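/- Let $m\ge 0$ and let $R_m$ be the ring of power series of bounded degree in $x_1,x_2,\dots$ over $\mathbb Q(q,t)$ that are symmetric in $x_{m+1},x_{m+2},\dots$. An $m$-partition is a pair $\Lambda=(\boldsymbol a;\lambda)$ with $\boldsymbol a=(a_1,\dots,a_m)\in\mathbb Z_{\ge0}^m$ and $\lambda$ a partition; it is dominant if $a_1\ge\dots\ge a_m$. Put $s_i\Lambda=(s_i\boldsymbol a;\lambda)$, where $s_i\boldsymbol a$ exchanges $a_i$ and $a_{i+1}$. For $1\le i<m$ let $T_i=t+\frac{tx_i-x_{i+1}}{x_i-x_{i+1}}(K_{i,i+1}-1)$ on $R_m$, where $K_{i,i+1}$ exchanges $x_i$ and $x_{i+1}$. The non-symmetric Hall–Littlewood polynomials are given by $H_{\boldsymbol a}=x^{\boldsymbol a}$ if $\boldsymbol a$ is dominant and $H_{\boldsymbol a}=T_iH_{s_i\boldsymbol a}$ if $a_i<a_{i+1}$. Let $k_\Lambda(x;t)=H_{\boldsymbol a}(x_1,\dots,x_m;t)\,s_\lambda(x)$, with $s_\lambda$ the Schur function in all of $x_1,x_2,\dots$; let $\langle\cdot,\cdot\rangle_m$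 be the bilinear form on $R_m$ with $\langle k_\Lambda,k_\Omega\rangle_m=\delta_{\Lambda\Omega}$, and $T_i^*$ the adjoint of $T_i$. For $\Lambda=(\boldsymbol a;\lambda)$ dominant and $\Omega=(\boldsymbol b;\mu)$, let $\mathcal S_{\Lambda\Omega}$ be the set of skew semistandard tableaux $T$ of shape $(\boldsymbol a\cup\lambda)/\mu$ in which each letter $i\in\{1,\dots,m\}$ appears $b_i$ times, always within the first $a_i$ columns; here $\boldsymbol a\cup\lambda$ is the partition whose parts are those of $\boldsymbol a$ and $\lambda$. For $T\in\mathcal S_{\Lambda\Omega}$ let $\bar T$ be the filling of $\mu/\lambda$ by letters $\bar 1>\bar2>\dots>\bar m$, increasing down columns, such that for $c\le a_i$ column $c$ of $\bar T$ contains $\bar i$ if and only if column $c$ of $T$ does not contain $i$ (and it contains no $\bar i$ with $c>a_i$). Let $\operatorname{Inv}(\boldsymbol b)=\#\{i<j: b_i<b_j\}$, $u_{\boldsymbol a}=\bar 1^{\,a_1-a_1}\bar 2^{\,a_1-a_2}\cdots\bar m^{\,a_1-a_m}$ and $$\operatorname{charge}_{\boldsymbol a,\boldsymbol b}(T)=\operatorname{Inv}(\boldsymbol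 b)+\operatorname{charge}(\bar T\,u_{\boldsymbol a}),$$ where $\bar T$ is read row by row from bottom to top, each row from left to right, $\bar i$ is replaced by $m+1-i$, and $\operatorname{charge}$ is the Lascoux–Schützenberger charge of words (extended to words of non-dominant evaluation through the Lascoux–Schützenberger action of the symmetric group on words). The dual $m$-symmetric Schur functions are defined by $$s^*_\Lambda=\sum_\Omega\Big(\sum_{T\in\mathcal S_{\Lambda\Omega}}t^{\operatorname{charge}_{\boldsymbol a,\boldsymbol b}(T)}\Big)k_\Omega(x;t)\ \text{ for }\Lambda\text{ dominant},\qquad s^*_\Lambda=t^{-1}T_i^*s^*_{s_i\Lambda}\ \text{ if } a_i<a_{i+1},$$ and the $m$-symmetric Schur functions $s_\Lambda\in R_m$ by $\langle s_\Lambda,s^*_\Omega\rangle_m=\delta_{\Lambda\Omega}$. **Proposition.** All these objects are well defined: the recursions for $H_{\boldsymbol a}$ and $s^*_\Lambda$ hold for every $i$ with $a_i<a_{i+1}$, and the form $\langle\cdot,\cdot\rangle_m$, the adjoints $T_i^*$ and the family $(s_\Lambda)$ exist and are unique. Let $i:R_m\to R_{m+1}$ be the inclusion, and let $r:R_{m+1}\to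 R_m$ be the restriction, which sets $x_{m+1}=0$ and then relabels $(x_{m+2},x_{m+3},\dots)\mapsto(x_{m+1},x_{m+2},\dots)$. 1. For every $m$-partition $\Lambda=(a_1,\dots,a_m;\lambda)$, $\ i(s^*_\Lambda)=s^*_{\Lambda^0}$ with $\Lambda^0=(a_1,\dots,a_m,0;\lambda)$. 2. Equivalently, by duality, for every $(m+1)$-partition $\Lambda=(a_1,\dots,a_{m+1};\lambda)$, $\ r(s_\Lambda)=0$ if $a_{m+1}>0$, and $r(s_\Lambda)=s_{(a_1,\dots,a_m;\lambda)}$ if $a_{m+1}=0$. -/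

import Mathlib

namespace MSym

open MvPowerSeries

/-! ## The base field and the ring of `m`-symmetric functions -/

/-- The field `ℚ(q,t)` of rational functions in two variables (`X 0` is `q`, `X 1` is `t`). -/
abbrev QT : Type := FractionRing (MvPolynomial (Fin 2) ℚ)

/-- The variable `t` of `ℚ(q,t)`. -/
noncomputable def tt : QT := algebraMap (MvPolynomial (Fin 2) ℚ) QT (MvPolynomial.X 1)

/-- Formal power series in `x_1, x_2, …` over `ℚ(q,t)`.
The variable `x_{j+1}` is `X j`, i.e. variables are numbered from `0`. -/
abbrev PS : Type := MvPowerSeries ℕ QT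

/-- The ring `R_m`: power series of bounded degree that are symmetric in
`x_{m+1}, x_{m+2}, …`. -/
noncomputable def R (m : ℕ) : Subalgebra QT PS where
  carrier := {f | (∀ i j : ℕ, m ≤ i → m ≤ j → renameEquiv QT (Equiv.swap i j) f = f) ∧
    ∃ N : ℕ, ∀ d : ℕ →₀ ℕ, N < d.degree → coeff d f = 0}
  mul_mem' := by
    rintro f g ⟨hf, N, hN⟩ ⟨hg, M, hM⟩
    refine ⟨fun i j hi hj => by rw [map_mul, hf i j hi hj, hg i j hi hj], N + M, fun d hd => ?_⟩
    classical
    rw [coeff_mul]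
    refine Finset.sum_eq_zero fun p hp => ?_
    have h : p.1.degree + p.2.degree = d.degree := by
      rw [← Finset.HasAntidiagonal.mem_antidiagonal.mp hp, map_add]
    rcases lt_or_ge N p.1.degree with h1 | h1
    · rw [hN _ h1, zero_mul]
    · rw [hM _ (by omega), mul_zero]
  add_mem' := by
    rintro f g ⟨hf, N, hN⟩ ⟨hg, M, hM⟩
    refine ⟨fun i j hi hj => by rw [map_add, hf i j hi hj, hg i j hi hj], N + M, fun d hd => ?_⟩
    rw [map_add, hN _ (by omega), hM _ (by omega), add_zero]
  algebraMap_mem' := by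
    intro r
    refine ⟨fun i j _ _ => AlgEquiv.commutes _ r, 0, fun d hd => ?_⟩
    classical
    rw [MvPowerSeries.algebraMap_apply, coeff_C, if_neg]
    · rintro rfl
      simp at hd

theorem R_le_succ (m : ℕ) : R m ≤ R (m + 1) := fun _ hf =>
  ⟨fun i j hi hj => hf.1 i j (by omega) (by omega), hf.2⟩

/-- The inclusion `i : R_m → R_{m+1}`. -/
noncomputable def incl (m : ℕ) : R m →ₐ[QT] R (m + 1) := Subalgebra.inclusion (R_le_succ m)

/-- The injection of `ℕ` into itself that misses exactly `m` and is increasing. -/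
def skip (m : ℕ) : ℕ ↪ ℕ where
  toFun j := if j < m then j else j + 1
  inj' := by
    intro a b h
    dsimp only at h
    split_ifs at h <;> omega

theorem skip_apply (m j : ℕ) : skip m j = if j < m then j else j + 1 := rfl

/-- The substitution `f(x_1,…,x_m,0,x_{m+2},x_{m+3},…)` followed by the relabelling
`(x_{m+2}, x_{m+3}, …) ↦ (x_{m+1}, x_{m+2}, …)`. -/
noncomputable def restrPS (m : ℕ) : PS →ₐ[QT] PS := killCompl (skip m)

theorem coeff_swap (i j : ℕ) (f : PS) (d : ℕ →₀ ℕ) :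
    coeff d (renameEquiv QT (Equiv.swap i j) f) = coeff (d.mapDomain (Equiv.swap i j)) f := by
  have h := coeff_embDomain_rename (Equiv.swap i j).toEmbedding f (d.mapDomain (Equiv.swap i j))
  have h2 : Finsupp.embDomain (Equiv.swap i j).toEmbedding (d.mapDomain (Equiv.swap i j)) = d := by
    rw [Finsupp.embDomain_eq_mapDomain, ← Finsupp.mapDomain_comp]
    have : (⇑(Equiv.swap i j).toEmbedding ∘ ⇑(Equiv.swap i j)) = id := by
      ext x; simp
    rw [this, Finsupp.mapDomain_id]
  rw [h2] at h
  exact h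

theorem restrPS_mem (m : ℕ) (f : PS) (hf : f ∈ R (m + 1)) : restrPS m f ∈ R m := by
  obtain ⟨hs, N, hN⟩ := hf
  refine ⟨fun i j hi hj => ?_, N, fun d hd => ?_⟩
  · ext d
    rw [coeff_swap, restrPS, coeff_killCompl, coeff_killCompl]
    have h := hs (skip m i) (skip m j) (by rw [skip_apply]; split_ifs <;> omega)
      (by rw [skip_apply]; split_ifs <;> omega)
    have h3 := congrArg (coeff (d.embDomain (skip m))) h
    rw [coeff_swap] at h3
    rw [← h3]
    congr 2
    rw [Finsupp.embDomain_eq_mapDomain, Finsupp.embDomain_eq_mapDomain, ← Finsupp.mapDomain_comp,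
      ← Finsupp.mapDomain_comp, (skip m).injective.swap_comp]
  · rw [restrPS, coeff_killCompl]
    apply hN
    rw [Finsupp.embDomain_eq_mapDomain, Finsupp.degree_mapDomain]
    exact hd

/-- The restriction `r : R_{m+1} → R_m`. -/
noncomputable def restr (m : ℕ) : R (m + 1) →ₐ[QT] R m :=
  ((restrPS m).comp (R (m + 1)).val).codRestrict (R m) fun f => restrPS_mem m f f.2

/-! ## The Hecke operators -/

theorem mapDomain_swap_apply (i j : ℕ) (d : ℕ →₀ ℕ) (x : ℕ) :
    d.mapDomain (Equiv.swap i j) x = d (Equiv.swap i j x) := by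
  conv_lhs => rw [← Equiv.swap_apply_self i j x]
  exact Finsupp.mapDomain_apply (Equiv.swap i j).injective d _

/-- The divided difference `f ↦ (f - K_{ij} f) / (x_i - x_j)` on power series, where `K_{ij}`
exchanges `x_i` and `x_j`, through its coefficients; see `dividedDiff_spec`. -/
noncomputable def dividedDiffFun (i j : ℕ) (f : PS) : PS := fun d =>
  ∑ k ∈ Finset.range (d j + 1),
    coeff (d + Finsupp.single i (k + 1) - Finsupp.single j k)
      (f - renameEquiv QT (Equiv.swap i j) f)

theorem coeff_dividedDiffFun (i j : ℕ) (f : PS) (d : ℕ →₀ ℕ) :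
    coeff d (dividedDiffFun i j f) = ∑ k ∈ Finset.range (d j + 1),
      coeff (d + Finsupp.single i (k + 1) - Finsupp.single j k)
        (f - renameEquiv QT (Equiv.swap i j) f) := rfl

/-- `dividedDiffFun` as a linear map. -/
noncomputable def dividedDiff (i j : ℕ) : PS →ₗ[QT] PS where
  toFun := dividedDiffFun i j
  map_add' f g := by
    ext d
    rw [map_add, coeff_dividedDiffFun, coeff_dividedDiffFun, coeff_dividedDiffFun,
      ← Finset.sum_add_distrib]
    refine Finset.sum_congr rfl fun k _ => ?_
    simp only [map_add, map_sub]
    ring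
  map_smul' c f := by
    ext d
    rw [RingHom.id_apply, map_smul, coeff_dividedDiffFun, coeff_dividedDiffFun, smul_eq_mul,
      Finset.mul_sum]
    refine Finset.sum_congr rfl fun k _ => ?_
    simp only [map_smul, map_sub, smul_eq_mul]
    ring

theorem coeff_dividedDiff (i j : ℕ) (f : PS) (d : ℕ →₀ ℕ) :
    coeff d (dividedDiff i j f) = ∑ k ∈ Finset.range (d j + 1),
      coeff (d + Finsupp.single i (k + 1) - Finsupp.single j k)
        (f - renameEquiv QT (Equiv.swap i j) f) := rfl

theorem coeff_X_mul_of_pos (i : ℕ) (g : PS) (d : ℕ →₀ ℕ) (h : d i ≠ 0) :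
    coeff d (X i * g) = coeff (d - Finsupp.single i 1) g := by
  classical
  have h1 : Finsupp.single i 1 + (d - Finsupp.single i 1) = d :=
    add_tsub_cancel_of_le (Finsupp.single_le_iff.mpr (Nat.one_le_iff_ne_zero.mpr h))
  conv_lhs => rw [← h1]
  rw [X, coeff_add_monomial_mul, one_mul]

theorem coeff_X_mul_of_zero (i : ℕ) (g : PS) (d : ℕ →₀ ℕ) (h : d i = 0) :
    coeff d (X i * g) = 0 := by
  classical
  rw [X, coeff_monomial_mul, if_neg]
  intro h1
  have := h1 i
  simp at this
  omega

/-- `dividedDiff` is the divided difference. -/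
theorem dividedDiff_spec (i j : ℕ) (hij : i ≠ j) (f : PS) :
    (X i - X j) * dividedDiff i j f = f - renameEquiv QT (Equiv.swap i j) f := by
  set F : PS := f - renameEquiv QT (Equiv.swap i j) f with hF
  have hanti : ∀ d : ℕ →₀ ℕ, coeff (d.mapDomain (Equiv.swap i j)) F = - coeff d F := by
    intro d
    rw [hF, map_sub, map_sub, coeff_swap, coeff_swap, ← Finsupp.mapDomain_comp]
    have : (⇑(Equiv.swap i j) ∘ ⇑(Equiv.swap i j)) = id := by
      ext x; simp
    rw [this, Finsupp.mapDomain_id]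
    ring
  ext d
  set u : ℕ → (ℕ →₀ ℕ) := fun k => d + Finsupp.single i k - Finsupp.single j k with hu
  have hB : coeff d (X j * dividedDiff i j f) = ∑ k ∈ Finset.range (d j), coeff (u (k + 1)) F := by
    by_cases h : d j = 0
    · rw [coeff_X_mul_of_zero _ _ _ h, h]; simp
    · rw [coeff_X_mul_of_pos _ _ _ h, coeff_dividedDiff]
      have h2 : (d - Finsupp.single j 1 : ℕ →₀ ℕ) j + 1 = d j := by simp; omega
      rw [h2]
      refine Finset.sum_congr rfl fun k _ => ?_
      congr 2
      ext x
      simp only [hu, Finsupp.coe_add, Finsupp.coe_tsub, Pi.add_apply, Pi.sub_apply,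
        Finsupp.single_apply]
      split_ifs <;> omega
  rw [sub_mul, map_sub, hB]
  by_cases h : d i = 0
  · rw [coeff_X_mul_of_zero _ _ _ h]
    have hsum : ∑ k ∈ Finset.range (d j + 1), coeff (u k) F = 0 := by
      have h1 : ∑ k ∈ Finset.range (d j + 1), coeff (u k) F
          = - ∑ k ∈ Finset.range (d j + 1), coeff (u k) F := by
        conv_lhs => rw [← Finset.sum_range_reflect]
        rw [← Finset.sum_neg_distrib]
        refine Finset.sum_congr rfl fun k hk => ?_
        rw [Finset.mem_range] at hk
        rw [← hanti]
        congr 2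
        ext x
        rw [mapDomain_swap_apply]
        simp only [hu, Finsupp.coe_add, Finsupp.coe_tsub, Pi.add_apply, Pi.sub_apply,
          Finsupp.single_apply]
        rcases eq_or_ne x i with rfl | hxi
        · rw [Equiv.swap_apply_left]; simp [hij, hij.symm]; omega
        rcases eq_or_ne x j with rfl | hxj
        · rw [Equiv.swap_apply_right]; simp [hij, hij.symm]; omega
        · rw [Equiv.swap_apply_of_ne_of_ne hxi hxj]
          simp [hxi.symm, hxj.symm]
      exact self_eq_neg.mp h1
    rw [Finset.sum_range_succ'] at hsum
    have hu0 : u 0 = d := by simp [hu]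
    rw [hu0] at hsum
    linear_combination -hsum
  · rw [coeff_X_mul_of_pos _ _ _ h, coeff_dividedDiff]
    have h2 : (d - Finsupp.single i 1 : ℕ →₀ ℕ) j = d j := by simp [hij]
    rw [h2]
    have hA : ∑ k ∈ Finset.range (d j + 1), coeff (d - Finsupp.single i 1 + Finsupp.single i (k + 1)
        - Finsupp.single j k) F = ∑ k ∈ Finset.range (d j + 1), coeff (u k) F := by
      refine Finset.sum_congr rfl fun k _ => ?_
      congr 2
      ext x
      simp only [hu, Finsupp.coe_add, Finsupp.coe_tsub, Pi.add_apply, Pi.sub_apply,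
        Finsupp.single_apply]
      split_ifs with h3 h4 h4
      all_goals first | omega | (subst h3; omega)
    rw [hA, Finset.sum_range_succ']
    have hu0 : u 0 = d := by simp [hu]
    rw [hu0]
    ring

theorem dividedDiff_mem (m i j : ℕ) (hij : i ≠ j) (hi : i < m) (hj : j < m) (f : PS)
    (hf : f ∈ R m) : dividedDiff i j f ∈ R m := by
  obtain ⟨hs, N, hN⟩ := hf
  refine ⟨fun k l hk hl => ?_, N, fun d hd => ?_⟩
  · have hXi : ∀ x : ℕ, x < m → renameEquiv QT (Equiv.swap k l) (X x : PS) = X x := by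
      intro x hx
      change rename _ _ = _
      rw [rename_X, Equiv.swap_apply_of_ne_of_ne (by omega) (by omega)]
    have hcomm : renameEquiv QT (Equiv.swap k l) (renameEquiv QT (Equiv.swap i j) f)
        = renameEquiv QT (Equiv.swap i j) f := by
      conv_rhs => rw [← hs k l hk hl]
      ext d
      rw [coeff_swap, coeff_swap, coeff_swap, coeff_swap, ← Finsupp.mapDomain_comp,
        ← Finsupp.mapDomain_comp]
      congr 2
      have hc : Equiv.swap i j * Equiv.swap k l = Equiv.swap k l * Equiv.swap i j := by
        apply Equiv.Perm.Disjoint.commute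
        intro x
        by_cases hx : x < m
        · right; exact Equiv.swap_apply_of_ne_of_ne (by omega) (by omega)
        · left; exact Equiv.swap_apply_of_ne_of_ne (by omega) (by omega)
      exact congrArg (fun e : ℕ → ℕ => Finsupp.mapDomain e d)
        (congrArg (fun e : Equiv.Perm ℕ => (e : ℕ → ℕ)) hc)
    have h1 := dividedDiff_spec i j hij f
    have h2 := congrArg (renameEquiv QT (Equiv.swap k l)) h1
    rw [map_mul, map_sub, map_sub, hXi i hi, hXi j hj, hcomm, hs k l hk hl, ← h1] at h2
    refine mul_left_cancel₀ (sub_ne_zero.mpr ?_) h2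
    intro h3
    have h4 := congrArg (coeff (Finsupp.single i 1)) h3
    classical
    rw [coeff_index_single_X, coeff_index_single_X] at h4
    simp [hij] at h4
  · rw [coeff_dividedDiff]
    refine Finset.sum_eq_zero fun k hk => ?_
    rw [Finset.mem_range] at hk
    have hle : Finsupp.single j k ≤ d + Finsupp.single i (k + 1) := by
      rw [Finsupp.single_le_iff]
      simp [hij]
      omega
    have hdeg : (d + Finsupp.single i (k + 1) - Finsupp.single j k).degree = d.degree + 1 := by
      have h5 := congrArg Finsupp.degree (tsub_add_cancel_of_le hle)
      simp only [map_add, Finsupp.degree_single] at h5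
      omega
    rw [map_sub, coeff_swap, hN _ (by omega), hN _ (by rw [Finsupp.degree_mapDomain]; omega),
      sub_zero]

/-- The Hecke operator `T f = t f + (t x_i - x_{i+1}) / (x_i - x_{i+1}) (K_{i,i+1} f - f)` on
`R_m`, for two consecutive variables `X i`, `X (i+1)` among the first `m` ones. -/
noncomputable def heckeT (m i : ℕ) (hi : i + 1 < m) : R m →ₗ[QT] R m where
  toFun f := ⟨tt • (f : PS) - (C tt * X i - X (i + 1)) * dividedDiff i (i + 1) (f : PS), by
    have hX : ∀ x : ℕ, x < m → (X x : PS) ∈ R m := by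
      intro x hx
      refine ⟨fun k l hk hl => ?_, 1, fun d hd => ?_⟩
      · change rename _ _ = _
        rw [rename_X, Equiv.swap_apply_of_ne_of_ne (by omega) (by omega)]
      · classical
        rw [coeff_X, if_neg]
        rintro rfl
        simp at hd
    have hC : (C tt : PS) ∈ R m := (R m).algebraMap_mem tt
    exact sub_mem (Subalgebra.smul_mem _ f.2 _) (mul_mem (sub_mem (mul_mem hC (hX i (by omega)))
      (hX (i + 1) hi)) (dividedDiff_mem m i (i + 1) (by omega) (by omega) hi f f.2))⟩
  map_add' f g := by
    ext1
    simp only [Subalgebra.coe_add, map_add, smul_add]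
    ring
  map_smul' c f := by
    ext1
    simp only [SetLike.val_smul, map_smul, RingHom.id_apply, smul_sub, mul_smul_comm]
    rw [smul_comm]

/-! ## `m`-partitions and the functions `k_Λ(x;t)` -/

/-- An `m`-partition `Λ = (a; λ)`: a composition `a` with `m` parts and a partition `λ`
(given by its Young diagram). -/
@[ext]
structure MPart (m : ℕ) where
  a : Fin m → ℕ
  lam : YoungDiagram

/-- `Λ ↦ Λ⁰ = (a_1,…,a_m,0;λ)`. -/
def MPart.snocZero {m : ℕ} (Λ : MPart m) : MPart (m + 1) := ⟨Fin.snoc Λ.a 0, Λ.lam⟩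

/-- `Λ ↦ Λ_- = (a_1,…,a_m;λ)` for `Λ = (a_1,…,a_{m+1};λ)`. -/
def MPart.init {m : ℕ} (Λ : MPart (m + 1)) : MPart m := ⟨Fin.init Λ.a, Λ.lam⟩

/-- `a_i < a_{i+1}` (with indices counted from `0`). -/
def IsAscent {m : ℕ} (a : Fin m → ℕ) (i : ℕ) : Prop :=
  ∃ h : i + 1 < m, a ⟨i, by omega⟩ < a ⟨i + 1, h⟩

/-- `s_i a`: exchange of the entries `a_i` and `a_{i+1}`. -/
def swapAt {m : ℕ} (a : Fin m → ℕ) (i : ℕ) (h : i + 1 < m) : Fin m → ℕ :=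
  a ∘ Equiv.swap ⟨i, by omega⟩ ⟨i + 1, h⟩

/-- Termination measure for sorting a composition. -/
def sortMeasure {m : ℕ} (a : Fin m → ℕ) : ℕ := ∑ j : Fin m, (j : ℕ) * a j

theorem sortMeasure_swapAt {m : ℕ} (a : Fin m → ℕ) (i : ℕ) (h : IsAscent a i) :
    sortMeasure (swapAt a i h.1) < sortMeasure a := by
  obtain ⟨hi, hlt⟩ := h
  have hne : (⟨i, by omega⟩ : Fin m) ≠ ⟨i + 1, hi⟩ := by simp
  unfold sortMeasure
  rw [← Finset.add_sum_erase _ _ (Finset.mem_univ (⟨i, by omega⟩ : Fin m)),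
    ← Finset.add_sum_erase _ _ (Finset.mem_univ (⟨i, by omega⟩ : Fin m)),
    ← Finset.add_sum_erase _ _ (Finset.mem_erase.mpr ⟨hne.symm, Finset.mem_univ _⟩),
    ← Finset.add_sum_erase _ _ (Finset.mem_erase.mpr ⟨hne.symm, Finset.mem_univ _⟩)]
  have hrest : ∑ x ∈ (Finset.univ.erase (⟨i, by omega⟩ : Fin m)).erase ⟨i + 1, hi⟩,
      (x : ℕ) * swapAt a i hi x = ∑ x ∈ (Finset.univ.erase (⟨i, by omega⟩ : Fin m)).erase
        ⟨i + 1, hi⟩, (x : ℕ) * a x := by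
    refine Finset.sum_congr rfl fun x hx => ?_
    simp only [Finset.mem_erase] at hx
    simp only [swapAt, Function.comp, Equiv.swap_apply_of_ne_of_ne hx.2.1 hx.1]
  rw [hrest]
  simp only [swapAt, Function.comp, Equiv.swap_apply_left, Equiv.swap_apply_right]
  nlinarith

/-- The monomial `x^a = x_1^{a_1} ⋯ x_m^{a_m}` as an element of `R_m`. -/
noncomputable def xPow {m : ℕ} (a : Fin m → ℕ) : R m :=
  ⟨monomial (Finsupp.embDomain Fin.valEmbedding (Finsupp.equivFunOnFinite.symm a)) 1, by
    refine ⟨fun i j hi hj => ?_,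
      (Finsupp.embDomain Fin.valEmbedding (Finsupp.equivFunOnFinite.symm a)).degree,
      fun d hd => ?_⟩
    · change rename _ _ = _
      have hfix : (⇑(Equiv.swap i j) ∘ ⇑(Fin.valEmbedding (n := m))) = ⇑Fin.valEmbedding := by
        ext x
        have hx := x.2
        exact Equiv.swap_apply_of_ne_of_ne (by simp; omega) (by simp; omega)
      rw [rename_monomial, Finsupp.embDomain_eq_mapDomain, ← Finsupp.mapDomain_comp, hfix]
    · classical
      rw [coeff_monomial, if_neg]
      rintro rfl
      exact lt_irrefl _ hd⟩

open Classical in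
/-- The non-symmetric Hall-Littlewood polynomial `H_a(x_1,…,x_m;t)`: it is `x^a` if `a` is
dominant, and `H_{s_i a} = T_i H_a` whenever `a_i > a_{i+1}`.  (The recursion below uses the first
`i` with `a_i < a_{i+1}`.) -/
noncomputable def hallLittlewood {m : ℕ} (a : Fin m → ℕ) : R m :=
  if h : ∃ i, IsAscent a i then
    heckeT m (Nat.find h) (Nat.find_spec h).1 (hallLittlewood (swapAt a (Nat.find h)
      (Nat.find_spec h).1))
  else xPow a
termination_by sortMeasure a
decreasing_by exact sortMeasure_swapAt a _ (Nat.find_spec h)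

/-- The complete homogeneous symmetric function `h_r(x_1,x_2,…)`, the sum of all monomials of
degree `r`; it is `0` for `r < 0`. -/
noncomputable def hPS (r : ℤ) : PS := fun d => if (d.degree : ℤ) = r then 1 else 0

theorem coeff_hPS (r : ℤ) (d : ℕ →₀ ℕ) :
    coeff d (hPS r) = if (d.degree : ℤ) = r then 1 else 0 := rfl

/-- `h_r(x_1,x_2,…)` as an element of `R_m`. -/
noncomputable def hFun (m : ℕ) (r : ℤ) : R m :=
  ⟨hPS r, by
    refine ⟨fun i j _ _ => ?_, r.toNat, fun d hd => ?_⟩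
    · ext d
      rw [coeff_swap, coeff_hPS, coeff_hPS, Finsupp.degree_mapDomain]
    · rw [coeff_hPS, if_neg (by omega)]⟩

/-- The Schur function `s_λ(x) = det (h_{λ_i - i + j})` in all the variables `x_1, x_2, …`, as an
element of `R_m`. -/
noncomputable def schurFn (m : ℕ) (lam : YoungDiagram) : R m :=
  Matrix.det (Matrix.of fun i j : Fin (lam.colLen 0) =>
    hFun m ((lam.rowLen i : ℤ) - (i : ℤ) + (j : ℤ)))

/-- `k_Λ(x;t) = H_a(x_1,…,x_m;t) s_λ(x)`. -/
noncomputable def kFun {m : ℕ} (Λ : MPart m) : R m := hallLittlewood Λ.a * schurFn m Λ.lam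

/-! ## The action of the symmetric group on words, and the charge -/

/-- One step of the marriage process for the letters `i`, `i+1` of a word.  The stack `st` holds
the positions (last one first) of the so far unmarried letters, `p` is the next letter together
with its position: an `i` marries an unmarried `i+1` directly before it. -/
def marryStep (i : ℕ) (st : List (ℕ × ℕ)) (p : ℕ × ℕ) : List (ℕ × ℕ) :=
  if p.1 = i + 1 then p :: st
  else if p.1 = i then
    match st with
    | [] => [p]
    | b :: rest => if b.1 = i + 1 then rest else p :: b :: rest
  else st

/-- The (letter, position) pairs of the letters `i`, `i+1` of `w` that stay unmarried, from left
to right, once factors `(i+1) i` have been married as long as possible. -/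
def unmarried (i : ℕ) (w : List ℕ) : List (ℕ × ℕ) :=
  (w.zipIdx.foldl (marryStep i) []).reverse

/-- The operator `σ_i` on words: the unmarried subword `i^r (i+1)^s` becomes `i^s (i+1)^r`. -/
def wordSigma (i : ℕ) (w : List ℕ) : List ℕ :=
  let pos := (unmarried i w).map Prod.snd
  let s := (unmarried i w).countP fun p => p.1 = i + 1
  w.mapIdx fun p x => if p ∈ pos then (if pos.idxOf p < s then i else i + 1) else x

/-- Apply `σ_i` if the letter `i` appears less often than `i+1`. -/
def condSigma (w : List ℕ) (i : ℕ) : List ℕ :=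
  if w.count i < w.count (i + 1) then wordSigma i w else w

/-- Act with the symmetric group on a word in the letters `0,…,m-1` so that its evaluation becomes
dominant (insertion sort of the evaluation). -/
def makeDominant (m : ℕ) (w : List ℕ) : List ℕ :=
  (List.range m).foldl (fun w k => (List.range k).reverse.foldl condSigma w) w

/-- One round of the charge labelling.  The unlabelled letters of the word, in the order in which
they are read, are `before ++ after`, where the reading head stands in front of `after`; `k` is the
next letter to be labelled, `l` the current label and `n` a bound on the number of steps.
Returns the sum of the labels and the word of the letters left unlabelled. -/
def chargeRound : (n k l : ℕ) → (before after : List ℕ) → ℕ × List ℕ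
  | 0, _, _, before, after => (0, before ++ after)
  | n + 1, k, l, before, after =>
    if k ∈ after then
      let res := chargeRound n (k + 1) l (before ++ after.takeWhile (· ≠ k))
        (after.dropWhile (· ≠ k)).tail
      (l + res.1, res.2)
    else if k ∈ before then
      let res := chargeRound n (k + 1) (l + 1) (before.takeWhile (· ≠ k))
        ((before.dropWhile (· ≠ k)).tail ++ after)
      (l + 1 + res.1, res.2)
    else (0, before ++ after)

/-- At most `n` rounds of charge labelling, each one starting from the smallest letter `0` at the
beginning of the reading. -/
def chargeRounds : (n : ℕ) → List ℕ → ℕ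
  | 0, _ => 0
  | n + 1, w =>
    let res := chargeRound w.length 0 0 [] w
    res.1 + chargeRounds n res.2

/-- The charge of a word in the letters `0,…,m-1`; the word is read from right to left. -/
def charge (m : ℕ) (w : List ℕ) : ℕ := chargeRounds w.length (makeDominant m w).reverse

/-! ## Tableaux and the coefficients of the dual `m`-symmetric Schur functions -/

/-- The partition `a ∪ λ` obtained by reordering the entries of `a` and `λ`: in its diagram, the
length of column `c` is the number of entries of `a` and of `λ` that exceed `c`
(columns are counted from `0`). -/
def cup {m : ℕ} (a : Fin m → ℕ) (lam : YoungDiagram) : YoungDiagram where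
  cells := (Finset.range (lam.colLen 0 + m) ×ˢ
    Finset.range (lam.rowLen 0 + Finset.univ.sup a)).filter fun x =>
      x.1 < lam.colLen x.2 + (Finset.univ.filter fun i => x.2 < a i).card
  isLowerSet := by
    intro x y hxy hx
    simp only [Finset.coe_filter, Finset.mem_product, Finset.mem_range, Set.mem_ofPred_eq] at hx ⊢
    have h1 : y.1 ≤ x.1 := hxy.1
    have h2 : y.2 ≤ x.2 := hxy.2
    have h3 := lam.colLen_anti y.2 x.2 h2
    have h4 : (Finset.univ.filter fun i => x.2 < a i).card ≤
        (Finset.univ.filter fun i => y.2 < a i).card := by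
      refine Finset.card_le_card fun i hi => ?_
      simp only [Finset.mem_filter, Finset.mem_univ, true_and] at hi ⊢
      omega
    exact ⟨⟨by omega, by omega⟩, by omega⟩

theorem mem_cup {m : ℕ} (a : Fin m → ℕ) (lam : YoungDiagram) (x : ℕ × ℕ) :
    x ∈ cup a lam ↔ x.1 < lam.colLen x.2 + (Finset.univ.filter fun i => x.2 < a i).card := by
  rw [← YoungDiagram.mem_cells]
  simp only [cup, Finset.mem_filter, Finset.mem_product, Finset.mem_range, and_iff_right_iff_imp]
  intro hx
  have h3 := lam.colLen_anti 0 x.2 (Nat.zero_le _)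
  have h4 : (Finset.univ.filter fun i => x.2 < a i).card ≤ m := by
    simpa using Finset.card_le_univ (Finset.univ.filter fun i => x.2 < a i)
  refine ⟨by omega, ?_⟩
  by_contra hlt
  have h5 : lam.colLen x.2 = 0 := by
    by_contra h6
    have h7 : (0, x.2) ∈ lam := YoungDiagram.mem_iff_lt_colLen.mpr (Nat.pos_of_ne_zero h6)
    rw [YoungDiagram.mem_iff_lt_rowLen] at h7
    omega
  have h8 : (Finset.univ.filter fun i => x.2 < a i) = ∅ := by
    refine Finset.filter_eq_empty_iff.mpr fun i _ => ?_
    have := Finset.le_sup (f := a) (Finset.mem_univ i)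
    omega
  rw [h5, h8] at hx
  simp at hx

/-- Fillings of the cells of the skew shape `(a ∪ λ)/μ` with the letters `1,…,m`
(numbered from `0`), for `Λ = (a;λ)` and `Ω = (b;μ)`. -/
abbrev Filling {m : ℕ} (Λ Ω : MPart m) : Type :=
  ↥((cup Λ.a Λ.lam).cells \ Ω.lam.cells) → Fin m

/-- The filling `T` belongs to `S_{ΛΩ}`: `μ` is contained in `a ∪ λ`, `T` is a skew tableau,
the letter `i` appears `b_i` times in `T`, and always within the first `a_i` columns. -/
structure IsTableau {m : ℕ} (Λ Ω : MPart m) (T : Filling Λ Ω) : Prop where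
  contained : Ω.lam ≤ cup Λ.a Λ.lam
  row_weak : ∀ x y, x.1.1 = y.1.1 → x.1.2 < y.1.2 → T x ≤ T y
  col_strict : ∀ x y, x.1.2 = y.1.2 → x.1.1 < y.1.1 → T x < T y
  content : ∀ i, (Finset.univ.filter fun x => T x = i).card = Ω.a i
  bounded : ∀ x, x.1.2 < Λ.a (T x)

/-- The letters `i` such that column `c` is among the first `a_i` columns but does not contain `i`
in `T`, from the largest to the smallest `i`.  With a bar over every letter, and the order
`1̄ > 2̄ > ⋯ > m̄`, this is column `c` of the tableau `T̄` of shape `μ/λ`, from top to bottom. -/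
def barColumn {m : ℕ} {Λ Ω : MPart m} (T : Filling Λ Ω) (c : ℕ) : List (Fin m) :=
  (Finset.univ.filter fun i => c < Λ.a i ∧ ∀ x, x.1.2 = c → T x ≠ i).sort (· ≥ ·)

/-- The word of the skew tableau `T̄` of shape `μ/λ`: its rows are read from bottom to top, every
row from left to right. (The letter `i` of `Fin m` stands for the barred letter.) -/
def barWord {m : ℕ} {Λ Ω : MPart m} (T : Filling Λ Ω) : List (Fin m) :=
  (List.range (Ω.lam.colLen 0)).reverse.flatMap fun r =>
    (List.range' (Λ.lam.rowLen r) (Ω.lam.rowLen r - Λ.lam.rowLen r)).filterMap fun c =>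
      (barColumn T c)[r - Λ.lam.colLen c]?

/-- The word `u_a`, the concatenation of the `ī^{a_1 - a_i}` for `i = 1,…,m`.
For dominant `a`, the first entry `a_1` is the largest entry. -/
def uWord {m : ℕ} (a : Fin m → ℕ) : List (Fin m) :=
  (List.finRange m).flatMap fun i => List.replicate (Finset.univ.sup a - a i) i

/-- `Inv(b) = #{i < j | b_i < b_j}`. -/
def inv {m : ℕ} (b : Fin m → ℕ) : ℕ :=
  (Finset.univ.filter fun p : Fin m × Fin m => p.1 < p.2 ∧ b p.1 < b p.2).card

/-- `charge_{a,b}(T) = Inv(b) + charge(T̄ u_a)`; a word in the barred letters is turned into an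
ordinary word by `ī ↦ m + 1 - i`, which is `Fin.rev` for letters numbered from `0`. -/
def tableauCharge {m : ℕ} {Λ Ω : MPart m} (T : Filling Λ Ω) : ℕ :=
  inv Ω.a + charge m ((barWord T ++ uWord Λ.a).map fun i => (Fin.rev i : ℕ))

open Classical in
/-- `D_{ΛΩ}(t)` for dominant `Λ`: the sum of `t ^ charge_{a,b}(T)` over `T ∈ S_{ΛΩ}`. -/
noncomputable def dominantD {m : ℕ} (Λ Ω : MPart m) : QT :=
  ∑ T : Filling Λ Ω with IsTableau Λ Ω T, tt ^ tableauCharge T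

/-! ## The scalar product, the adjoint Hecke operators, and the (dual) `m`-symmetric Schur functions -/

open Classical in
/-- The bilinear form `B` on `R_m` makes the `k_Λ(x;t)` self-dual. -/
def IsScalarProduct (m : ℕ) (B : R m →ₗ[QT] R m →ₗ[QT] QT) : Prop :=
  ∀ Λ Ω : MPart m, B (kFun Λ) (kFun Ω) = if Λ = Ω then 1 else 0

/-- The scalar product `⟨·,·⟩_m`, i.e. the bilinear form with `IsScalarProduct`. -/
noncomputable def scalarProduct (m : ℕ) : R m →ₗ[QT] R m →ₗ[QT] QT :=
  Classical.epsilon (IsScalarProduct m)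

/-- `S` is adjoint to the Hecke operator `T_i` with respect to `⟨·,·⟩_m`. -/
def IsHeckeAdjoint (m i : ℕ) (hi : i + 1 < m) (S : R m →ₗ[QT] R m) : Prop :=
  ∀ f g : R m, scalarProduct m (heckeT m i hi f) g = scalarProduct m f (S g)

/-- The adjoint `T_i^*` of `T_i`. -/
noncomputable def heckeTStar (m i : ℕ) (hi : i + 1 < m) : R m →ₗ[QT] R m :=
  Classical.epsilon (IsHeckeAdjoint m i hi)

open Classical in
/-- The dual `m`-symmetric Schur function `s^*_Λ(x;t)`: it is `∑_Ω D_{ΛΩ}(t) k_Ω(x;t)` (a sum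
with finitely many non-zero terms) if `Λ` is dominant, and `t⁻¹ T_i^* s^*_{s_i Λ}(x;t)` if
`a_i < a_{i+1}`.  (The recursion below uses the first such `i`.) -/
noncomputable def dualSchur {m : ℕ} (Λ : MPart m) : R m :=
  if h : ∃ i, IsAscent Λ.a i then
    tt⁻¹ • heckeTStar m (Nat.find h) (Nat.find_spec h).1
      (dualSchur ⟨swapAt Λ.a (Nat.find h) (Nat.find_spec h).1, Λ.lam⟩)
  else ∑ᶠ Ω : MPart m, dominantD Λ Ω • kFun Ω
termination_by sortMeasure Λ.a
decreasing_by exact sortMeasure_swapAt Λ.a _ (Nat.find_spec h)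

open Classical in
/-- The family `s` is dual to the family of the `s^*_Ω(x;t)` with respect to `⟨·,·⟩_m`. -/
def IsSchurFamily (m : ℕ) (s : MPart m → R m) : Prop :=
  ∀ Λ Ω : MPart m, scalarProduct m (s Λ) (dualSchur Ω) = if Λ = Ω then 1 else 0

/-- The `m`-symmetric Schur functions `s_Λ(x;t)`. -/
noncomputable def schur {m : ℕ} : MPart m → R m := Classical.epsilon (IsSchurFamily m)

end MSym

/-! The basis of the k_Λ controls everything. The inclusion i sends k_Λ to k_{Λ⁰}, and r sends k_Λ
to 0 if a_{m+1} > 0 and to the k of the truncated index if a_{m+1} = 0. The first claim holds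
because the formulas of T_i and s_λ do not involve m, the second because x_{m+1} divides H_a when
a_{m+1} > 0. Hence r and i are adjoint (`scalarProduct_restr`), and the statement about s_Λ follows
by duality from the one about s^*_Λ.

For dominant Λ the coefficients of s^*_Λ and s^*_{Λ⁰} must be compared. The letter m+1 is confined
to the first 0 columns, so it never occurs: only indices Ω⁰ contribute, the tableaux are the same,
and so are the fillings T̄. Only the word u changes: it gains a_1 barred letters m+1 at its end. In
ordinary letters, the old word is raised by one and a_1 zeros are appended. No old letter occurs
more than a_1 times, so the sorting of the evaluation never touches the zeros. Since words are read
from the right, each round of labelling starts with an appended zero of label 0 and then runs as the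
old round did. So the charge does not change (`charge_shiftWord`, `tableauCharge_liftFilling`). The
non-dominant case follows because i commutes with T_i^* for i < m (`incl_heckeTStar`).

Well-definedness rests on three facts. First, the T_i satisfy the braid and commutation relations,
hence so do the T_i^*, and then a recursion along one ascent holds along every ascent
(`recursion_of_braid`). Second, the k_Λ form a basis of R_m. They span because R_m is generated by
x_1, …, x_m and the h_n (`monoFun_mem_genAlg`), monomials are combinations of the H_a
(`xPow_mem_hallSpan`), and products of the h_n are combinations of Schur functions
(`hProd_mem_schurSpan`). They are independent because they are homogeneous and there are as many of
them in each degree as monomial functions. Third, s^*_Λ is a nonzero multiple of k_Λ plus terms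
k_{(b;μ)} with |b| < |a| (`dualSchur_triangular`), so the s^*_Λ also span and have a unique dual
family. -/

namespace MSym
open MvPowerSeries

/-! ## Relations between the Hecke operators -/

/-- The two sides of the braid relation agree for operators of Demazure–Lusztig type. -/
theorem braid_of_exchange {A : Type*} [CommRing A] [IsDomain A] {x y z t : A}
    (hxy : x - y ≠ 0) (hxz : x - z ≠ 0) (hyz : y - z ≠ 0) {K₁ K₂ : A →+* A} {T₁ T₂ : A → A}
    (hx₁ : K₁ x = y) (hy₁ : K₁ y = x) (hz₁ : K₁ z = z) (ht₁ : K₁ t = t)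
    (hx₂ : K₂ x = x) (hy₂ : K₂ y = z) (hz₂ : K₂ z = y) (ht₂ : K₂ t = t)
    (hK₁ : ∀ f, K₁ (K₁ f) = f) (hK₂ : ∀ f, K₂ (K₂ f) = f)
    (hK : ∀ f, K₁ (K₂ (K₁ f)) = K₂ (K₁ (K₂ f)))
    (h₁ : ∀ f, (x - y) * T₁ f = (1 - t) * y * f + (t * x - y) * K₁ f)
    (h₂ : ∀ f, (y - z) * T₂ f = (1 - t) * z * f + (t * y - z) * K₂ f) (f : A) :
    T₁ (T₂ (T₁ f)) = T₂ (T₁ (T₂ f)) := by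
  -- The defining relations along the words T₁T₂T₁ and T₂T₁T₂, and their images under the exchanges.
  -- The primed relations are those with the roles of 1 and 2 interchanged.
  have g1 := h₁ f
  have g2 := congrArg K₁ g1
  have g3 := congrArg K₂ g1
  have g4 := congrArg K₁ g3
  have h5 := h₂ (T₁ f)
  have h6 := congrArg K₁ h5
  have h7 := h₁ (T₂ (T₁ f))
  have g1' := h₂ f
  have g2' := congrArg K₂ g1'
  have g3' := congrArg K₁ g1'
  have g4' := congrArg K₂ g3'
  have h5' := h₁ (T₂ f)
  have h6' := congrArg K₂ h5'
  have h7' := h₂ (T₁ (T₂ f))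
  simp only [map_add, map_sub, map_mul, map_one, hx₁, hy₁, hz₁, ht₁, hx₂, hy₂, hz₂, ht₂, hK₁, hK₂,
    hK] at g1 g2 g3 g4 h5 h6 h7 g1' g2' g3' g4' h5' h6' h7'
  -- A common denominator of both sides; x - z enters because K₂ turns x - y into x - z.
  refine mul_left_cancel₀ (mul_ne_zero (mul_ne_zero (pow_ne_zero 2 hxy) (pow_ne_zero 2 hyz)) hxz) ?_
  have e1 : (x - y) ^ 2 * (y - z) * (x - z) * T₁ (T₂ (T₁ f)) =
      (1 - t) * y * (x - z) * (1 - t) * z * ((1 - t) * y * f + (t * x - y) * K₁ f)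
      + (1 - t) * y * (x - y) * (t * y - z) * ((1 - t) * z * K₂ f + (t * x - z) * K₂ (K₁ f))
      - (t * x - y) * (y - z) * (1 - t) * z * ((1 - t) * x * K₁ f + (t * y - x) * f)
      + (t * x - y) * (x - y) * (t * x - z) *
        ((1 - t) * z * K₁ (K₂ f) + (t * y - z) * K₂ (K₁ (K₂ f))) := by
    linear_combination (x - y) * (x - z) * (y - z) * h7 + (1 - t) * y * (x - y) * (x - z) * h5
      + (t * x - y) * (x - y) * (y - z) * h6 + (1 - t) * y * (x - z) * (1 - t) * z * g1
      + (1 - t) * y * (x - y) * (t * y - z) * g3 - (t * x - y) * (y - z) * (1 - t) * z * g2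
      + (t * x - y) * (x - y) * (t * x - z) * g4
  have e2 : (y - z) ^ 2 * (x - y) * (x - z) * T₂ (T₁ (T₂ f)) =
      (1 - t) * z * (x - z) * (1 - t) * y * ((1 - t) * z * f + (t * y - z) * K₂ f)
      + (1 - t) * z * (y - z) * (t * x - y) * ((1 - t) * z * K₁ f + (t * x - z) * K₁ (K₂ f))
      - (t * y - z) * (x - y) * (1 - t) * z * ((1 - t) * y * K₂ f + (t * z - y) * f)
      + (t * y - z) * (y - z) * (t * x - z) *
        ((1 - t) * y * K₂ (K₁ f) + (t * x - y) * K₂ (K₁ (K₂ f))) := by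
    linear_combination (x - y) * (x - z) * (y - z) * h7' + (1 - t) * z * (y - z) * (x - z) * h5'
      + (t * y - z) * (x - y) * (y - z) * h6' + (1 - t) * z * (x - z) * (1 - t) * y * g1'
      + (1 - t) * z * (y - z) * (t * x - y) * g3' - (t * y - z) * (x - y) * (1 - t) * z * g2'
      + (t * y - z) * (y - z) * (t * x - z) * g4'
  linear_combination (y - z) * e1 - (x - y) * e2

/-- Exchange of two variables, as a ring homomorphism. -/
noncomputable abbrev exch (i j : ℕ) : PS →+* PS := (renameEquiv QT (Equiv.swap i j) : PS →+* PS)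

theorem exch_X (i j k : ℕ) : exch i j (X k) = X (Equiv.swap i j k) := by
  change rename _ _ = _
  rw [rename_X]

theorem exch_C (i j : ℕ) (c : QT) : exch i j (C c) = C c := by
  change rename _ _ = _
  rw [rename_C]

theorem coeff_exch (i j : ℕ) (f : PS) (d : ℕ →₀ ℕ) :
    coeff d (exch i j f) = coeff (d.mapDomain (Equiv.swap i j)) f := coeff_swap i j f d

theorem exch_exch (i j : ℕ) (f : PS) : exch i j (exch i j f) = f := by
  ext d
  rw [coeff_exch, coeff_exch]
  congr 2
  ext x
  simp

theorem exch_braid (i : ℕ) (f : PS) :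
    exch i (i + 1) (exch (i + 1) (i + 2) (exch i (i + 1) f)) =
      exch (i + 1) (i + 2) (exch i (i + 1) (exch (i + 1) (i + 2) f)) := by
  ext d
  simp only [coeff_exch]
  congr 2
  ext x
  simp only [mapDomain_swap_apply, Equiv.swap_apply_def]
  congr 1
  split_ifs <;> omega

theorem exch_comm {i j : ℕ} (h : i + 1 < j) (f : PS) :
    exch i (i + 1) (exch j (j + 1) f) = exch j (j + 1) (exch i (i + 1) f) := by
  ext d
  simp only [coeff_exch]
  congr 2
  ext x
  simp only [mapDomain_swap_apply, Equiv.swap_apply_def]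
  congr 1
  split_ifs <;> omega

instance : IsDomain PS := NoZeroDivisors.to_isDomain _

theorem X_sub_X_ne_zero {i j : ℕ} (hij : i ≠ j) : (X i - X j : PS) ≠ 0 := by
  intro h3
  have h4 := congrArg (coeff (Finsupp.single i 1)) h3
  classical
  rw [map_sub, coeff_index_single_X, coeff_index_single_X] at h4
  simp [hij] at h4

/-- The denominator is cleared. Power series form a domain, so this relation determines T_i f, and
identities between Hecke operators become polynomial identities in the variables and the exchanged
functions. -/
theorem heckeT_spec {m i : ℕ} (hi : i + 1 < m) (f : R m) :
    (X i - X (i + 1)) * (heckeT m i hi f : PS) =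
      (1 - C tt) * X (i + 1) * (f : PS) + (C tt * X i - X (i + 1)) * exch i (i + 1) (f : PS) := by
  have h := dividedDiff_spec i (i + 1) (by omega) (f : PS)
  change (X i - X (i + 1)) * (tt • (f : PS) -
    (C tt * X i - X (i + 1)) * dividedDiff i (i + 1) (f : PS)) = _
  change _ = (f : PS) - exch i (i + 1) f at h
  rw [smul_eq_C_mul]
  linear_combination -(C tt * X i - X (i + 1)) * h

theorem heckeT_eq_iff {m i : ℕ} (hi : i + 1 < m) (f g : R m) : heckeT m i hi f = g ↔
    (X i - X (i + 1)) * (g : PS) =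
      (1 - C tt) * X (i + 1) * (f : PS) + (C tt * X i - X (i + 1)) * exch i (i + 1) (f : PS) := by
  rw [← heckeT_spec hi f]
  constructor
  · rintro rfl; rfl
  · intro h
    exact Subtype.ext (mul_left_cancel₀ (X_sub_X_ne_zero (by omega)) h).symm

theorem coe_heckeT_eq {m i : ℕ} (hi : i + 1 < m) (f : R m) : (heckeT m i hi f : PS) =
    tt • (f : PS) - (C tt * X i - X (i + 1)) * dividedDiff i (i + 1) (f : PS) := rfl

/-- The formula for T_i makes sense on all power series, where the exchanges are ring endomorphisms;
there `braid_of_exchange` applies. -/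
theorem heckeT_braid {m i : ℕ} (hi : i + 2 < m) (f : R m) :
    heckeT m i (by omega) (heckeT m (i + 1) hi (heckeT m i (by omega) f)) =
      heckeT m (i + 1) hi (heckeT m i (by omega) (heckeT m (i + 1) hi f)) := by
  ext1
  refine braid_of_exchange (T₁ := fun f => tt • (f : PS) -
    (C tt * X i - X (i + 1)) * dividedDiff i (i + 1) f) (T₂ := fun f => tt • (f : PS) -
    (C tt * X (i + 1) - X (i + 2)) * dividedDiff (i + 1) (i + 2) f) (t := C tt)
    (X_sub_X_ne_zero (i := i) (j := i + 1) (by omega))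
    (X_sub_X_ne_zero (i := i) (j := i + 2) (by omega))
    (X_sub_X_ne_zero (i := i + 1) (j := i + 2) (by omega))
    (K₁ := exch i (i + 1)) (K₂ := exch (i + 1) (i + 2)) ?_ ?_ ?_ (exch_C _ _ _) ?_ ?_ ?_
    (exch_C _ _ _) (exch_exch _ _) (exch_exch _ _) (exch_braid i) (fun f => ?_) (fun f => ?_) _
  any_goals rw [exch_X]; congr 1; simp [Equiv.swap_apply_def]
  · have h := dividedDiff_spec i (i + 1) (by omega) f
    change _ = f - exch i (i + 1) f at h
    rw [smul_eq_C_mul]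
    linear_combination -(C tt * X i - X (i + 1)) * h
  · have h := dividedDiff_spec (i + 1) (i + 2) (by omega) f
    change _ = f - exch (i + 1) (i + 2) f at h
    rw [smul_eq_C_mul]
    linear_combination -(C tt * X (i + 1) - X (i + 2)) * h

/-- Each exchange fixes the two variables of the other operator, so both sides agree after
multiplication by the two differences. -/
theorem heckeT_comm {m i j : ℕ} (hij : i + 1 < j) (hj : j + 1 < m) (f : R m) :
    heckeT m i (by omega) (heckeT m j hj f) = heckeT m j hj (heckeT m i (by omega) f) := by
  rw [heckeT_eq_iff]
  have h1 := heckeT_spec hj (heckeT m i (by omega) f)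
  have h2 := heckeT_spec hj f
  have h3 := heckeT_spec (show i + 1 < m by omega) f
  have h4 := congrArg (exch i (i + 1)) h2
  have h5 := congrArg (exch j (j + 1)) h3
  have e1 : Equiv.swap i (i + 1) j = j := Equiv.swap_apply_of_ne_of_ne (by omega) (by omega)
  have e2 : Equiv.swap i (i + 1) (j + 1) = j + 1 :=
    Equiv.swap_apply_of_ne_of_ne (by omega) (by omega)
  have e3 : Equiv.swap j (j + 1) i = i := Equiv.swap_apply_of_ne_of_ne (by omega) (by omega)
  have e4 : Equiv.swap j (j + 1) (i + 1) = i + 1 :=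
    Equiv.swap_apply_of_ne_of_ne (by omega) (by omega)
  simp only [map_add, map_sub, map_mul, map_one, exch_X, exch_C, e1, e2, e3, e4,
    exch_comm hij] at h4 h5
  refine mul_left_cancel₀ (X_sub_X_ne_zero (i := j) (j := j + 1) (by omega)) ?_
  linear_combination (X i - X (i + 1)) * h1 + (1 - C tt) * X (j + 1) * h3
    + (C tt * X j - X (j + 1)) * h5 - (1 - C tt) * X (i + 1) * h2
    - (C tt * X i - X (i + 1)) * h4

/-- The quadratic Hecke relation (T_i - t)(T_i + 1) = 0. -/
theorem heckeT_heckeT {m i : ℕ} (hi : i + 1 < m) (f : R m) :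
    heckeT m i hi (heckeT m i hi f) = (tt - 1) • heckeT m i hi f + tt • f := by
  rw [heckeT_eq_iff]
  have h1 := heckeT_spec hi f
  have h2 := congrArg (exch i (i + 1)) h1
  simp only [map_add, map_sub, map_mul, map_one, exch_X, exch_C, Equiv.swap_apply_left,
    Equiv.swap_apply_right, exch_exch] at h2
  have e : (C (tt - 1) : PS) = C tt - 1 := by rw [map_sub, map_one]
  simp only [Subalgebra.coe_add, SetLike.val_smul, smul_eq_C_mul, e]
  refine mul_left_cancel₀ (X_sub_X_ne_zero (i := i) (j := i + 1) (by omega)) ?_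
  linear_combination ((C tt - 1) * (X i - X (i + 1)) - (1 - C tt) * X (i + 1)) * h1
    + (C tt * X i - X (i + 1)) * h2

/-- `T_i` is linear over the functions that are symmetric in `x_i`, `x_{i+1}`. -/
theorem heckeT_mul_of_symm {m i : ℕ} (hi : i + 1 < m) (f g : R m)
    (hg : exch i (i + 1) (g : PS) = g) : heckeT m i hi (f * g) = heckeT m i hi f * g := by
  rw [heckeT_eq_iff]
  have h := heckeT_spec hi f
  push_cast
  rw [map_mul, hg]
  linear_combination (g : PS) * h

theorem heckeT_of_symm {m i : ℕ} (hi : i + 1 < m) (g : R m)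
    (hg : exch i (i + 1) (g : PS) = g) : heckeT m i hi g = tt • g := by
  rw [heckeT_eq_iff, hg, SetLike.val_smul, smul_eq_C_mul]
  ring

/-! ## Sorting compositions -/

theorem swapAt_apply {m : ℕ} (a : Fin m → ℕ) (i : ℕ) (h : i + 1 < m) (j : Fin m) :
    swapAt a i h j = if (j : ℕ) = i then a ⟨i + 1, h⟩ else if (j : ℕ) = i + 1 then
      a ⟨i, by omega⟩ else a j := by
  simp only [swapAt, Function.comp, Equiv.swap_apply_def, Fin.ext_iff]
  split_ifs <;> rfl

theorem swapAt_swapAt {m : ℕ} (a : Fin m → ℕ) (i : ℕ) (h : i + 1 < m) :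
    swapAt (swapAt a i h) i h = a := by
  ext j
  simp [swapAt, Function.comp]

theorem swapAt_comm {m : ℕ} (a : Fin m → ℕ) {i j : ℕ} (hij : i + 1 < j) (hj : j + 1 < m) :
    swapAt (swapAt a i (by omega)) j hj = swapAt (swapAt a j hj) i (by omega) := by
  ext k
  simp only [swapAt_apply]
  split_ifs <;> first | rfl | (exfalso; omega)

theorem swapAt_braid {m : ℕ} (a : Fin m → ℕ) {i : ℕ} (hi : i + 2 < m) :
    swapAt (swapAt (swapAt a i (by omega)) (i + 1) hi) i (by omega) =
      swapAt (swapAt (swapAt a (i + 1) hi) i (by omega)) (i + 1) hi := by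
  ext k
  simp only [swapAt_apply]
  split_ifs <;> first | rfl | (exfalso; omega)

theorem swapAt_eq_self {m : ℕ} (a : Fin m → ℕ) {i : ℕ} (hi : i + 1 < m)
    (h : a ⟨i, by omega⟩ = a ⟨i + 1, hi⟩) : swapAt a i hi = a := by
  ext ⟨k, hk⟩
  rw [swapAt_apply]
  split_ifs with h1 h2
  · simp only at h1; subst h1; exact h.symm
  · simp only at h2; subst h2; exact h
  · rfl

theorem swapAt_left {m : ℕ} (a : Fin m → ℕ) {i : ℕ} (hi : i + 1 < m) :
    swapAt a i hi ⟨i, by omega⟩ = a ⟨i + 1, hi⟩ := by simp [swapAt_apply]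

theorem swapAt_right {m : ℕ} (a : Fin m → ℕ) {i : ℕ} (hi : i + 1 < m) :
    swapAt a i hi ⟨i + 1, hi⟩ = a ⟨i, by omega⟩ := by simp [swapAt_apply]

theorem swapAt_of_ne {m : ℕ} (a : Fin m → ℕ) {i : ℕ} (hi : i + 1 < m) (k : Fin m)
    (h1 : (k : ℕ) ≠ i) (h2 : (k : ℕ) ≠ i + 1) : swapAt a i hi k = a k := by
  simp [swapAt_apply, h1, h2]

theorem sum_comp_swapAt {m : ℕ} (a : Fin m → ℕ) {i : ℕ} (hi : i + 1 < m) (φ : ℕ → ℕ) :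
    ∑ j, φ (swapAt a i hi j) = ∑ j, φ (a j) :=
  Equiv.sum_comp (Equiv.swap (⟨i, by omega⟩ : Fin m) ⟨i + 1, hi⟩) fun j => φ (a j)

theorem antitone_of_no_ascent {m : ℕ} {a : Fin m → ℕ} (h : ¬ ∃ i, IsAscent a i) : Antitone a := by
  cases m with
  | zero => intro i; exact i.elim0
  | succ n =>
    rw [Fin.antitone_iff_succ_le]
    intro i
    by_contra hlt
    exact h ⟨i, by omega, not_le.mp hlt⟩

theorem no_ascent_of_antitone {m : ℕ} {a : Fin m → ℕ} (h : Antitone a) : ¬ ∃ i, IsAscent a i := by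
  rintro ⟨i, hi, hlt⟩
  have := h (show (⟨i, by omega⟩ : Fin m) ≤ ⟨i + 1, hi⟩ from by simp [Fin.le_def])
  omega

/-- A family that satisfies a recursion along one ascent of every non-dominant composition
satisfies it along all ascents, if the operators satisfy the braid relations. -/
theorem recursion_of_braid {m : ℕ} {V : Type*} (F : (Fin m → ℕ) → V)
    (τ : ∀ i, i + 1 < m → V → V)
    (hcomm : ∀ i j (_ : i + 1 < j) (hj : j + 1 < m) v, τ i (by omega) (τ j hj v) =
      τ j hj (τ i (by omega) v))
    (hbraid : ∀ i (hi : i + 2 < m) v, τ i (by omega) (τ (i + 1) hi (τ i (by omega) v)) =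
      τ (i + 1) hi (τ i (by omega) (τ (i + 1) hi v)))
    (hF : ∀ a, (∃ i, IsAscent a i) → ∃ i, ∃ h : IsAscent a i, F a = τ i h.1 (F (swapAt a i h.1)))
    (a : Fin m → ℕ) (i : ℕ) (h : IsAscent a i) : F a = τ i h.1 (F (swapAt a i h.1)) := by
  induction hn : sortMeasure a using Nat.strong_induction_on generalizing a i with
  | _ n ih =>
  subst hn
  -- The recursion is known along some ascent j. It is carried over to i by comparing the two ways
  -- of sorting, which merge at a composition of smaller measure.
  obtain ⟨j, hj, hFj⟩ := hF a ⟨i, h⟩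
  have hlt := fun (k : ℕ) (hk : IsAscent a k) => sortMeasure_swapAt a k hk
  -- two distant ascents
  have far : ∀ p q (_ : p + 1 < q) (hp : IsAscent a p) (hq : IsAscent a q),
      τ p hp.1 (F (swapAt a p hp.1)) = τ q hq.1 (F (swapAt a q hq.1)) := by
    intro p q hpq hp hq
    obtain ⟨hp1, hp2⟩ := hp
    obtain ⟨hq1, hq2⟩ := hq
    have hq' : IsAscent (swapAt a p hp1) q := ⟨hq1, by
      rw [swapAt_of_ne _ _ _ (by dsimp only; omega) (by dsimp only; omega),
        swapAt_of_ne _ _ _ (by dsimp only; omega) (by dsimp only; omega)]; exact hq2⟩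
    have hp' : IsAscent (swapAt a q hq1) p := ⟨hp1, by
      rw [swapAt_of_ne _ _ _ (by dsimp only; omega) (by dsimp only; omega),
        swapAt_of_ne _ _ _ (by dsimp only; omega) (by dsimp only; omega)]; exact hp2⟩
    rw [ih _ (hlt p ⟨hp1, hp2⟩) _ q hq' rfl, ih _ (hlt q ⟨hq1, hq2⟩) _ p hp' rfl,
      hcomm p q hpq hq1, swapAt_comm a hpq hq1]
  -- two consecutive ascents
  have near : ∀ p (hp : IsAscent a p) (hq : IsAscent a (p + 1)),
      τ p hp.1 (F (swapAt a p hp.1)) = τ (p + 1) hq.1 (F (swapAt a (p + 1) hq.1)) := by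
    intro p hp hq
    obtain ⟨hp1, hp2⟩ := hp
    obtain ⟨hq1, hq2⟩ := hq
    -- Here a_p < a_{p+1} < a_{p+2}. Both reduced words of the longest permutation of three entries
    -- sort them through ascents, and the induction hypothesis covers all steps after the first.
    have hq' : IsAscent (swapAt a p hp1) (p + 1) := ⟨hq1, by
      rw [swapAt_right, swapAt_of_ne _ _ _ (by dsimp only; omega) (by dsimp only; omega)]; omega⟩
    have hp'' : IsAscent (swapAt (swapAt a p hp1) (p + 1) hq1) p := ⟨hp1, by
      rw [swapAt_left, swapAt_of_ne _ _ _ (by dsimp only; omega) (by dsimp only; omega), swapAt_left,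
        swapAt_of_ne _ _ _ (by dsimp only; omega) (by dsimp only; omega)]; omega⟩
    have hp' : IsAscent (swapAt a (p + 1) hq1) p := ⟨hp1, by
      rw [swapAt_left, swapAt_of_ne _ _ _ (by dsimp only; omega) (by dsimp only; omega)]; omega⟩
    have hq'' : IsAscent (swapAt (swapAt a (p + 1) hq1) p hp1) (p + 1) := ⟨hq1, by
      rw [swapAt_right, swapAt_of_ne _ _ _ (by dsimp only; omega) (by dsimp only; omega),
        swapAt_of_ne _ _ _ (by dsimp only; omega) (by dsimp only; omega), swapAt_right]; omega⟩
    have l1 := hlt p ⟨hp1, hp2⟩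
    have l2 := hlt (p + 1) ⟨hq1, hq2⟩
    rw [ih _ l1 _ (p + 1) hq' rfl, ih _ ((sortMeasure_swapAt _ _ hq').trans l1) _ p hp'' rfl,
      ih _ l2 _ p hp' rfl, ih _ ((sortMeasure_swapAt _ _ hp').trans l2) _ (p + 1) hq'' rfl,
      hbraid p hq1, swapAt_braid a hq1]
  rcases lt_trichotomy i j with hij | rfl | hij
  · rcases Nat.lt_or_ge (i + 1) j with h1 | h1
    · rw [hFj, far i j h1 h hj]
    · obtain rfl : j = i + 1 := by omega
      rw [hFj, near i h hj]
  · exact hFj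
  · rcases Nat.lt_or_ge (j + 1) i with h1 | h1
    · rw [hFj, far j i h1 hj h]
    · obtain rfl : i = j + 1 := by omega
      rw [hFj, near j hj h]

/-! ## The action of the Hecke operators on the Hall–Littlewood polynomials -/

open Classical in
theorem hallLittlewood_of_ascent {m : ℕ} (a : Fin m → ℕ) (i : ℕ) (h : IsAscent a i) :
    hallLittlewood a = heckeT m i h.1 (hallLittlewood (swapAt a i h.1)) := by
  refine recursion_of_braid hallLittlewood (fun i hi v => heckeT m i hi v)
    (fun i j hij hj v => heckeT_comm hij hj v) (fun i hi v => heckeT_braid hi v) ?_ a i h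
  intro a ha
  refine ⟨_, Nat.find_spec ha, ?_⟩
  conv_lhs => rw [hallLittlewood, dif_pos ha]

theorem hallLittlewood_of_antitone {m : ℕ} {a : Fin m → ℕ} (h : Antitone a) :
    hallLittlewood a = xPow a := by
  rw [hallLittlewood, dif_neg (no_ascent_of_antitone h)]

theorem exch_xPow {m : ℕ} (a : Fin m → ℕ) {i : ℕ} (hi : i + 1 < m) :
    exch i (i + 1) (xPow a : PS) = xPow (swapAt a i hi) := by
  change rename _ (monomial _ _) = monomial _ _
  rw [rename_monomial]
  congr 2
  ext x
  rw [mapDomain_swap_apply]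
  rcases lt_or_ge x m with hx | hx
  · have e : ∀ (b : Fin m → ℕ) (y : ℕ) (hy : y < m), Finsupp.embDomain Fin.valEmbedding
        (Finsupp.equivFunOnFinite.symm b) y = b ⟨y, hy⟩ := fun b y hy =>
      Finsupp.embDomain_apply_self Fin.valEmbedding _ (⟨y, hy⟩ : Fin m)
    have hs : Equiv.swap i (i + 1) x < m := by rw [Equiv.swap_apply_def]; split_ifs <;> omega
    rw [e _ x hx, e _ _ hs, swapAt_apply]
    simp only [Equiv.swap_apply_def]
    split_ifs <;> rfl
  · rw [Equiv.swap_apply_of_ne_of_ne (by omega) (by omega),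
      Finsupp.embDomain_of_notMem_range _ _ _ (by rintro ⟨y, hy⟩; simp at hy; omega),
      Finsupp.embDomain_of_notMem_range _ _ _ (by rintro ⟨y, hy⟩; simp at hy; omega)]

/-- If a is dominant, x^a is symmetric in the two variables. Otherwise some ascent is used: a
distant one commutes with T_i, and an adjacent one is dealt with by the braid relation. -/
theorem heckeT_hallLittlewood_eq {m : ℕ} (a : Fin m → ℕ) {i : ℕ} (hi : i + 1 < m)
    (h : a ⟨i, by omega⟩ = a ⟨i + 1, hi⟩) :
    heckeT m i hi (hallLittlewood a) = tt • hallLittlewood a := by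
  induction hn : sortMeasure a using Nat.strong_induction_on generalizing a i with
  | _ n ih =>
  subst hn
  by_cases hasc : ∃ j, IsAscent a j
  swap
  · rw [hallLittlewood_of_antitone (antitone_of_no_ascent hasc)]
    refine heckeT_of_symm hi _ ?_
    rw [exch_xPow a hi, swapAt_eq_self a hi h]
  obtain ⟨j, hj, hlt⟩ := hasc
  have hm := sortMeasure_swapAt a j ⟨hj, hlt⟩
  have hH := hallLittlewood_of_ascent a j ⟨hj, hlt⟩
  rcases Nat.lt_or_ge (i + 1) j with h1 | h1
  · rw [hH, heckeT_comm h1 hj, ih _ hm _ hi _ rfl, map_smul]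
    rw [swapAt_of_ne _ _ _ (by dsimp only; omega) (by dsimp only; omega),
        swapAt_of_ne _ _ _ (by dsimp only; omega) (by dsimp only; omega)]; exact h
  rcases Nat.lt_or_ge (j + 1) i with h2 | h2
  · rw [hH, ← heckeT_comm h2 hi, ih _ hm _ hi _ rfl, map_smul]
    rw [swapAt_of_ne _ _ _ (by dsimp only; omega) (by dsimp only; omega),
        swapAt_of_ne _ _ _ (by dsimp only; omega) (by dsimp only; omega)]; exact h
  rcases (by omega : j = i + 1 ∨ i = j ∨ i = j + 1) with rfl | rfl | rfl
  -- With a_i = a_{i+1} < a_{i+2}, the large entry moves left past both equal ones. So H_a = T_{i+1}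
  -- T_i H_b with equal entries of b at i+1 and i+2, and T_i T_{i+1} T_i = T_{i+1} T_i T_{i+1} lets
  -- T_{i+1} act on H_b first.
  · have ha : IsAscent (swapAt a (i + 1) hj) i := ⟨hi, by
      rw [swapAt_left, swapAt_of_ne _ _ _ (by dsimp only; omega) (by dsimp only; omega)]; omega⟩
    have hm' := (sortMeasure_swapAt _ _ ha).trans hm
    rw [hH, hallLittlewood_of_ascent _ i ha, heckeT_braid hj, ih _ hm' (i := i + 1) _ hj ?_ rfl,
      map_smul, map_smul]
    rw [swapAt_right, swapAt_of_ne _ _ _ (by dsimp only; omega) (by dsimp only; omega),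
      swapAt_of_ne _ _ ⟨i + 1 + 1, hj⟩ (by dsimp only; omega) (by dsimp only; omega), swapAt_right]
    exact h
  · omega
  · have ha : IsAscent (swapAt a j hj) (j + 1) := ⟨hi, by
      rw [swapAt_right, swapAt_of_ne _ _ _ (by dsimp only; omega) (by dsimp only; omega)]; omega⟩
    have hm' := (sortMeasure_swapAt _ _ ha).trans hm
    rw [hH, hallLittlewood_of_ascent _ (j + 1) ha, ← heckeT_braid hi, ih _ hm' (i := j) _ hj ?_ rfl,
      map_smul, map_smul]
    rw [swapAt_of_ne _ _ _ (by dsimp only; omega) (by dsimp only; omega), swapAt_left,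
      swapAt_left, swapAt_of_ne _ _ _ (by dsimp only; omega) (by dsimp only; omega)]
    exact h

theorem heckeT_hallLittlewood_descent {m : ℕ} (a : Fin m → ℕ) {i : ℕ} (hi : i + 1 < m)
    (h : a ⟨i + 1, hi⟩ < a ⟨i, by omega⟩) :
    heckeT m i hi (hallLittlewood a) = hallLittlewood (swapAt a i hi) := by
  rw [hallLittlewood_of_ascent (swapAt a i hi) i ⟨hi, by rwa [swapAt_left, swapAt_right]⟩,
    swapAt_swapAt]

theorem heckeT_hallLittlewood_ascent {m : ℕ} (a : Fin m → ℕ) {i : ℕ} (hi : i + 1 < m)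
    (h : a ⟨i, by omega⟩ < a ⟨i + 1, hi⟩) : heckeT m i hi (hallLittlewood a) =
      (tt - 1) • hallLittlewood a + tt • hallLittlewood (swapAt a i hi) := by
  rw [hallLittlewood_of_ascent a i ⟨hi, h⟩, heckeT_heckeT]

/-- The same determinant already lives in R_0, whose elements are symmetric in all variables. -/
theorem schurFn_symm (m : ℕ) (lam : YoungDiagram) (i j : ℕ) :
    exch i j (schurFn m lam : PS) = schurFn m lam := by
  have h : (schurFn m lam : PS) = schurFn 0 lam := by
    simp only [schurFn]
    rw [← Subalgebra.coe_val, ← Subalgebra.coe_val, AlgHom.map_det, AlgHom.map_det]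
    rfl
  rw [h]
  exact (schurFn 0 lam).2.1 i j (Nat.zero_le _) (Nat.zero_le _)

theorem heckeT_kFun {m i : ℕ} (hi : i + 1 < m) (Λ : MPart m) :
    heckeT m i hi (kFun Λ) = heckeT m i hi (hallLittlewood Λ.a) * schurFn m Λ.lam :=
  heckeT_mul_of_symm hi _ _ (schurFn_symm m Λ.lam i (i + 1))

/-! ## Monomial `m`-symmetric functions -/

/-- The Young diagram whose column lengths are the values of an antitone function. -/
def ofCols (f : ℕ → ℕ) (hf : Antitone f) (C : ℕ) : YoungDiagram where
  cells := (Finset.range (f 0) ×ˢ Finset.range C).filter fun x => x.1 < f x.2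
  isLowerSet := by
    intro x y hxy hx
    simp only [Finset.coe_filter, Finset.mem_product, Finset.mem_range, Set.mem_ofPred_eq] at hx ⊢
    have h1 : y.1 ≤ x.1 := hxy.1
    have h2 : y.2 ≤ x.2 := hxy.2
    have h3 := hf h2
    exact ⟨⟨by omega, by omega⟩, by omega⟩

/-- The bound C only makes the set of cells finite; f C = 0 guarantees that it cuts nothing off. -/
theorem mem_ofCols {f : ℕ → ℕ} (hf : Antitone f) {C : ℕ} (hC : f C = 0) (r c : ℕ) :
    (r, c) ∈ ofCols f hf C ↔ r < f c := by
  rw [← YoungDiagram.mem_cells]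
  simp only [ofCols, Finset.mem_filter, Finset.mem_product, Finset.mem_range,
    and_iff_right_iff_imp]
  intro h
  refine ⟨h.trans_le (hf (Nat.zero_le _)), ?_⟩
  by_contra hlt
  have := hf (not_lt.mp hlt)
  omega

theorem diagram_ext_colLen {μ ν : YoungDiagram} (h : ∀ c, μ.colLen c = ν.colLen c) : μ = ν := by
  ext ⟨r, c⟩
  simp only [YoungDiagram.mem_cells, YoungDiagram.mem_iff_lt_colLen, h]

theorem colLen_ofCols {f : ℕ → ℕ} (hf : Antitone f) {C : ℕ} (hC : f C = 0) (c : ℕ) :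
    (ofCols f hf C).colLen c = f c := by
  have h : ∀ r, r < (ofCols f hf C).colLen c ↔ r < f c := fun r => by
    rw [← YoungDiagram.mem_iff_lt_colLen, mem_ofCols hf hC]
  exact le_antisymm (not_lt.mp fun hlt => lt_irrefl _ ((h _).mp hlt))
    (not_lt.mp fun hlt => lt_irrefl _ ((h _).mpr hlt))

theorem lt_rowLen_iff_lt_colLen (μ : YoungDiagram) (r c : ℕ) : c < μ.rowLen r ↔ r < μ.colLen c := by
  rw [← YoungDiagram.mem_iff_lt_rowLen, YoungDiagram.mem_iff_lt_colLen]

/-- The number of exponents of the variables `X j`, `m ≤ j`, that exceed `c`. -/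
def tailCount (m : ℕ) (d : ℕ →₀ ℕ) (c : ℕ) : ℕ :=
  (d.support.filter fun j => m ≤ j ∧ c < d j).card

theorem tailCount_antitone (m : ℕ) (d : ℕ →₀ ℕ) : Antitone (tailCount m d) := by
  intro c c' h
  refine Finset.card_le_card fun j hj => ?_
  simp only [Finset.mem_filter] at hj ⊢
  exact ⟨hj.1, hj.2.1, by omega⟩

theorem le_degree (d : ℕ →₀ ℕ) (j : ℕ) : d j ≤ d.degree := by
  by_cases h : j ∈ d.support
  · exact Finset.single_le_sum (f := d) (fun _ _ => Nat.zero_le _) h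
  · rw [Finsupp.notMem_support_iff.mp h]; exact Nat.zero_le _

theorem tailCount_degree (m : ℕ) (d : ℕ →₀ ℕ) : tailCount m d d.degree = 0 := by
  rw [tailCount, Finset.card_eq_zero, Finset.filter_eq_empty_iff]
  intro j _ h
  have := le_degree d j
  omega

/-- The `m`-partition that describes the orbit of an exponent under the permutations of the
variables `X j`, `m ≤ j`. -/
noncomputable def mtype (m : ℕ) (d : ℕ →₀ ℕ) : MPart m :=
  ⟨fun i => d i, ofCols (tailCount m d) (tailCount_antitone m d) d.degree⟩

theorem colLen_mtype (m : ℕ) (d : ℕ →₀ ℕ) (c : ℕ) :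
    (mtype m d).lam.colLen c = tailCount m d c :=
  colLen_ofCols (tailCount_antitone m d) (tailCount_degree m d) c

theorem mtype_eq_iff {m : ℕ} {d : ℕ →₀ ℕ} {Λ : MPart m} : mtype m d = Λ ↔
    (∀ i : Fin m, d i = Λ.a i) ∧ ∀ c, tailCount m d c = Λ.lam.colLen c := by
  constructor
  · rintro rfl
    exact ⟨fun _ => rfl, fun c => (colLen_mtype m d c).symm⟩
  · rintro ⟨h1, h2⟩
    exact MPart.ext (funext h1) (diagram_ext_colLen fun c => by rw [colLen_mtype, h2])

/-- The exponent of the leading monomial of the orbit described by an `m`-partition. -/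
noncomputable def expo {m : ℕ} (Λ : MPart m) : ℕ →₀ ℕ :=
  Finsupp.onFinset (Finset.range (m + Λ.lam.colLen 0))
    (fun j => if h : j < m then Λ.a ⟨j, h⟩ else Λ.lam.rowLen (j - m)) (by
      intro j hj
      rw [Finset.mem_range]
      split_ifs at hj with h
      · omega
      · have := (lt_rowLen_iff_lt_colLen Λ.lam (j - m) 0).mp (Nat.pos_of_ne_zero hj)
        omega)

theorem expo_apply {m : ℕ} (Λ : MPart m) (j : ℕ) :
    expo Λ j = if h : j < m then Λ.a ⟨j, h⟩ else Λ.lam.rowLen (j - m) := rfl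

theorem expo_add {m : ℕ} (Λ : MPart m) (r : ℕ) : expo Λ (m + r) = Λ.lam.rowLen r := by
  rw [expo_apply, dif_neg (by omega), Nat.add_sub_cancel_left]

theorem mtype_expo {m : ℕ} (Λ : MPart m) : mtype m (expo Λ) = Λ := by
  rw [mtype_eq_iff]
  refine ⟨fun i => by rw [expo_apply, dif_pos i.2], fun c => ?_⟩
  have : ((expo Λ).support.filter fun j => m ≤ j ∧ c < expo Λ j) =
      (Finset.range (Λ.lam.colLen c)).map (addLeftEmbedding m) := by
    ext j
    simp only [Finset.mem_filter, Finsupp.mem_support_iff, Finset.mem_map, Finset.mem_range,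
      addLeftEmbedding_apply]
    constructor
    · rintro ⟨_, h2, h3⟩
      obtain ⟨r, rfl⟩ := Nat.exists_eq_add_of_le h2
      rw [expo_add, lt_rowLen_iff_lt_colLen] at h3
      exact ⟨r, h3, rfl⟩
    · rintro ⟨r, hr, rfl⟩
      rw [← lt_rowLen_iff_lt_colLen] at hr
      rw [expo_add]
      exact ⟨by omega, by omega, hr⟩
  rw [tailCount, this, Finset.card_map, Finset.card_range]

theorem mtype_swap {m i j : ℕ} (hi : m ≤ i) (hj : m ≤ j) (d : ℕ →₀ ℕ) :
    mtype m (d.mapDomain (Equiv.swap i j)) = mtype m d := by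
  rw [mtype_eq_iff]
  constructor
  · intro k
    rw [mapDomain_swap_apply, Equiv.swap_apply_of_ne_of_ne (by omega) (by omega)]
    rfl
  · intro c
    rw [colLen_mtype]
    have hm : ∀ x, m ≤ x → m ≤ Equiv.swap i j x := by
      intro x hx
      rw [Equiv.swap_apply_def]
      split_ifs <;> omega
    refine Finset.card_nbij' (Equiv.swap i j) (Equiv.swap i j) ?_ ?_
      (fun x _ => Equiv.swap_apply_self i j x) (fun x _ => Equiv.swap_apply_self i j x)
    · intro x hx
      simp only [Finset.coe_filter, Set.mem_ofPred_eq, Finsupp.mem_support_iff,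
        mapDomain_swap_apply] at hx ⊢
      exact ⟨hx.1, hm _ hx.2.1, hx.2.2⟩
    · intro x hx
      simp only [Finset.coe_filter, Set.mem_ofPred_eq, Finsupp.mem_support_iff,
        mapDomain_swap_apply, Equiv.swap_apply_self] at hx ⊢
      exact ⟨hx.1, hm _ hx.2.1, hx.2.2⟩

/-- For a decreasing tail, the positions from m on with exponent above c form an interval that
starts at m, so their number recovers the exponents. -/
theorem expo_mtype_of_sorted {m : ℕ} {d : ℕ →₀ ℕ} (h : ∀ j, m ≤ j → d (j + 1) ≤ d j) :
    expo (mtype m d) = d := by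
  have hanti : ∀ r s, r ≤ s → d (m + s) ≤ d (m + r) := by
    intro r s hrs
    induction s, hrs using Nat.le_induction with
    | base => exact le_rfl
    | succ n hn ih => exact (h (m + n) (by omega)).trans ih
  ext j
  rcases lt_or_ge j m with hj | hj
  · rw [expo_apply, dif_pos hj]; rfl
  obtain ⟨r, rfl⟩ := Nat.exists_eq_add_of_le hj
  rw [expo_add]
  have key : ∀ c, c < (mtype m d).lam.rowLen r ↔ c < d (m + r) := by
    intro c
    rw [lt_rowLen_iff_lt_colLen, colLen_mtype]
    constructor
    · intro h1
      by_contra h2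
      have hsub : (d.support.filter fun j => m ≤ j ∧ c < d j) ⊆ Finset.Ico m (m + r) := by
        intro x hx
        simp only [Finset.mem_filter] at hx
        obtain ⟨s, rfl⟩ := Nat.exists_eq_add_of_le hx.2.1
        rw [Finset.mem_Ico]
        refine ⟨hx.2.1, ?_⟩
        by_contra h3
        have := hanti r s (by omega)
        omega
      have := Finset.card_le_card hsub
      rw [Nat.card_Ico] at this
      rw [tailCount] at h1
      omega
    · intro h1
      have hsub : Finset.Ico m (m + r + 1) ⊆ (d.support.filter fun j => m ≤ j ∧ c < d j) := by
        intro x hx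
        rw [Finset.mem_Ico] at hx
        obtain ⟨s, rfl⟩ := Nat.exists_eq_add_of_le hx.1
        have := hanti s r (by omega)
        simp only [Finset.mem_filter, Finsupp.mem_support_iff]
        exact ⟨by omega, by omega, by omega⟩
      have := Finset.card_le_card hsub
      rw [Nat.card_Ico] at this
      rw [tailCount]
      omega
  exact le_antisymm (not_lt.mp fun hlt => lt_irrefl _ ((key _).mp hlt))
    (not_lt.mp fun hlt => lt_irrefl _ ((key _).mpr hlt))

/-- The coefficients of a function in `R_m` are constant on the orbits of exponents. -/
theorem coeff_eq_coeff_expo {m : ℕ} (f : R m) (d : ℕ →₀ ℕ) :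
    coeff d (f : PS) = coeff (expo (mtype m d)) (f : PS) := by
  induction hn : Finsupp.weight (fun j : ℕ => j) d using Nat.strong_induction_on generalizing d with
  | _ n ih =>
  subst hn
  by_cases hs : ∀ j, m ≤ j → d (j + 1) ≤ d j
  · rw [expo_mtype_of_sorted hs]
  push Not at hs
  obtain ⟨j, hj, hlt⟩ := hs
  -- Exchanging d_j < d_{j+1} lowers the weight ∑ j d_j by d_{j+1} - d_j; the identity is arranged
  -- so that no exponent vectors are subtracted.
  have hw : d.mapDomain (Equiv.swap j (j + 1)) + Finsupp.single (j + 1) (d (j + 1) - d j) =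
      d + Finsupp.single j (d (j + 1) - d j) := by
    ext x
    simp only [Finsupp.add_apply, mapDomain_swap_apply, Finsupp.single_apply,
      Equiv.swap_apply_def]
    rcases eq_or_ne x j with rfl | h1
    · simp; omega
    rcases eq_or_ne x (j + 1) with rfl | h2
    · simp; omega
    · simp [h1, h2, h1.symm, h2.symm]
  have hw' := congrArg (Finsupp.weight (fun j : ℕ => j)) hw
  have e : ∀ a b : ℕ, (Finsupp.single a b).sum (fun i c => c * i) = b * a := fun a b =>
    Finsupp.sum_single_index (zero_mul _)
  simp only [map_add, Finsupp.weight_apply, smul_eq_mul, e] at hw'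
  have hlt' : Finsupp.weight (fun j : ℕ => j) (d.mapDomain (Equiv.swap j (j + 1))) <
      Finsupp.weight (fun j : ℕ => j) d := by
    simp only [Finsupp.weight_apply, smul_eq_mul]
    rw [mul_add] at hw'
    omega
  have h1 := ih _ hlt' _ rfl
  rw [mtype_swap (by omega) (by omega)] at h1
  rw [← h1, ← coeff_swap, f.2.1 j (j + 1) hj (by omega)]

/-- The function h_n with n = deg d lies in R_m and its coefficients detect the degree, so the
constancy of coefficients on orbits gives the claim. -/
theorem degree_expo_mtype (m : ℕ) (d : ℕ →₀ ℕ) : (expo (mtype m d)).degree = d.degree := by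
  have h := coeff_eq_coeff_expo (hFun m d.degree) d
  change coeff d (hPS _) = coeff _ (hPS _) at h
  rw [coeff_hPS, coeff_hPS, if_pos rfl] at h
  by_contra hne
  rw [if_neg (by exact_mod_cast hne)] at h
  exact one_ne_zero h

/-- The degree `|a| + |λ|` of an `m`-partition. -/
def MPart.size {m : ℕ} (Λ : MPart m) : ℕ := ∑ i, Λ.a i + Λ.lam.card

theorem card_eq_sum_colLen (μ : YoungDiagram) {C : ℕ} (hC : μ.colLen C = 0) :
    μ.card = ∑ c ∈ Finset.range C, μ.colLen c := by
  rw [YoungDiagram.card, Finset.card_eq_sum_card_fiberwise (f := Prod.snd) (t := Finset.range C)]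
  · exact Finset.sum_congr rfl fun c _ => (μ.colLen_eq_card).symm
  · rintro ⟨r, c⟩ hx
    rw [Finset.mem_coe, YoungDiagram.mem_cells, YoungDiagram.mem_iff_lt_colLen] at hx
    simp only [Finset.coe_range, Set.mem_Iio]
    by_contra h
    have := μ.colLen_anti C c (by omega)
    omega

theorem card_eq_sum_rowLen (μ : YoungDiagram) {r : ℕ} (hr : μ.rowLen r = 0) :
    μ.card = ∑ i ∈ Finset.range r, μ.rowLen i := by
  rw [YoungDiagram.card, Finset.card_eq_sum_card_fiberwise (f := Prod.fst) (t := Finset.range r)]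
  · exact Finset.sum_congr rfl fun c _ => (μ.rowLen_eq_card).symm
  · rintro ⟨i, c⟩ hx
    rw [Finset.mem_coe, YoungDiagram.mem_cells, YoungDiagram.mem_iff_lt_rowLen] at hx
    simp only [Finset.coe_range, Set.mem_Iio]
    by_contra h
    have := μ.rowLen_anti r i (by omega)
    omega

theorem rowLen_colLen_zero (μ : YoungDiagram) : μ.rowLen (μ.colLen 0) = 0 := by
  by_contra h
  have := (lt_rowLen_iff_lt_colLen μ (μ.colLen 0) 0).mp (Nat.pos_of_ne_zero h)
  omega

theorem colLen_rowLen_zero (μ : YoungDiagram) : μ.colLen (μ.rowLen 0) = 0 := by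
  by_contra h
  have := (lt_rowLen_iff_lt_colLen μ 0 (μ.rowLen 0)).mpr (Nat.pos_of_ne_zero h)
  omega

theorem degree_expo {m : ℕ} (Λ : MPart m) : (expo Λ).degree = Λ.size := by
  have h : (expo Λ).degree = ∑ j ∈ Finset.range (m + Λ.lam.colLen 0), expo Λ j := by
    rw [Finsupp.degree_apply]
    exact Finset.sum_subset Finsupp.support_onFinset_subset
        fun _ _ h => Finsupp.notMem_support_iff.mp h
  rw [h, Finset.sum_range_add, MPart.size, card_eq_sum_rowLen _ (rowLen_colLen_zero _)]
  congr 1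
  · rw [← Fin.sum_univ_eq_sum_range]
    exact Finset.sum_congr rfl fun i _ => by rw [expo_apply, dif_pos i.2]
  · exact Finset.sum_congr rfl fun r _ => expo_add Λ r

theorem size_mtype (m : ℕ) (d : ℕ →₀ ℕ) : (mtype m d).size = d.degree := by
  rw [← degree_expo, degree_expo_mtype]

theorem finite_card_le (N : ℕ) : {μ : YoungDiagram | μ.card ≤ N}.Finite := by
  refine Set.Finite.of_finite_image (f := YoungDiagram.cells) (Set.Finite.subset
    (Finset.finite_toSet (Finset.range N ×ˢ Finset.range N).powerset) ?_)
    (fun μ _ ν _ h => YoungDiagram.ext h)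
  rintro _ ⟨μ, hμ, rfl⟩
  rw [Finset.mem_coe, Finset.mem_powerset]
  rintro ⟨r, c⟩ hx
  rw [YoungDiagram.mem_cells] at hx
  have h1 : μ.colLen c ≤ μ.card := by
    rw [YoungDiagram.colLen_eq_card]
    exact Finset.card_le_card (Finset.filter_subset _ _)
  have h2 : μ.rowLen r ≤ μ.card := by
    rw [YoungDiagram.rowLen_eq_card]
    exact Finset.card_le_card (Finset.filter_subset _ _)
  have h3 := YoungDiagram.mem_iff_lt_colLen.mp hx
  have h4 := YoungDiagram.mem_iff_lt_rowLen.mp hx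
  have h5 : μ.card ≤ N := hμ
  simp only [Finset.mem_product, Finset.mem_range]
  omega

theorem finite_size_le (m N : ℕ) : {Λ : MPart m | Λ.size ≤ N}.Finite := by
  refine Set.Finite.of_finite_image (f := fun Λ => (Λ.a, Λ.lam)) (Set.Finite.subset
    ((Set.Finite.pi fun _ : Fin m => Set.finite_Iic N).prod (finite_card_le N)) ?_)
    (fun Λ _ Ω _ h => MPart.ext (congrArg Prod.fst h) (congrArg Prod.snd h))
  rintro _ ⟨Λ, hΛ, rfl⟩
  have h : ∑ i, Λ.a i + Λ.lam.card ≤ N := hΛ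
  refine ⟨fun i _ => ?_, ?_⟩
  · have := Finset.single_le_sum (f := Λ.a) (fun _ _ => Nat.zero_le _) (Finset.mem_univ i)
    simp only [Set.mem_Iic]
    omega
  · simp only [Set.mem_ofPred_eq]
    omega

open Classical in
/-- The sum of the monomials in the orbit of an `m`-partition. -/
noncomputable def monoPS {m : ℕ} (Λ : MPart m) : PS := fun d => if mtype m d = Λ then 1 else 0

open Classical in
theorem coeff_monoPS {m : ℕ} (Λ : MPart m) (d : ℕ →₀ ℕ) :
    coeff d (monoPS Λ) = if mtype m d = Λ then 1 else 0 := rfl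

/-- The monomial `m`-symmetric function: the sum of the monomials in the orbit of an
`m`-partition. -/
noncomputable def monoFun {m : ℕ} (Λ : MPart m) : R m :=
  ⟨monoPS Λ, by
    refine ⟨fun i j hi hj => ?_, Λ.size, fun d hd => ?_⟩
    · ext d
      rw [coeff_swap, coeff_monoPS, coeff_monoPS, mtype_swap hi hj]
    · rw [coeff_monoPS, if_neg]
      rintro rfl
      rw [size_mtype] at hd
      exact lt_irrefl _ hd⟩

open Classical in
theorem coeff_monoFun {m : ℕ} (Λ : MPart m) (d : ℕ →₀ ℕ) :
    coeff d (monoFun Λ : PS) = if mtype m d = Λ then 1 else 0 := rfl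

/-- A coefficient as a linear form on `R_m`. -/
noncomputable def coeffForm {m : ℕ} (d : ℕ →₀ ℕ) : R m →ₗ[QT] QT :=
  (coeff d).comp (R m).val.toLinearMap

theorem coeffForm_apply {m : ℕ} (d : ℕ →₀ ℕ) (f : R m) : coeffForm d f = coeff d (f : PS) := rfl

open Classical in
theorem coeffForm_monoFun {m : ℕ} (Λ Ω : MPart m) :
    coeffForm (expo Λ) (monoFun Ω) = if Λ = Ω then 1 else 0 := by
  rw [coeffForm_apply, coeff_monoFun, mtype_expo]

theorem linearIndependent_monoFun (m : ℕ) : LinearIndependent QT (monoFun (m := m)) := by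
  classical
  rw [linearIndependent_iff']
  intro s g hg Λ hΛ
  have h := congrArg (coeffForm (expo Λ)) hg
  rw [map_sum, map_zero] at h
  simpa [coeffForm_monoFun, hΛ] using h

/-- Bounded degree leaves only finitely many orbits, and a function in R_m is determined by one
coefficient on each of them. -/
theorem eq_sum_monoFun {m N : ℕ} (f : R m)
    (hN : ∀ d : ℕ →₀ ℕ, N < d.degree → coeff d (f : PS) = 0) :
    f = ∑ Λ ∈ (finite_size_le m N).toFinset, coeffForm (expo Λ) f • monoFun Λ := by
  classical
  ext d
  change _ = coeffForm d _
  rw [map_sum]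
  simp only [map_smul, coeffForm_apply, coeff_monoFun, smul_eq_mul, mul_ite, mul_one, mul_zero]
  rw [Finset.sum_ite_eq]
  split_ifs with h
  · exact coeff_eq_coeff_expo f d
  · refine hN d ?_
    simpa [size_mtype] using h

theorem span_monoFun (m : ℕ) : ⊤ ≤ Submodule.span QT (Set.range (monoFun (m := m))) := by
  intro f _
  obtain ⟨N, hN⟩ := f.2.2
  rw [eq_sum_monoFun f hN]
  exact Submodule.sum_mem _ fun Λ _ => Submodule.smul_mem _ _
    (Submodule.subset_span (Set.mem_range_self Λ))

/-- The basis of `R_m` that consists of the monomial `m`-symmetric functions. -/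
noncomputable def monoBasis (m : ℕ) : Module.Basis (MPart m) QT (R m) :=
  Module.Basis.mk (linearIndependent_monoFun m) (span_monoFun m)

theorem monoBasis_repr {m : ℕ} (f : R m) (Λ : MPart m) :
    (monoBasis m).repr f Λ = coeff (expo Λ) (f : PS) := by
  classical
  have h : (monoBasis m).coord Λ = coeffForm (expo Λ) := by
    refine (monoBasis m).ext fun Ω => ?_
    rw [Module.Basis.coord_apply, Module.Basis.repr_self, monoBasis, Module.Basis.mk_apply,
      coeffForm_monoFun, Finsupp.single_apply]
    exact if_congr eq_comm rfl rfl
  exact congrArg (fun φ => φ f) h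

/-- The homogeneous functions of degree `n`. -/
def homog (m n : ℕ) : Submodule QT (R m) where
  carrier := {f | ∀ d : ℕ →₀ ℕ, d.degree ≠ n → coeff d (f : PS) = 0}
  zero_mem' := fun d _ => map_zero (coeff d)
  add_mem' := by
    intro f g hf hg d hd
    rw [Subalgebra.coe_add, map_add, hf d hd, hg d hd, add_zero]
  smul_mem' := by
    intro c f hf d hd
    rw [SetLike.val_smul, map_smul, hf d hd, smul_zero]

theorem mul_mem_homog {m k n : ℕ} {f g : R m} (hf : f ∈ homog m k) (hg : g ∈ homog m n) :
    f * g ∈ homog m (k + n) := by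
  classical
  intro d hd
  rw [Subalgebra.coe_mul, coeff_mul]
  refine Finset.sum_eq_zero fun p hp => ?_
  have h : p.1.degree + p.2.degree = d.degree := by
    rw [← Finset.HasAntidiagonal.mem_antidiagonal.mp hp, map_add]
  by_cases h1 : p.1.degree = k
  · rw [hg p.2 (by omega), mul_zero]
  · rw [hf p.1 h1, zero_mul]

theorem one_mem_homog (m : ℕ) : (1 : R m) ∈ homog m 0 := by
  classical
  intro d hd
  change coeff d (1 : PS) = 0
  rw [coeff_one, if_neg]
  rintro rfl
  simp at hd

/-- The divided difference lowers the degree by one, and the linear factor in front of it restores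
it. -/
theorem heckeT_mem_homog {m n i : ℕ} (hi : i + 1 < m) {f : R m} (hf : f ∈ homog m n) :
    heckeT m i hi f ∈ homog m n := by
  have hd : ∀ e : ℕ →₀ ℕ, e.degree + 1 ≠ n → coeff e (dividedDiff i (i + 1) (f : PS)) = 0 := by
    intro e he
    rw [coeff_dividedDiff]
    refine Finset.sum_eq_zero fun k hk => ?_
    rw [Finset.mem_range] at hk
    have hle : Finsupp.single (i + 1) k ≤ e + Finsupp.single i (k + 1) := by
      rw [Finsupp.single_le_iff]
      simp
      omega
    have hdeg : (e + Finsupp.single i (k + 1) - Finsupp.single (i + 1) k).degree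
        = e.degree + 1 := by
      have h5 := congrArg Finsupp.degree (tsub_add_cancel_of_le hle)
      simp only [map_add, Finsupp.degree_single] at h5
      omega
    rw [map_sub, coeff_swap, hf _ (by omega), hf _ (by rw [Finsupp.degree_mapDomain]; omega),
      sub_zero]
  have hX : ∀ (j : ℕ) (d : ℕ →₀ ℕ), d.degree ≠ n →
      coeff d (X j * dividedDiff i (i + 1) (f : PS)) = 0 := by
    intro j d hdn
    by_cases h : d j = 0
    · exact coeff_X_mul_of_zero _ _ _ h
    · rw [coeff_X_mul_of_pos _ _ _ h]
      apply hd
      have hle : Finsupp.single j 1 ≤ d := by rw [Finsupp.single_le_iff]; omega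
      have h5 := congrArg Finsupp.degree (tsub_add_cancel_of_le hle)
      simp only [map_add, Finsupp.degree_single] at h5
      omega
  intro d hdn
  rw [coe_heckeT_eq, sub_mul, map_sub, map_sub, mul_assoc, ← smul_eq_C_mul, map_smul, map_smul,
    hf d hdn, hX _ d hdn, hX _ d hdn]
  simp

theorem xPow_mem_homog {m : ℕ} (a : Fin m → ℕ) : xPow a ∈ homog m (∑ i, a i) := by
  classical
  intro d hd
  change coeff d (monomial _ _) = 0
  rw [coeff_monomial, if_neg]
  rintro rfl
  apply hd
  rw [Finsupp.embDomain_eq_mapDomain, Finsupp.degree_mapDomain, Finsupp.degree_eq_sum]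
  rfl

theorem sum_swapAt {m : ℕ} (a : Fin m → ℕ) {i : ℕ} (hi : i + 1 < m) :
    ∑ j, swapAt a i hi j = ∑ j, a j := sum_comp_swapAt a hi fun x => x

theorem hallLittlewood_mem_homog {m : ℕ} (a : Fin m → ℕ) :
    hallLittlewood a ∈ homog m (∑ i, a i) := by
  induction hn : sortMeasure a using Nat.strong_induction_on generalizing a with
  | _ n ih =>
  subst hn
  by_cases h : ∃ i, IsAscent a i
  · obtain ⟨i, hi⟩ := h
    rw [hallLittlewood_of_ascent a i hi, ← sum_swapAt a hi.1]
    exact heckeT_mem_homog hi.1 (ih _ (sortMeasure_swapAt a i hi) _ rfl)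
  · rw [hallLittlewood_of_antitone (antitone_of_no_ascent h)]
    exact xPow_mem_homog a

/-! ### Homogeneity of the Schur functions and of the k_Λ -/

theorem hFun_mem_homog (m : ℕ) (n : ℕ) : hFun m n ∈ homog m n := by
  intro d hd
  change coeff d (hPS _) = 0
  rw [coeff_hPS, if_neg (by exact_mod_cast hd)]

theorem hFun_of_neg (m : ℕ) {r : ℤ} (h : r < 0) : hFun m r = 0 := by
  ext d
  change coeff d (hPS _) = 0
  rw [coeff_hPS, if_neg (by omega)]

theorem hFun_zero (m : ℕ) : hFun m 0 = 1 := by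
  classical
  ext d
  change coeff d (hPS _) = coeff d (1 : PS)
  rw [coeff_hPS, coeff_one]
  refine if_congr ?_ rfl rfl
  rw [Nat.cast_eq_zero, Finsupp.degree_eq_zero_iff]

/-- A factor with negative index makes the product 0, so integer indices are harmless; this is the
form needed for the Jacobi–Trudi terms. -/
theorem prod_hFun_mem_homog {m : ℕ} {ι : Type*} (s : Finset ι) (r : ι → ℤ) (n : ℕ)
    (hn : ∑ i ∈ s, r i = n) : ∏ i ∈ s, hFun m (r i) ∈ homog m n := by
  classical
  by_cases hneg : ∃ i ∈ s, r i < 0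
  · obtain ⟨i, hi, h⟩ := hneg
    rw [Finset.prod_eq_zero hi (hFun_of_neg m h)]
    exact zero_mem _
  push Not at hneg
  induction s using Finset.induction_on generalizing n with
  | empty =>
    simp only [Finset.sum_empty] at hn
    obtain rfl : n = 0 := by omega
    exact one_mem_homog m
  | insert i s hi ih =>
    rw [Finset.sum_insert hi] at hn
    rw [Finset.prod_insert hi]
    have h0 := hneg i (Finset.mem_insert_self i s)
    have h1 : 0 ≤ ∑ i ∈ s, r i :=
      Finset.sum_nonneg fun j hj => hneg j (Finset.mem_insert_of_mem hj)
    obtain ⟨k, hk⟩ := Int.eq_ofNat_of_zero_le h0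
    obtain ⟨l, hl⟩ := Int.eq_ofNat_of_zero_le h1
    obtain rfl : n = k + l := by omega
    rw [hk]
    exact mul_mem_homog (hFun_mem_homog m k)
      (ih l hl fun j hj => hneg j (Finset.mem_insert_of_mem hj))

theorem sum_jacobiTrudi_index (lam : YoungDiagram) (σ : Equiv.Perm (Fin (lam.colLen 0))) :
    ∑ i, ((lam.rowLen (σ i : ℕ) : ℤ) - ((σ i : ℕ) : ℤ) + ((i : ℕ) : ℤ)) = lam.card := by
  rw [Finset.sum_add_distrib, Equiv.sum_comp σ fun i : Fin (lam.colLen 0) =>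
    (lam.rowLen (i : ℕ) : ℤ) - ((i : ℕ) : ℤ), Finset.sum_sub_distrib,
    card_eq_sum_rowLen lam (rowLen_colLen_zero lam), ← Fin.sum_univ_eq_sum_range]
  push_cast
  ring

theorem schurFn_eq_sum (m : ℕ) (lam : YoungDiagram) : schurFn m lam =
    ∑ σ : Equiv.Perm (Fin (lam.colLen 0)), Equiv.Perm.sign σ • ∏ i, hFun m
      ((lam.rowLen (σ i : ℕ) : ℤ) - ((σ i : ℕ) : ℤ) + ((i : ℕ) : ℤ)) := by
  rw [schurFn, Matrix.det_apply]
  rfl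

theorem schurFn_mem_homog (m : ℕ) (lam : YoungDiagram) : schurFn m lam ∈ homog m lam.card := by
  rw [schurFn_eq_sum]
  refine Submodule.sum_mem _ fun σ _ => ?_
  have h := prod_hFun_mem_homog (m := m) Finset.univ _ _ (sum_jacobiTrudi_index lam σ)
  rcases Int.units_eq_one_or (Equiv.Perm.sign σ) with h1 | h1
  · rw [h1, one_smul]; exact h
  · rw [h1, Units.neg_smul, one_smul]; exact neg_mem h

theorem kFun_mem_homog {m : ℕ} (Λ : MPart m) : kFun Λ ∈ homog m Λ.size :=
  mul_mem_homog (hallLittlewood_mem_homog Λ.a) (schurFn_mem_homog m Λ.lam)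

/-! ## The span of the Hall–Littlewood polynomials -/

theorem xPow_add {m : ℕ} (a b : Fin m → ℕ) : xPow (a + b) = xPow a * xPow b := by
  ext1
  change monomial _ _ = monomial _ _ * monomial _ _
  rw [monomial_mul_monomial, one_mul]
  congr 2
  rw [Finsupp.embDomain_eq_mapDomain, Finsupp.embDomain_eq_mapDomain,
    Finsupp.embDomain_eq_mapDomain, ← Finsupp.mapDomain_add]
  congr 1
  ext x
  rfl

theorem xPow_zero (m : ℕ) : xPow (0 : Fin m → ℕ) = 1 := by
  ext1
  change monomial _ _ = (1 : PS)
  rw [← monomial_zero_one]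
  have : Finsupp.equivFunOnFinite.symm (0 : Fin m → ℕ) = 0 := by ext x; rfl
  rw [this, Finsupp.embDomain_zero]

theorem coe_xPow_single {m : ℕ} (i : Fin m) (k : ℕ) :
    (xPow (Pi.single i k : Fin m → ℕ) : PS) = X (i : ℕ) ^ k := by
  change monomial _ _ = _
  rw [X_pow_eq]
  congr 1
  have : Finsupp.equivFunOnFinite.symm (Pi.single i k : Fin m → ℕ) = Finsupp.single i k := by
    ext x
    simp [Finsupp.single_apply]
  rw [this, Finsupp.embDomain_single]
  rfl

theorem sum_sq_add_single {m : ℕ} (e : Fin m → ℕ) {i j : Fin m} (hij : i ≠ j) (k l : ℕ) :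
    ∑ x, (e + Pi.single i k + Pi.single j l : Fin m → ℕ) x ^ 2 =
      ∑ x, e x ^ 2 + (2 * k * e i + k ^ 2) + (2 * l * e j + l ^ 2) := by
  have h : ∀ x, (e + Pi.single i k + Pi.single j l : Fin m → ℕ) x ^ 2 = e x ^ 2 +
      (if x = i then 2 * k * e x + k ^ 2 else 0) + (if x = j then 2 * l * e x + l ^ 2 else 0) := by
    intro x
    simp only [Pi.add_apply, Pi.single_apply]
    split_ifs with h1 h2
    · exact absurd (h1.symm.trans h2) hij
    · ring
    · ring
    · ring
  simp only [h, Finset.sum_add_distrib, Finset.sum_ite_eq', Finset.mem_univ, if_true]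

/-- The geometric sum for (x_i^n - x_{i+1}^n)/(x_i - x_{i+1}). Besides the exchanged power only
mixed monomials appear, which have a smaller sum of squared exponents. -/
theorem heckeT_xPow_single {m i : ℕ} (hi : i + 1 < m) (n : ℕ) :
    heckeT m i hi (xPow (Pi.single ⟨i, by omega⟩ (n + 1))) = xPow (Pi.single ⟨i + 1, hi⟩ (n + 1)) +
      (1 - tt) • ∑ k ∈ Finset.range n,
        xPow (Pi.single ⟨i, by omega⟩ (k + 1) + Pi.single ⟨i + 1, hi⟩ (n - k)) := by
  rw [heckeT_eq_iff]
  have hC : (C (1 - tt) : PS) = 1 - C tt := by rw [map_sub, map_one]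
  simp only [Subalgebra.coe_add, SetLike.val_smul, AddSubmonoidClass.coe_finsetSum, xPow_add,
    Subalgebra.coe_mul, coe_xPow_single, map_pow, exch_X, Equiv.swap_apply_left,
    smul_eq_C_mul, hC]
  have hg := geom_sum₂_mul (X i : PS) (X (i + 1)) n
  have hs : ∑ k ∈ Finset.range n, (X i : PS) ^ (k + 1) * X (i + 1) ^ (n - k) =
      X i * X (i + 1) * ∑ k ∈ Finset.range n, (X i : PS) ^ k * X (i + 1) ^ (n - 1 - k) := by
    rw [Finset.mul_sum]
    refine Finset.sum_congr rfl fun k hk => ?_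
    rw [Finset.mem_range] at hk
    rw [show n - k = (n - 1 - k) + 1 by omega]
    ring
  rw [hs]
  linear_combination (1 - C tt) * X i * X (i + 1) * hg

/-- The span of the non-symmetric Hall–Littlewood polynomials. -/
noncomputable def hallSpan (m : ℕ) : Submodule QT (R m) :=
  Submodule.span QT (Set.range (hallLittlewood (m := m)))

theorem heckeT_mem_hallSpan {m i : ℕ} (hi : i + 1 < m) {f : R m} (hf : f ∈ hallSpan m) :
    heckeT m i hi f ∈ hallSpan m := by
  have h : hallSpan m ≤ (hallSpan m).comap (heckeT m i hi) := by
    rw [hallSpan, Submodule.span_le]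
    rintro _ ⟨a, rfl⟩
    have hm : ∀ b : Fin m → ℕ, hallLittlewood b ∈ hallSpan m := fun b =>
      Submodule.subset_span (Set.mem_range_self b)
    change heckeT m i hi (hallLittlewood a) ∈ hallSpan m
    rcases lt_trichotomy (a ⟨i, by omega⟩) (a ⟨i + 1, hi⟩) with h | h | h
    · rw [heckeT_hallLittlewood_ascent a hi h]
      exact add_mem (Submodule.smul_mem _ _ (hm _)) (Submodule.smul_mem _ _ (hm _))
    · rw [heckeT_hallLittlewood_eq a hi h]
      exact Submodule.smul_mem _ _ (hm _)
    · rw [heckeT_hallLittlewood_descent a hi h]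
      exact hm _
  exact h hf

/-- Induction on the sum of squares, then on the sorting measure. At an ascent, T_i x^{s_i c} is x^c
plus mixed monomials with smaller sum of squares; s_i c is closer to dominant, and the span is
stable under T_i. -/
theorem xPow_mem_hallSpan {m : ℕ} (c : Fin m → ℕ) : xPow c ∈ hallSpan m := by
  induction hN : ∑ j, c j ^ 2 using Nat.strong_induction_on generalizing c with
  | _ N ihN =>
  induction hn : sortMeasure c using Nat.strong_induction_on generalizing c with
  | _ n ih =>
  subst hN hn
  by_cases hasc : ∃ i, IsAscent c i
  swap
  · rw [← hallLittlewood_of_antitone (antitone_of_no_ascent hasc)]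
    exact Submodule.subset_span (Set.mem_range_self c)
  obtain ⟨i, hi, hlt⟩ := hasc
  have hm := ih _ (sortMeasure_swapAt c i ⟨hi, hlt⟩) _ (sum_comp_swapAt c hi (· ^ 2)) rfl
  have hT := heckeT_mem_hallSpan hi hm
  set u : Fin m := ⟨i, by omega⟩ with hu
  set v : Fin m := ⟨i + 1, hi⟩ with hv
  have huv : u ≠ v := by simp [hu, hv]
  -- The excess of the larger entry is r + 1. The rest e has equal entries at u and v, so x^e passes
  -- through T_i.
  obtain ⟨r, hr⟩ := Nat.exists_eq_add_of_lt hlt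
  set e : Fin m → ℕ := Function.update c v (c u) with he
  have heu : e u = c u := Function.update_of_ne huv _ _
  have hev : e v = c u := Function.update_self _ _ _
  have h1 : c = e + Pi.single v (r + 1) := by
    ext x
    rcases eq_or_ne x v with rfl | hx
    · rw [Pi.add_apply, hev, Pi.single_eq_same, hr]; ring
    · rw [Pi.add_apply, Pi.single_eq_of_ne hx, he, Function.update_of_ne hx]; rfl
  have h2 : swapAt c i hi = e + Pi.single u (r + 1) := by
    ext x
    rcases eq_or_ne x u with rfl | hx
    · rw [hu, swapAt_left, ← hu, Pi.add_apply, heu, Pi.single_eq_same, ← hv, hr]; ring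
    rcases eq_or_ne x v with rfl | hx'
    · rw [hv, swapAt_right, ← hv, Pi.add_apply, hev, Pi.single_eq_of_ne hx]; rfl
    · rw [Pi.add_apply, Pi.single_eq_of_ne hx, he, Function.update_of_ne hx',
        swapAt_of_ne _ _ _ (fun h => hx (Fin.ext h)) (fun h => hx' (Fin.ext h))]; rfl
  have hsymm : exch i (i + 1) (xPow e : PS) = xPow e := by
    rw [exch_xPow e hi, swapAt_eq_self e hi (heu.trans hev.symm)]
  rw [h2, xPow_add, mul_comm, heckeT_mul_of_symm hi _ _ hsymm, heckeT_xPow_single hi, add_mul,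
    mul_comm, ← xPow_add, ← h1] at hT
  refine (Submodule.add_mem_iff_left _ ?_).mp hT
  rw [smul_mul_assoc, Finset.sum_mul]
  refine Submodule.smul_mem _ _ (Submodule.sum_mem _ fun k hk => ?_)
  rw [mul_comm, ← xPow_add, ← add_assoc]
  refine ihN _ ?_ _ rfl
  rw [Finset.mem_range] at hk
  -- A zero increment at u puts c into the same form as the mixed exponents. It remains that (k+1)²
  -- + (l+1)² < (k+l+2)².
  have hc : ∑ j, c j ^ 2 = ∑ j, (e + Pi.single u 0 + Pi.single v (r + 1) : Fin m → ℕ) j ^ 2 := by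
    conv_lhs => rw [h1]
    simp
  rw [hc, sum_sq_add_single _ huv, sum_sq_add_single _ huv, heu, hev]
  obtain ⟨l, rfl⟩ := Nat.exists_eq_add_of_lt hk
  rw [show k + l + 1 - k = l + 1 by omega]
  nlinarith [Nat.zero_le (k * l)]

/-! ## The span of the Schur functions -/

/-- The span of the Schur functions. -/
noncomputable def schurSpan (m : ℕ) : Submodule QT (R m) :=
  Submodule.span QT (Set.range (schurFn m))

/-- The product of complete homogeneous symmetric functions indexed by a multiset. -/
noncomputable def hProd (m : ℕ) (S : Multiset ℕ) : R m := (S.map fun n : ℕ => hFun m n).prod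

theorem hProd_filter_pos (m : ℕ) (S : Multiset ℕ) : hProd m (S.filter (0 < ·)) = hProd m S := by
  induction S using Multiset.induction_on with
  | empty => rfl
  | cons a S ih =>
    rcases Nat.eq_zero_or_pos a with rfl | h
    · rw [Multiset.filter_cons_of_neg _ (lt_irrefl 0), ih, hProd, hProd, Multiset.map_cons,
        Multiset.prod_cons, Nat.cast_zero, hFun_zero, one_mul]
    · rw [Multiset.filter_cons_of_pos S (p := (0 < ·)) h, hProd, Multiset.map_cons, Multiset.prod_cons]
      change _ * hProd m _ = _
      rw [ih, hProd, hProd, Multiset.map_cons, Multiset.prod_cons]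

theorem sum_filter_pos (S : Multiset ℕ) : (S.filter (0 < ·)).sum = S.sum := by
  induction S using Multiset.induction_on with
  | empty => rfl
  | cons a S ih =>
    rcases Nat.eq_zero_or_pos a with rfl | h
    · rw [Multiset.filter_cons_of_neg _ (lt_irrefl 0), ih, Multiset.sum_cons, zero_add]
    · rw [Multiset.filter_cons_of_pos S (p := (0 < ·)) h, Multiset.sum_cons, ih, Multiset.sum_cons]

theorem sum_sq_filter_pos (S : Multiset ℕ) :
    ((S.filter (0 < ·)).map (· ^ 2)).sum = (S.map (· ^ 2)).sum := by
  induction S using Multiset.induction_on with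
  | empty => rfl
  | cons a S ih =>
    rcases Nat.eq_zero_or_pos a with rfl | h
    · rw [Multiset.filter_cons_of_neg _ (lt_irrefl 0), ih]; simp
    · rw [Multiset.filter_cons_of_pos S (p := (0 < ·)) h, Multiset.map_cons, Multiset.sum_cons, ih,
        Multiset.map_cons, Multiset.sum_cons]

/-- Makes the truncated difference in the induction of `hProd_mem_schurSpan` an honest one. -/
theorem sum_sq_le_sq_sum (S : Multiset ℕ) : (S.map (· ^ 2)).sum ≤ S.sum ^ 2 := by
  induction S using Multiset.induction_on with
  | empty => simp
  | cons a S ih =>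
    rw [Multiset.map_cons, Multiset.sum_cons, Multiset.sum_cons]
    nlinarith [Nat.zero_le (a * S.sum)]

/-- Since g decreases strictly, σ must be increasing, and a finite chain has no order automorphism
but the identity. -/
theorem perm_eq_one_of_antivary {n : ℕ} {g : Fin n → ℤ} (hg : StrictAnti g)
    {σ : Equiv.Perm (Fin n)} (h : Antivary (fun i : Fin n => ((i : ℕ) : ℤ)) (g ∘ σ)) : σ = 1 := by
  have hmono : Monotone σ := by
    intro i j hij
    by_contra hlt
    have h1 := h (i := i) (j := j) (hg (not_le.mp hlt))
    have h2 : i = j := le_antisymm hij (by simpa using h1)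
    subst h2
    exact hlt le_rfl
  have hs : StrictMono σ := hmono.strictMono_of_injective σ.injective
  ext i
  exact congrArg Fin.val (DFunLike.congr_fun (Subsingleton.elim
    (hs.orderIsoOfSurjective σ σ.surjective) (OrderIso.refl (Fin n))) i)

/-- After expanding the squares only ∑ i g(σ i) depends on σ; by the strict rearrangement inequality
it is smallest at σ = 1 alone. -/
theorem sum_sq_jacobiTrudi_lt {n : ℕ} {g : Fin n → ℤ} (hg : StrictAnti g)
    {σ : Equiv.Perm (Fin n)} (hσ : σ ≠ 1) :
    ∑ i, (g i + ((i : ℕ) : ℤ)) ^ 2 < ∑ i, (g (σ i) + ((i : ℕ) : ℤ)) ^ 2 := by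
  have hav : Antivary (fun i : Fin n => ((i : ℕ) : ℤ)) g := by
    intro i j hij
    have := hg.lt_iff_gt.mp hij
    simp only [Nat.cast_le]
    exact this.le
  have h := (hav.sum_mul_lt_sum_mul_comp_perm_iff (σ := σ)).mpr
    fun h => hσ (perm_eq_one_of_antivary hg h)
  simp only [smul_eq_mul] at h
  have e : ∀ f : Fin n → ℤ, ∑ i, (f i + ((i : ℕ) : ℤ)) ^ 2 =
      ∑ i, f i ^ 2 + ∑ i : Fin n, ((i : ℕ) : ℤ) ^ 2 + 2 * ∑ i : Fin n, ((i : ℕ) : ℤ) * f i := by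
    intro f
    rw [Finset.mul_sum, ← Finset.sum_add_distrib, ← Finset.sum_add_distrib]
    exact Finset.sum_congr rfl fun i _ => by ring
  have h1 := e g
  have h2 := e (g ∘ σ)
  have h3 : ∑ i, (g ∘ σ) i ^ 2 = ∑ i, g i ^ 2 := Equiv.sum_comp σ fun i => g i ^ 2
  simp only [Function.comp] at h2 h3
  rw [h1, h2, h3]
  linarith

theorem prod_rowLen_eq_hProd (m : ℕ) (lam : YoungDiagram) :
    ∏ i : Fin (lam.colLen 0), hFun m (lam.rowLen (i : ℕ)) = hProd m lam.rowLens := by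
  rw [Fin.prod_univ_eq_prod_range fun i => hFun m (lam.rowLen i), Finset.prod_eq_multiset_prod,
    hProd, YoungDiagram.rowLens, ← Multiset.map_coe, Multiset.map_map]
  rfl

/-- In the Jacobi–Trudi expansion of s_λ the identity contributes h_λ. Every other permutation gives
zero or a product whose indices have the same sum and a strictly larger sum of squares, to which the
induction applies. -/
theorem hProd_mem_schurSpan (m : ℕ) (S : Multiset ℕ) : hProd m S ∈ schurSpan m := by
  induction hN : S.sum ^ 2 - (S.map (· ^ 2)).sum using Nat.strong_induction_on generalizing S with
  | _ N ih =>
  subst hN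
  -- Since h_0 = 1, zeros may be dropped; the positive indices in decreasing order are the rows of a
  -- diagram.
  set L := (S.filter (0 < ·)).sort (· ≥ ·) with hL
  have hLS : (L : Multiset ℕ) = S.filter (0 < ·) := Multiset.sort_eq _ _
  have hpos : ∀ x ∈ L, 0 < x := by
    intro x hx
    have : x ∈ (L : Multiset ℕ) := hx
    rw [hLS] at this
    exact Multiset.of_mem_filter this
  have hsort : L.SortedGE := (Multiset.pairwise_sort (S.filter (0 < ·)) (· ≥ ·)).sortedGE
  obtain ⟨lam, hlam⟩ : ∃ lam : YoungDiagram, lam.rowLens = L :=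
    ⟨_, YoungDiagram.rowLens_ofRowLens_eq_self (hw := hsort) hpos⟩
  have hprod : ∏ i : Fin (lam.colLen 0), hFun m (lam.rowLen (i : ℕ)) = hProd m S := by
    rw [prod_rowLen_eq_hProd, hlam, hLS, hProd_filter_pos]
  have hmap : (Finset.univ.val.map fun i : Fin (lam.colLen 0) => lam.rowLen (i : ℕ)) =
      S.filter (0 < ·) := by
    rw [← hLS, ← hlam, YoungDiagram.rowLens, ← Multiset.map_coe, Multiset.coe_range,
      ← Finset.range_val, ← Nat.Iio_eq_range, ← Fin.map_valEmbedding_univ, Finset.map_val,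
      Multiset.map_map]
    rfl
  have hsum : ∑ i : Fin (lam.colLen 0), lam.rowLen (i : ℕ) = S.sum := by
    rw [← sum_filter_pos, ← hmap]; rfl
  have hsq : ∑ i : Fin (lam.colLen 0), lam.rowLen (i : ℕ) ^ 2 = (S.map (· ^ 2)).sum := by
    rw [← sum_sq_filter_pos, ← hmap, Multiset.map_map]; rfl
  have hs : schurFn m lam ∈ schurSpan m := Submodule.subset_span (Set.mem_range_self lam)
  rw [schurFn_eq_sum, ← Finset.add_sum_erase _ _
    (Finset.mem_univ (1 : Equiv.Perm (Fin (lam.colLen 0))))] at hs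
  have h1 : (∏ i : Fin (lam.colLen 0), hFun m ((lam.rowLen ((1 : Equiv.Perm (Fin (lam.colLen 0))) i : ℕ) : ℤ) -
      (((1 : Equiv.Perm (Fin (lam.colLen 0))) i : ℕ) : ℤ) + ((i : ℕ) : ℤ))) = hProd m S := by
    rw [← hprod]
    refine Finset.prod_congr rfl fun i _ => ?_
    simp
  rw [h1, Equiv.Perm.sign_one, one_smul] at hs
  refine (Submodule.add_mem_iff_left _ (Submodule.sum_mem _ fun σ hσ => ?_)).mp hs
  have hσ1 : σ ≠ 1 := Finset.ne_of_mem_erase hσ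
  suffices h : (∏ i : Fin (lam.colLen 0), hFun m ((lam.rowLen (σ i : ℕ) : ℤ) -
      ((σ i : ℕ) : ℤ) + ((i : ℕ) : ℤ))) ∈ schurSpan m by
    rcases Int.units_eq_one_or (Equiv.Perm.sign σ) with h1 | h1
    · rw [h1, one_smul]; exact h
    · rw [h1, Units.neg_smul, one_smul]; exact neg_mem h
  by_cases hneg : ∃ i : Fin (lam.colLen 0), (lam.rowLen (σ i : ℕ) : ℤ) -
      ((σ i : ℕ) : ℤ) + ((i : ℕ) : ℤ) < 0
  · obtain ⟨i, hi⟩ := hneg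
    rw [Finset.prod_eq_zero (Finset.mem_univ i) (hFun_of_neg m hi)]
    exact zero_mem _
  push Not at hneg
  choose r hr using fun i => Int.eq_ofNat_of_zero_le (hneg i)
  have hanti : StrictAnti fun i : Fin (lam.colLen 0) =>
      (lam.rowLen (i : ℕ) : ℤ) - ((i : ℕ) : ℤ) := by
    intro i j hij
    have h1 := lam.rowLen_anti i j hij.le
    have h2 : (i : ℕ) < j := hij
    simp only
    omega
  have hlt := sum_sq_jacobiTrudi_lt hanti hσ1
  have hsum' : ∑ i, r i = S.sum := by
    have h := sum_jacobiTrudi_index lam σ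
    simp only [hr] at h
    rw [card_eq_sum_rowLen lam (rowLen_colLen_zero lam), ← Fin.sum_univ_eq_sum_range, hsum] at h
    exact_mod_cast h
  simp only [sub_add_cancel, hr] at hlt
  have hlt' : (S.map (· ^ 2)).sum < ∑ i, r i ^ 2 := by
    rw [← hsq]
    exact_mod_cast hlt
  simp only [hr]
  have e1 : (Finset.univ.val.map r).sum = S.sum := hsum'
  have e2 : ((Finset.univ.val.map r).map (· ^ 2)).sum = ∑ i, r i ^ 2 := by
    rw [Multiset.map_map]; rfl
  have h := ih _ ?_ (Finset.univ.val.map r) rfl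
  · rw [hProd, Multiset.map_map] at h
    exact h
  · have := sum_sq_le_sq_sum (Finset.univ.val.map r)
    rw [e1, e2] at this ⊢
    omega

theorem xPow_mul_hProd_mem {m : ℕ} (c : Fin m → ℕ) (S : Multiset ℕ) :
    xPow c * hProd m S ∈ Submodule.span QT (Set.range (kFun (m := m))) := by
  have h := Submodule.mul_mem_mul (xPow_mem_hallSpan c) (hProd_mem_schurSpan m S)
  rw [hallSpan, schurSpan, Submodule.span_mul_span] at h
  refine Submodule.span_mono ?_ h
  rintro _ ⟨_, ⟨a, rfl⟩, _, ⟨lam, rfl⟩, rfl⟩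
  exact ⟨⟨a, lam⟩, rfl⟩

/-- The subalgebra of `R_m` generated by the monomials in the first `m` variables and the complete
homogeneous symmetric functions. -/
noncomputable def genAlg (m : ℕ) : Subalgebra QT (R m) :=
  Algebra.adjoin QT (Set.range (xPow (m := m)) ∪ Set.range fun n : ℕ => hFun m n)

/-- Products of generators collect into one monomial times one product of h's, and the two factors
expand separately into H_a and s_λ. -/
theorem genAlg_le (m : ℕ) :
    Subalgebra.toSubmodule (genAlg m) ≤ Submodule.span QT (Set.range (kFun (m := m))) := by
  rw [genAlg, Algebra.adjoin_eq_span, Submodule.span_le]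
  intro x hx
  obtain ⟨c, S, rfl⟩ : ∃ c S, x = xPow c * hProd m S := by
    induction hx using Submonoid.closure_induction with
    | mem x hx =>
      rcases hx with ⟨c, rfl⟩ | ⟨n, rfl⟩
      · exact ⟨c, 0, by simp [hProd]⟩
      · exact ⟨0, {n}, by simp [hProd, xPow_zero]⟩
    | one => exact ⟨0, 0, by simp [hProd, xPow_zero]⟩
    | mul x y _ _ hx hy =>
      obtain ⟨c, S, rfl⟩ := hx
      obtain ⟨c', S', rfl⟩ := hy
      refine ⟨c + c', S + S', ?_⟩
      rw [xPow_add, hProd, hProd, hProd, Multiset.map_add, Multiset.prod_add]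
      ring
  exact xPow_mul_hProd_mem c S

/-! ## Power sums, and the span of the functions `k_Λ` -/

open Classical in
/-- The power sum `∑_{j ≥ l} x_j^k`, for positive `k`. -/
noncomputable def powerPS (l k : ℕ) : PS := fun d =>
  if ∃ j, l ≤ j ∧ d = Finsupp.single j k then 1 else 0

open Classical in
theorem coeff_powerPS (l k : ℕ) (d : ℕ →₀ ℕ) :
    coeff d (powerPS l k) = if ∃ j, l ≤ j ∧ d = Finsupp.single j k then 1 else 0 := rfl

/-- The power sum `∑_{j ≥ l} x_j^k` as an element of `R_m`. -/
noncomputable def powerFun {l m : ℕ} (h : l ≤ m) (k : ℕ) : R m :=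
  ⟨powerPS l k, by
    classical
    refine ⟨fun i j hi hj => ?_, k, fun d hd => ?_⟩
    · ext d
      rw [coeff_swap, coeff_powerPS, coeff_powerPS]
      have hs : ∀ x, l ≤ x → l ≤ Equiv.swap i j x := by
        intro x hx
        rw [Equiv.swap_apply_def]
        split_ifs <;> omega
      have hd : (d.mapDomain (Equiv.swap i j)).mapDomain (Equiv.swap i j) = d := by
        ext x
        rw [mapDomain_swap_apply, mapDomain_swap_apply, Equiv.swap_apply_self]
      refine if_congr ⟨?_, ?_⟩ rfl rfl
      · rintro ⟨x, hx, h⟩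
        refine ⟨Equiv.swap i j x, hs x hx, ?_⟩
        rw [← hd, h, Finsupp.mapDomain_single]
      · rintro ⟨x, hx, rfl⟩
        exact ⟨Equiv.swap i j x, hs x hx, Finsupp.mapDomain_single⟩
    · rw [coeff_powerPS, if_neg]
      rintro ⟨j, _, rfl⟩
      rw [Finsupp.degree_single] at hd
      exact lt_irrefl _ hd⟩

theorem coeff_powerPS_mul {l k : ℕ} (hk : 0 < k) (f : PS) (d : ℕ →₀ ℕ) :
    coeff d (powerPS l k * f) = ∑ j ∈ d.support.filter (fun j => l ≤ j ∧ k ≤ d j),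
      coeff (d - Finsupp.single j k) f := by
  classical
  rw [coeff_mul]
  symm
  refine Finset.sum_of_injOn (fun j => (Finsupp.single j k, d - Finsupp.single j k)) ?_ ?_ ?_ ?_
  · intro i _ j _ h
    exact (Finsupp.single_left_inj hk.ne').mp (congrArg Prod.fst h)
  · intro j hj
    simp only [Finset.coe_filter, Set.mem_ofPred_eq] at hj
    rw [Finset.mem_coe, Finset.HasAntidiagonal.mem_antidiagonal]
    exact add_tsub_cancel_of_le (Finsupp.single_le_iff.mpr hj.2.2)
  · rintro ⟨u, v⟩ huv hn
    rw [Finset.HasAntidiagonal.mem_antidiagonal] at huv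
    rw [coeff_powerPS, if_neg, zero_mul]
    rintro ⟨j, hj, rfl⟩
    simp only at huv
    subst huv
    refine hn ⟨j, ?_, ?_⟩
    · have h1 : (Finsupp.single j k + v : ℕ →₀ ℕ) j = k + v j := by simp
      rw [Finset.mem_coe, Finset.mem_filter, Finsupp.mem_support_iff, h1]
      omega
    · simp
  · intro j hj
    simp only [Finset.mem_filter] at hj
    rw [coeff_powerPS, if_pos ⟨j, hj.2.1, rfl⟩, one_mul]

/-- Newton's identity. On the right, the coefficient of a monomial x^d of degree n counts the pairs
(j,k) with 1 ≤ k ≤ d_j, of which there are n. -/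
theorem natCast_mul_hPS (n : ℕ) : (n : PS) * hPS n =
    ∑ k ∈ Finset.Icc 1 n, powerPS 0 k * hPS ((n - k : ℕ) : ℤ) := by
  ext d
  rw [← map_natCast (C (σ := ℕ) (R := QT)), coeff_C_mul, map_sum, coeff_hPS]
  have h1 : ∀ k ∈ Finset.Icc 1 n, coeff d (powerPS 0 k * hPS ((n - k : ℕ) : ℤ)) =
      if (d.degree : ℤ) = n then ((d.support.filter fun j => k ≤ d j).card : QT) else 0 := by
    intro k hk
    rw [Finset.mem_Icc] at hk
    rw [coeff_powerPS_mul (by omega)]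
    have h2 : ∀ j ∈ d.support.filter (fun j => 0 ≤ j ∧ k ≤ d j),
        coeff (d - Finsupp.single j k) (hPS ((n - k : ℕ) : ℤ)) =
          if (d.degree : ℤ) = n then 1 else 0 := by
      intro j hj
      rw [Finset.mem_filter] at hj
      have h5 := congrArg Finsupp.degree
        (tsub_add_cancel_of_le (Finsupp.single_le_iff.mpr hj.2.2))
      simp only [map_add, Finsupp.degree_single] at h5
      rw [coeff_hPS]
      exact if_congr (by omega) rfl rfl
    rw [Finset.sum_congr rfl h2, Finset.sum_const]
    simp only [Nat.zero_le, true_and]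
    split_ifs <;> simp
  rw [Finset.sum_congr rfl h1]
  by_cases hd : (d.degree : ℤ) = n
  · simp only [hd, if_true, mul_one]
    have hd' : d.degree = n := by exact_mod_cast hd
    rw [← Nat.cast_sum]
    congr 1
    simp only [Finset.card_filter]
    rw [Finset.sum_comm, ← hd', Finsupp.degree_apply]
    refine Finset.sum_congr rfl fun j _ => ?_
    rw [← Finset.card_filter]
    have : (Finset.Icc 1 (∑ i ∈ d.support, d i)).filter (fun k => k ≤ d j) =
        Finset.Icc 1 (d j) := by
      have := le_degree d j
      rw [Finsupp.degree_apply] at this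
      ext k
      simp only [Finset.mem_filter, Finset.mem_Icc]
      omega
    rw [this, Nat.card_Icc, Nat.add_sub_cancel]
  · simp [hd]

theorem xPow_mem_genAlg {m : ℕ} (c : Fin m → ℕ) : xPow c ∈ genAlg m :=
  Algebra.subset_adjoin (Or.inl (Set.mem_range_self c))

theorem hFun_mem_genAlg (m n : ℕ) : hFun m n ∈ genAlg m :=
  Algebra.subset_adjoin (Or.inr (Set.mem_range_self n))

/-- Newton's identity is solved for p_n, whose cofactor is h_0 = 1. -/
theorem powerFun_zero_mem {m n : ℕ} (hn : 0 < n) : powerFun (Nat.zero_le m) n ∈ genAlg m := by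
  induction n using Nat.strong_induction_on with
  | _ n ih =>
  have h : (n : R m) * hFun m n = ∑ k ∈ Finset.Icc 1 n, powerFun (Nat.zero_le m) k *
      hFun m ((n - k : ℕ) : ℤ) := by
    ext1
    rw [AddSubmonoidClass.coe_finsetSum]
    exact natCast_mul_hPS n
  rw [← Finset.sum_erase_add _ _ (Finset.mem_Icc.mpr ⟨hn, le_rfl⟩), Nat.sub_self, Nat.cast_zero,
    hFun_zero, mul_one] at h
  have h1 : (n : R m) * hFun m n ∈ genAlg m :=
    mul_mem (natCast_mem _ n) (hFun_mem_genAlg m n)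
  rw [h] at h1
  refine (add_mem_cancel_left (Subalgebra.sum_mem _ fun k hk => ?_)).mp h1
  rw [Finset.mem_erase, Finset.mem_Icc] at hk
  exact mul_mem (ih k (by omega) (by omega)) (hFun_mem_genAlg m _)

/-- The powers of the first l ≤ m variables are generators and are removed from the full power sum
one at a time. -/
theorem powerFun_mem {l m n : ℕ} (h : l ≤ m) (hn : 0 < n) : powerFun h n ∈ genAlg m := by
  classical
  induction l with
  | zero => exact powerFun_zero_mem hn
  | succ l ih =>
    have h1 : powerFun (Nat.le_of_succ_le h) n = powerFun h n + xPow (Pi.single ⟨l, h⟩ n) := by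
      ext1
      rw [Subalgebra.coe_add, coe_xPow_single]
      ext d
      rw [map_add, coeff_X_pow]
      change coeff d (powerPS _ _) = coeff d (powerPS _ _) + _
      rw [coeff_powerPS, coeff_powerPS]
      have h2 : (∃ j, l ≤ j ∧ d = Finsupp.single j n) ↔
          (∃ j, l + 1 ≤ j ∧ d = Finsupp.single j n) ∨ d = Finsupp.single l n := by
        constructor
        · rintro ⟨j, hj, rfl⟩
          rcases Nat.eq_or_lt_of_le hj with rfl | hlt
          · exact Or.inr rfl
          · exact Or.inl ⟨j, hlt, rfl⟩
        · rintro (⟨j, hj, rfl⟩ | rfl)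
          · exact ⟨j, by omega, rfl⟩
          · exact ⟨l, le_rfl, rfl⟩
      rw [if_congr h2 rfl rfl]
      by_cases h3 : d = Finsupp.single l n
      · have h4 : ¬ ∃ j, l + 1 ≤ j ∧ d = Finsupp.single j n := by
          rintro ⟨j, hj, h5⟩
          rw [h3] at h5
          have := (Finsupp.single_left_inj hn.ne').mp h5
          omega
        rw [if_pos (Or.inr h3), if_neg h4, if_pos h3, zero_add]
      · rw [if_neg h3, add_zero]
        exact if_congr (or_iff_left h3) rfl rfl
    have h2 := ih (Nat.le_of_succ_le h)
    rw [h1] at h2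
    exact (add_mem_cancel_right (xPow_mem_genAlg _)).mp h2

/-! ### Generation of R_m by the variables and power sums -/

theorem tailCount_erase {m : ℕ} (d : ℕ →₀ ℕ) {j : ℕ} (hj : m ≤ j) (c : ℕ) :
    tailCount m d c = tailCount m (d.erase j) c + if c < d j then 1 else 0 := by
  have h : ((d.erase j).support.filter fun x => m ≤ x ∧ c < d.erase j x) =
      (d.support.filter fun x => m ≤ x ∧ c < d x).erase j := by
    ext x
    simp only [Finset.mem_filter, Finsupp.support_erase, Finset.mem_erase]
    constructor
    · rintro ⟨⟨h1, h2⟩, h3, h4⟩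
      rw [Finsupp.erase_ne h1] at h4
      exact ⟨h1, h2, h3, h4⟩
    · rintro ⟨h1, h2, h3, h4⟩
      rw [Finsupp.erase_ne h1]
      exact ⟨⟨h1, h2⟩, h3, h4⟩
  rw [tailCount, tailCount, h]
  by_cases hc : c < d j
  · have hm : j ∈ d.support.filter fun x => m ≤ x ∧ c < d x := by
      simp only [Finset.mem_filter, Finsupp.mem_support_iff]
      omega
    rw [if_pos hc, Finset.card_erase_add_one hm]
  · rw [if_neg hc, add_zero, Finset.erase_eq_of_notMem]
    simp only [Finset.mem_filter]
    omega

theorem monoFun_of_colLen_zero {m : ℕ} (Λ : MPart m) (h : Λ.lam.colLen 0 = 0) :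
    monoFun Λ = xPow Λ.a := by
  classical
  ext d
  rw [coeff_monoFun]
  change _ = coeff d (monomial _ _)
  rw [coeff_monomial]
  have hexp : expo Λ = Finsupp.embDomain Fin.valEmbedding (Finsupp.equivFunOnFinite.symm Λ.a) := by
    ext x
    rcases lt_or_ge x m with hx | hx
    · rw [expo_apply, dif_pos hx]
      exact (Finsupp.embDomain_apply_self Fin.valEmbedding
        (Finsupp.equivFunOnFinite.symm Λ.a) (⟨x, hx⟩ : Fin m)).symm
    · rw [expo_apply, dif_neg (by omega), Finsupp.embDomain_of_notMem_range Fin.valEmbedding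
        (Finsupp.equivFunOnFinite.symm Λ.a) _ (by rintro ⟨y, hy⟩; simp at hy; omega)]
      by_contra hne
      have := (lt_rowLen_iff_lt_colLen _ _ _).mp (Nat.pos_of_ne_zero hne)
      omega
  rw [← hexp]
  refine if_congr ⟨fun hd => ?_, fun hd => by rw [hd, mtype_expo]⟩ rfl rfl
  rw [← hd, expo_mtype_of_sorted]
  intro j hj
  have h0 : tailCount m d 0 = 0 := by rw [← colLen_mtype, hd, h]
  have h1 := tailCount_erase d (m := m) (show m ≤ j + 1 by omega) 0
  split_ifs at h1 <;> omega

/-- Induction on the number l of parts of λ. Remove a smallest part k and multiply the remaining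
monomial function by the power sum p_k of the tail variables. Either x_j^k meets a new variable,
which gives the orbit of Λ, or it enlarges an existing part, which gives fewer than l parts. -/
theorem monoFun_mem_genAlg {m : ℕ} (Λ : MPart m) : monoFun Λ ∈ genAlg m := by
  induction hl : Λ.lam.colLen 0 using Nat.strong_induction_on generalizing Λ with
  | _ l ih =>
  rcases Nat.eq_zero_or_pos l with rfl | hpos
  · rw [monoFun_of_colLen_zero Λ hl]
    exact xPow_mem_genAlg _
  set k := Λ.lam.rowLen (l - 1) with hk
  have hkc : ∀ c, c < k ↔ Λ.lam.colLen c = l := by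
    intro c
    rw [hk, lt_rowLen_iff_lt_colLen]
    have := Λ.lam.colLen_anti 0 c (Nat.zero_le _)
    omega
  have hk0 : 0 < k := (hkc 0).mpr hl
  have hanti : Antitone fun c => min (Λ.lam.colLen c) (l - 1) := fun c c' h =>
    min_le_min_right _ (Λ.lam.colLen_anti c c' h)
  have hC : (fun c => min (Λ.lam.colLen c) (l - 1)) (Λ.lam.rowLen 0) = 0 := by
    simp [colLen_rowLen_zero]
  set Λ' : MPart m := ⟨Λ.a, ofCols _ hanti (Λ.lam.rowLen 0)⟩ with hΛ'
  have hcol : ∀ c, Λ'.lam.colLen c = min (Λ.lam.colLen c) (l - 1) := colLen_ofCols hanti hC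
  set g : R m := powerFun le_rfl k * monoFun Λ' with hg
  have hgA : g ∈ genAlg m := mul_mem (powerFun_mem _ hk0) (ih (l - 1) (by omega) Λ' (by
    rw [hcol, hl]; omega))
  classical
  have hcoeff : ∀ d, coeff d (g : PS) = ((d.support.filter fun j => m ≤ j ∧ k ≤ d j).filter
      fun j => mtype m (d - Finsupp.single j k) = Λ').card := by
    intro d
    change coeff d (powerPS m k * (monoFun Λ' : PS)) = _
    rw [coeff_powerPS_mul hk0, Finset.card_filter]
    simp only [coeff_monoFun]
    push_cast
    rfl
  have hne : ∀ d, l ≤ tailCount m d 0 → coeff d (g : PS) ≠ 0 → mtype m d = Λ := by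
    intro d hd h0
    rw [hcoeff, Nat.cast_ne_zero, Finset.card_ne_zero] at h0
    obtain ⟨j, hj⟩ := h0
    simp only [Finset.mem_filter, mtype_eq_iff, hcol] at hj
    obtain ⟨⟨_, hmj, hkj⟩, ha, hc⟩ := hj
    have herase : (d - Finsupp.single j k).erase j = d.erase j := by
      ext x
      rcases eq_or_ne x j with rfl | hx
      · simp
      · simp [Finsupp.erase_ne hx, Finsupp.single_eq_of_ne hx]
    have hsub : (d - Finsupp.single j k) j = d j - k := by simp
    have h1 := tailCount_erase d hmj
    have h2 := tailCount_erase (d - Finsupp.single j k) hmj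
    rw [herase, hsub] at h2
    -- If d_j > k, position j would survive the subtraction of k, and at least l parts would remain
    -- instead of l - 1.
    have hdj : d j = k := by
      have h3 := h1 0
      have h4 := h2 0
      rw [hc, hl] at h4
      by_contra hne
      rw [if_pos (by omega)] at h3 h4
      omega
    rw [mtype_eq_iff]
    refine ⟨fun i => ?_, fun c => ?_⟩
    · rw [← ha i, Finsupp.tsub_apply, Finsupp.single_eq_of_ne (by omega)]
      rfl
    · have h3 := h1 c
      have h4 := h2 c
      rw [hdj, Nat.sub_self, if_neg (Nat.not_lt_zero c), hc] at h4
      have h5 := hkc c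
      have h6 := Λ.lam.colLen_anti 0 c (Nat.zero_le _)
      rw [hdj] at h3
      split_ifs at h3 <;> omega
  -- The coefficient is a number of positions, nonzero in characteristic 0 since the last part, at m
  -- + (l - 1), is one of them.
  have hΛ : coeff (expo Λ) (g : PS) ≠ 0 := by
    rw [hcoeff, Nat.cast_ne_zero, Finset.card_ne_zero]
    have hval : expo Λ (m + (l - 1)) = k := expo_add Λ (l - 1)
    refine ⟨m + (l - 1), ?_⟩
    simp only [Finset.mem_filter, Finsupp.mem_support_iff]
    refine ⟨⟨by omega, by omega, by omega⟩, ?_⟩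
    rw [mtype_eq_iff]
    refine ⟨fun i => ?_, fun c => ?_⟩
    · rw [Finsupp.tsub_apply, Finsupp.single_eq_of_ne (by omega), expo_apply, dif_pos i.2]
      rfl
    · have hmj : m ≤ m + (l - 1) := by omega
      have herase : (expo Λ - Finsupp.single (m + (l - 1)) k) =
          (expo Λ).erase (m + (l - 1)) := by
        ext x
        rcases eq_or_ne x (m + (l - 1)) with rfl | hx
        · simp [hval]
        · simp [Finsupp.erase_ne hx, Finsupp.single_eq_of_ne hx]
      have h1 := tailCount_erase (expo Λ) hmj c
      have h2 : tailCount m (expo Λ) c = Λ.lam.colLen c := (mtype_eq_iff.mp (mtype_expo Λ)).2 c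
      have h5 := hkc c
      have h6 := Λ.lam.colLen_anti 0 c (Nat.zero_le _)
      rw [herase, hcol]
      rw [hval] at h1
      split_ifs at h1 <;> omega
  obtain ⟨N, hN⟩ := g.2.2
  have hsum := eq_sum_monoFun g hN
  have hmem : Λ ∈ (finite_size_le m N).toFinset := by
    rw [Set.Finite.mem_toFinset, Set.mem_ofPred_eq, ← degree_expo]
    by_contra h
    exact hΛ (hN _ (by omega))
  rw [← Finset.add_sum_erase _ _ hmem] at hsum
  rw [hsum] at hgA
  have h1 := (add_mem_cancel_right (Subalgebra.sum_mem _ fun Ω hΩ => ?_)).mp hgA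
  · have h2 := Subalgebra.smul_mem _ h1 (coeff (expo Λ) (g : PS))⁻¹
    rwa [coeffForm_apply, inv_smul_smul₀ hΛ] at h2
  · rw [Finset.mem_erase] at hΩ
    by_cases hlt : Ω.lam.colLen 0 < l
    · exact Subalgebra.smul_mem _ (ih _ hlt Ω rfl) _
    · have h0 : coeffForm (expo Ω) g = 0 := by
        by_contra h0
        refine hΩ.1 ((mtype_expo Ω).symm.trans (hne (expo Ω) ?_ h0))
        rw [(mtype_eq_iff.mp (mtype_expo Ω)).2 0]
        omega
      rw [h0, zero_smul]
      exact zero_mem _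

theorem span_kFun (m : ℕ) : ⊤ ≤ Submodule.span QT (Set.range (kFun (m := m))) := by
  refine (span_monoFun m).trans ((Submodule.span_le.mpr ?_).trans (genAlg_le m))
  rintro _ ⟨Λ, rfl⟩
  exact monoFun_mem_genAlg Λ

/-! ## Bases of graded vector spaces -/

/-- A homogeneous spanning family that is indexed like a basis has a dual family. -/
theorem exists_dual_of_homogeneous {ι K V : Type*} [Field K] [AddCommGroup V] [Module K V]
    (b : Module.Basis ι K V) (deg : ι → ℕ) (hfin : ∀ n, {i | deg i = n}.Finite) (v : ι → V)
    (hv : ∀ i j, b.repr (v i) j ≠ 0 → deg j = deg i)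
    (hspan : ⊤ ≤ Submodule.span K (Set.range v)) (i : ι) :
    ∃ w : ι →₀ K, (∀ j, w j ≠ 0 → deg j = deg i) ∧
      ∀ k, (w.sum fun j x => x * b.repr (v k) j) = Finsupp.single k 1 i := by
  classical
  set n := deg i with hn
  have : Fintype {j // deg j = n} := (hfin n).fintype
  -- Homogeneity makes the coordinate matrix block diagonal; A is its square finite block of degree
  -- n.
  set A : Matrix {j // deg j = n} {j // deg j = n} K :=
    Matrix.of fun j k => b.repr (v k) j with hA
  have hex : ∀ j, ∃ c : ι →₀ K, Finsupp.linearCombination K v c = b j := fun j =>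
    (Finsupp.mem_span_range_iff_exists_finsupp).mp (hspan trivial)
  choose c hc using hex
  have hAC : A * Matrix.of (fun k j : {j // deg j = n} => c j k) = 1 := by
    ext ⟨j, hj⟩ ⟨j', hj'⟩
    have h := congrArg (fun x => b.repr x j) (hc j')
    simp only [Finsupp.linearCombination_apply, Finsupp.sum, map_sum, map_smul,
      Finsupp.coe_finsetSum, Finset.sum_apply, Finsupp.smul_apply, smul_eq_mul,
      Module.Basis.repr_self] at h
    rw [Matrix.mul_apply]
    simp only [hA, Matrix.of_apply, Matrix.one_apply, Subtype.mk.injEq]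
    rw [Finsupp.single_apply] at h
    rw [if_congr eq_comm rfl rfl, ← h]
    symm
    -- Members v_k of other degrees have no coordinate in degree n, so they drop out of the
    -- expansion of b_{j'}.
    refine Finset.sum_bij_ne_zero (fun k _ h0 => ⟨k, ?_⟩) ?_ ?_ ?_ ?_
    · exact (hv k j (right_ne_zero_of_mul h0)).symm.trans hj
    · intros; exact Finset.mem_univ _
    · intro k _ _ l _ _ h; exact congrArg Subtype.val h
    · rintro ⟨k, hk⟩ _ h0
      exact ⟨k, Finsupp.mem_support_iff.mpr (right_ne_zero_of_mul h0), by rwa [mul_comm], rfl⟩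
    · intro k _ _; exact mul_comm _ _
  -- Spanning gives a right inverse; for square matrices it is also a left inverse, and its row i is
  -- the functional w.
  have hCA := mul_eq_one_comm.mp hAC
  refine ⟨Finsupp.onFinset (hfin n).toFinset
    (fun j => if h : deg j = n then c j i else 0) ?_, ?_, fun k => ?_⟩
  · intro j hj
    rw [Set.Finite.mem_toFinset]
    by_contra h
    rw [Set.mem_ofPred_eq] at h
    simp [h] at hj
  · intro j hj
    by_contra h
    simp [h] at hj
  rw [Finsupp.onFinset_sum _ fun _ => zero_mul _]
  by_cases hk : deg k = n
  · have h := congrFun (congrFun hCA ⟨i, rfl⟩) ⟨k, hk⟩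
    rw [Matrix.mul_apply] at h
    simp only [hA, Matrix.of_apply, Matrix.one_apply, Subtype.mk.injEq] at h
    rw [Finsupp.single_apply, if_congr eq_comm rfl rfl, ← h]
    refine Finset.sum_bij (fun j hj => ⟨j, (hfin n).mem_toFinset.mp hj⟩) ?_ ?_ ?_ ?_
    · intros; exact Finset.mem_univ _
    · intro k _ l _ h; exact congrArg Subtype.val h
    · rintro ⟨j, hj⟩ _
      exact ⟨j, (hfin n).mem_toFinset.mpr hj, rfl⟩
    · intro j hj
      have : deg j = n := (hfin n).mem_toFinset.mp hj
      simp [this]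
  · rw [Finsupp.single_apply, if_neg (by rintro rfl; exact hk rfl)]
    refine Finset.sum_eq_zero fun j hj => ?_
    have h1 : deg j = n := (hfin n).mem_toFinset.mp hj
    have h2 : b.repr (v k) j = 0 := by
      by_contra h0
      exact hk ((hv k j h0).symm.trans h1)
    rw [h2, mul_zero]

/-- The functional dual to v_i reads off the coefficient of v_i in any linear relation. -/
theorem linearIndependent_of_homogeneous {ι K V : Type*} [Field K] [AddCommGroup V] [Module K V]
    (b : Module.Basis ι K V) (deg : ι → ℕ) (hfin : ∀ n, {i | deg i = n}.Finite) (v : ι → V)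
    (hv : ∀ i j, b.repr (v i) j ≠ 0 → deg j = deg i)
    (hspan : ⊤ ≤ Submodule.span K (Set.range v)) : LinearIndependent K v := by
  classical
  rw [linearIndependent_iff']
  intro s g hg i hi
  obtain ⟨w, _, hw⟩ := exists_dual_of_homogeneous b deg hfin v hv hspan i
  have h : (w.sum fun j x => x * b.repr (∑ k ∈ s, g k • v k) j) = 0 := by
    rw [hg]; simp
  simp only [map_sum, map_smul, Finsupp.coe_finsetSum, Finset.sum_apply, Finsupp.smul_apply,
    smul_eq_mul, Finset.mul_sum, Finsupp.sum] at h
  rw [Finset.sum_comm] at h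
  have h2 : ∀ k ∈ s, ∑ j ∈ w.support, w j * (g k * b.repr (v k) j) =
      g k * Finsupp.single k 1 i := by
    intro k _
    rw [← hw k, Finsupp.sum, Finset.mul_sum]
    exact Finset.sum_congr rfl fun j _ => by ring
  rw [Finset.sum_congr rfl h2] at h
  simpa [Finsupp.single_apply, hi] using h

theorem finite_size_eq (m n : ℕ) : {Λ : MPart m | Λ.size = n}.Finite :=
  (finite_size_le m n).subset fun _ h => le_of_eq h

theorem linearIndependent_kFun (m : ℕ) : LinearIndependent QT (kFun (m := m)) := by
  refine linearIndependent_of_homogeneous (monoBasis m) MPart.size (finite_size_eq m) _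
    (fun Λ Ω h => ?_) (span_kFun m)
  rw [monoBasis_repr] at h
  rw [← degree_expo Ω]
  by_contra hne
  exact h (kFun_mem_homog Λ _ hne)

/-- The basis of `R_m` that consists of the functions `k_Λ(x;t)`. -/
noncomputable def kBasis (m : ℕ) : Module.Basis (MPart m) QT (R m) :=
  Module.Basis.mk (linearIndependent_kFun m) (span_kFun m)

theorem kBasis_apply {m : ℕ} (Λ : MPart m) : kBasis m Λ = kFun Λ :=
  Module.Basis.mk_apply _ _ Λ

/-! ## The scalar product and the adjoint Hecke operators -/

theorem tt_ne_zero : tt ≠ 0 := by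
  rw [tt, Ne, FaithfulSMul.algebraMap_eq_zero_iff]
  exact MvPolynomial.X_ne_zero 1

theorem exists_scalarProduct (m : ℕ) : ∃ B, IsScalarProduct m B := by
  classical
  refine ⟨(kBasis m).constr QT fun Λ => (kBasis m).coord Λ, fun Λ Ω => ?_⟩
  rw [← kBasis_apply, Module.Basis.constr_basis, ← kBasis_apply, Module.Basis.coord_apply,
    Module.Basis.repr_self, Finsupp.single_apply]
  exact if_congr eq_comm rfl rfl

theorem isScalarProduct_scalarProduct (m : ℕ) : IsScalarProduct m (scalarProduct m) :=
  Classical.epsilon_spec (exists_scalarProduct m)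

theorem IsScalarProduct.eq {m : ℕ} {B B' : R m →ₗ[QT] R m →ₗ[QT] QT} (h : IsScalarProduct m B)
    (h' : IsScalarProduct m B') : B = B' := by
  refine (kBasis m).ext fun Λ => (kBasis m).ext fun Ω => ?_
  rw [kBasis_apply, kBasis_apply, h, h']

open Classical in
theorem scalarProduct_kFun_kFun {m : ℕ} (Λ Ω : MPart m) :
    scalarProduct m (kFun Λ) (kFun Ω) = if Λ = Ω then 1 else 0 :=
  isScalarProduct_scalarProduct m Λ Ω

/-- Pairing with an orthonormal basis reads off coordinates; nondegeneracy of the form follows. -/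
theorem scalarProduct_kFun_left {m : ℕ} (Λ : MPart m) (g : R m) :
    scalarProduct m (kFun Λ) g = (kBasis m).repr g Λ := by
  classical
  have h : scalarProduct m (kFun Λ) = (kBasis m).coord Λ := by
    refine (kBasis m).ext fun Ω => ?_
    rw [Module.Basis.coord_apply, Module.Basis.repr_self, kBasis_apply, scalarProduct_kFun_kFun,
      Finsupp.single_apply]
    exact if_congr eq_comm rfl rfl
  rw [h, Module.Basis.coord_apply]

theorem scalarProduct_kFun_right {m : ℕ} (Λ : MPart m) (f : R m) :
    scalarProduct m f (kFun Λ) = (kBasis m).repr f Λ := by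
  classical
  have h : (scalarProduct m).flip (kFun Λ) = (kBasis m).coord Λ := by
    refine (kBasis m).ext fun Ω => ?_
    rw [Module.Basis.coord_apply, Module.Basis.repr_self, kBasis_apply, LinearMap.flip_apply,
      scalarProduct_kFun_kFun, Finsupp.single_apply]
  rw [← LinearMap.flip_apply, h, Module.Basis.coord_apply]

theorem ext_scalarProduct_right {m : ℕ} {g g' : R m}
    (h : ∀ f, scalarProduct m f g = scalarProduct m f g') : g = g' :=
  (kBasis m).ext_elem fun Λ => by
    rw [← scalarProduct_kFun_left, ← scalarProduct_kFun_left, h]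

theorem ext_scalarProduct_left {m : ℕ} {f f' : R m}
    (h : ∀ g, scalarProduct m f g = scalarProduct m f' g) : f = f' :=
  (kBasis m).ext_elem fun Λ => by
    rw [← scalarProduct_kFun_right, ← scalarProduct_kFun_right, h]

/-- `s_i Λ = (s_i a; λ)`. -/
def MPart.swap {m : ℕ} (Λ : MPart m) (i : ℕ) (hi : i + 1 < m) : MPart m :=
  ⟨swapAt Λ.a i hi, Λ.lam⟩

theorem MPart.swap_swap {m : ℕ} (Λ : MPart m) (i : ℕ) (hi : i + 1 < m) :
    (Λ.swap i hi).swap i hi = Λ := MPart.ext (swapAt_swapAt Λ.a i hi) rfl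

theorem MPart.swap_eq_iff {m : ℕ} {Λ Ω : MPart m} {i : ℕ} {hi : i + 1 < m} :
    Λ.swap i hi = Ω ↔ Λ = Ω.swap i hi :=
  ⟨fun h => by rw [← h, swap_swap], fun h => by rw [h, swap_swap]⟩

theorem MPart.size_swap {m : ℕ} (Λ : MPart m) (i : ℕ) (hi : i + 1 < m) :
    (Λ.swap i hi).size = Λ.size := congrArg (· + Λ.lam.card) (sum_swapAt Λ.a hi)

theorem heckeT_kFun_ascent {m i : ℕ} (hi : i + 1 < m) {Λ : MPart m}
    (h : Λ.a ⟨i, by omega⟩ < Λ.a ⟨i + 1, hi⟩) :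
    heckeT m i hi (kFun Λ) = (tt - 1) • kFun Λ + tt • kFun (Λ.swap i hi) := by
  rw [heckeT_kFun, heckeT_hallLittlewood_ascent _ hi h, add_mul, smul_mul_assoc, smul_mul_assoc]
  rfl

theorem heckeT_kFun_eq {m i : ℕ} (hi : i + 1 < m) {Λ : MPart m}
    (h : Λ.a ⟨i, by omega⟩ = Λ.a ⟨i + 1, hi⟩) :
    heckeT m i hi (kFun Λ) = tt • kFun Λ := by
  rw [heckeT_kFun, heckeT_hallLittlewood_eq _ hi h, smul_mul_assoc]
  rfl

theorem heckeT_kFun_descent {m i : ℕ} (hi : i + 1 < m) {Λ : MPart m}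
    (h : Λ.a ⟨i + 1, hi⟩ < Λ.a ⟨i, by omega⟩) :
    heckeT m i hi (kFun Λ) = kFun (Λ.swap i hi) := by
  rw [heckeT_kFun, heckeT_hallLittlewood_descent _ hi h]
  rfl

/-- The value of the adjoint Hecke operator on `k_Λ`. -/
noncomputable def starVal {m : ℕ} (i : ℕ) (hi : i + 1 < m) (Λ : MPart m) : R m :=
  if Λ.a ⟨i, by omega⟩ < Λ.a ⟨i + 1, hi⟩ then (tt - 1) • kFun Λ + kFun (Λ.swap i hi)
  else if Λ.a ⟨i, by omega⟩ = Λ.a ⟨i + 1, hi⟩ then tt • kFun Λ else tt • kFun (Λ.swap i hi)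

/-- T_i preserves the span of k_Λ and k_{s_iΛ}; `starVal` is the transpose of its block there, with
columns (t-1, t) at an ascent and (1, 0) at a descent. -/
theorem scalarProduct_heckeT_kFun {m i : ℕ} (hi : i + 1 < m) (Λ Ω : MPart m) :
    scalarProduct m (heckeT m i hi (kFun Λ)) (kFun Ω) =
      scalarProduct m (kFun Λ) (starVal i hi Ω) := by
  classical
  have hΛ1 : (Λ.swap i hi).a ⟨i, by omega⟩ = Λ.a ⟨i + 1, hi⟩ := swapAt_left Λ.a hi
  have hΛ2 : (Λ.swap i hi).a ⟨i + 1, hi⟩ = Λ.a ⟨i, by omega⟩ := swapAt_right Λ.a hi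
  unfold starVal
  by_cases h1 : Λ = Ω
  · subst h1
    rcases lt_trichotomy (Λ.a ⟨i, by omega⟩) (Λ.a ⟨i + 1, hi⟩) with h | h | h
    · have hne : Λ.swap i hi ≠ Λ := by
        intro he
        rw [he] at hΛ1
        omega
      rw [if_pos h, heckeT_kFun_ascent hi h]
      simp [scalarProduct_kFun_kFun, hne, hne.symm]
    · rw [if_neg h.not_lt, if_pos h, heckeT_kFun_eq hi h]
      simp
    · have hne : Λ.swap i hi ≠ Λ := by
        intro he
        rw [he] at hΛ1
        omega
      rw [if_neg h.not_gt, if_neg h.ne', heckeT_kFun_descent hi h]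
      simp [scalarProduct_kFun_kFun, hne, hne.symm]
  by_cases h2 : Λ.swap i hi = Ω
  · subst h2
    rw [hΛ1, hΛ2, MPart.swap_swap]
    rcases lt_trichotomy (Λ.a ⟨i, by omega⟩) (Λ.a ⟨i + 1, hi⟩) with h | h | h
    · rw [if_neg h.not_gt, if_neg h.ne', heckeT_kFun_ascent hi h]
      simp [scalarProduct_kFun_kFun, h1]
    · exact absurd (MPart.ext (swapAt_eq_self Λ.a hi h).symm rfl : Λ = Λ.swap i hi) h1
    · rw [if_pos h, heckeT_kFun_descent hi h]
      simp [scalarProduct_kFun_kFun, h1]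
  · have h3 : Λ ≠ Ω.swap i hi := fun h => h2 (MPart.swap_eq_iff.mpr h)
    have hR : scalarProduct m (heckeT m i hi (kFun Λ)) (kFun Ω) = 0 := by
      rcases lt_trichotomy (Λ.a ⟨i, by omega⟩) (Λ.a ⟨i + 1, hi⟩) with h | h | h
      · rw [heckeT_kFun_ascent hi h]
        simp [scalarProduct_kFun_kFun, h1, h2]
      · rw [heckeT_kFun_eq hi h]
        simp [scalarProduct_kFun_kFun, h1]
      · rw [heckeT_kFun_descent hi h]
        simp [scalarProduct_kFun_kFun, h2]
    rw [hR]
    split_ifs <;> simp [scalarProduct_kFun_kFun, h1, h3]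

theorem isHeckeAdjoint_constr (m i : ℕ) (hi : i + 1 < m) :
    IsHeckeAdjoint m i hi ((kBasis m).constr QT (starVal i hi)) := by
  have h : (scalarProduct m).comp (heckeT m i hi) =
      (scalarProduct m).compl₂ ((kBasis m).constr QT (starVal i hi)) := by
    refine (kBasis m).ext fun Λ => (kBasis m).ext fun Ω => ?_
    rw [LinearMap.compl₂_apply, Module.Basis.constr_basis, LinearMap.comp_apply, kBasis_apply,
      kBasis_apply, scalarProduct_heckeT_kFun]
  intro f g
  exact congrArg (fun φ => φ f g) h

theorem IsHeckeAdjoint.eq {m i : ℕ} {hi : i + 1 < m} {S S' : R m →ₗ[QT] R m}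
    (h : IsHeckeAdjoint m i hi S) (h' : IsHeckeAdjoint m i hi S') : S = S' :=
  LinearMap.ext fun g => ext_scalarProduct_right fun f => by rw [← h, ← h']

theorem isHeckeAdjoint_heckeTStar (m i : ℕ) (hi : i + 1 < m) :
    IsHeckeAdjoint m i hi (heckeTStar m i hi) :=
  Classical.epsilon_spec ⟨_, isHeckeAdjoint_constr m i hi⟩

theorem heckeTStar_kFun {m i : ℕ} (hi : i + 1 < m) (Λ : MPart m) :
    heckeTStar m i hi (kFun Λ) = starVal i hi Λ := by
  rw [(isHeckeAdjoint_heckeTStar m i hi).eq (isHeckeAdjoint_constr m i hi), ← kBasis_apply,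
    Module.Basis.constr_basis]

theorem heckeTStar_comm {m i j : ℕ} (hij : i + 1 < j) (hj : j + 1 < m) (g : R m) :
    heckeTStar m i (by omega) (heckeTStar m j hj g) =
      heckeTStar m j hj (heckeTStar m i (by omega) g) :=
  ext_scalarProduct_right fun f => by
    simp only [← isHeckeAdjoint_heckeTStar _ _ _ _ _, heckeT_comm hij hj]

/-- Taking adjoints reverses words, and both sides of the braid relation are palindromes. -/
theorem heckeTStar_braid {m i : ℕ} (hi : i + 2 < m) (g : R m) :
    heckeTStar m i (by omega) (heckeTStar m (i + 1) hi (heckeTStar m i (by omega) g)) =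
      heckeTStar m (i + 1) hi (heckeTStar m i (by omega) (heckeTStar m (i + 1) hi g)) :=
  ext_scalarProduct_right fun f => by
    simp only [← isHeckeAdjoint_heckeTStar _ _ _ _ _, heckeT_braid hi]

-- The factor t⁻¹ occurs equally often on both sides of the braid and commutation relations, so
-- `recursion_of_braid` applies to t⁻¹ T_i^*.
open Classical in
theorem dualSchur_of_ascent {m : ℕ} (Λ : MPart m) (i : ℕ) (h : IsAscent Λ.a i) :
    dualSchur Λ = tt⁻¹ • heckeTStar m i h.1 (dualSchur (Λ.swap i h.1)) := by
  refine recursion_of_braid (fun a => dualSchur ⟨a, Λ.lam⟩)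
    (fun i hi v => tt⁻¹ • heckeTStar m i hi v) (fun i j hij hj v => ?_) (fun i hi v => ?_) ?_ Λ.a i h
  · simp only [map_smul, heckeTStar_comm hij hj]
  · simp only [map_smul, heckeTStar_braid hi]
  · intro a ha
    refine ⟨_, Nat.find_spec ha, ?_⟩
    conv_lhs => rw [dualSchur, dif_pos ha]

theorem dualSchur_of_antitone {m : ℕ} {Λ : MPart m} (h : Antitone Λ.a) :
    dualSchur Λ = ∑ᶠ Ω : MPart m, dominantD Λ Ω • kFun Ω := by
  rw [dualSchur, dif_neg (no_ascent_of_antitone h)]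

/-! ## Triangularity of the dual `m`-symmetric Schur functions -/

theorem colLen_cup {m : ℕ} (a : Fin m → ℕ) (lam : YoungDiagram) (c : ℕ) :
    (cup a lam).colLen c = lam.colLen c + (Finset.univ.filter fun i => c < a i).card := by
  have h : ∀ r, r < (cup a lam).colLen c ↔
      r < lam.colLen c + (Finset.univ.filter fun i => c < a i).card := fun r => by
    rw [← YoungDiagram.mem_iff_lt_colLen, mem_cup]
  exact le_antisymm (not_lt.mp fun hlt => lt_irrefl _ ((h _).mp hlt))
    (not_lt.mp fun hlt => lt_irrefl _ ((h _).mpr hlt))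

theorem card_cup {m : ℕ} (a : Fin m → ℕ) (lam : YoungDiagram) :
    (cup a lam).card = lam.card + ∑ i, a i := by
  have ha : ∀ i, a i ≤ Finset.univ.sup a := fun i => Finset.le_sup (Finset.mem_univ i)
  have h0 : lam.colLen (lam.rowLen 0 + Finset.univ.sup a) = 0 := by
    have h1 := lam.colLen_anti (lam.rowLen 0) (lam.rowLen 0 + Finset.univ.sup a) (by omega)
    rw [colLen_rowLen_zero] at h1
    omega
  have hf : (Finset.univ.filter fun i => lam.rowLen 0 + Finset.univ.sup a < a i) = ∅ := by
    refine Finset.filter_eq_empty_iff.mpr fun i _ => ?_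
    have := ha i
    omega
  rw [card_eq_sum_colLen lam h0, card_eq_sum_colLen (cup a lam)
    (C := lam.rowLen 0 + Finset.univ.sup a) (by rw [colLen_cup, h0, hf]; rfl)]
  simp only [colLen_cup, Finset.sum_add_distrib, Finset.card_filter]
  rw [Finset.sum_comm]
  congr 1
  refine Finset.sum_congr rfl fun i _ => ?_
  rw [← Finset.card_filter]
  have : (Finset.range (lam.rowLen 0 + Finset.univ.sup a)).filter (fun c => c < a i) =
      Finset.range (a i) := by
    have := ha i
    ext c
    simp only [Finset.mem_filter, Finset.mem_range]
    omega
  rw [this, Finset.card_range]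

section Tableau

variable {m : ℕ} {Λ Ω : MPart m} {T : Filling Λ Ω}

theorem IsTableau.eq_of_col_eq (hT : IsTableau Λ Ω T) {x y} (hc : x.1.2 = y.1.2)
    (h : T x = T y) : x = y := by
  rcases lt_trichotomy x.1.1 y.1.1 with h1 | h1 | h1
  · exact absurd h (hT.col_strict x y hc h1).ne
  · exact Subtype.ext (Prod.ext h1 hc)
  · exact absurd h (hT.col_strict y x hc.symm h1).ne'

theorem IsTableau.injOn_col (hT : IsTableau Λ Ω T) (i : Fin m) :
    Set.InjOn (fun x : ↥((cup Λ.a Λ.lam).cells \ Ω.lam.cells) => x.1.2)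
      ↑(Finset.univ.filter fun x => T x = i) := by
  intro x hx y hy h
  rw [Finset.mem_coe, Finset.mem_filter] at hx hy
  exact hT.eq_of_col_eq h (hx.2.trans hy.2.symm)

theorem IsTableau.image_col_subset (hT : IsTableau Λ Ω T) (i : Fin m) :
    (Finset.univ.filter fun x => T x = i).image (fun x => x.1.2) ⊆ Finset.range (Λ.a i) := by
  intro c hc
  rw [Finset.mem_image] at hc
  obtain ⟨x, hx, rfl⟩ := hc
  rw [Finset.mem_filter] at hx
  rw [Finset.mem_range, ← hx.2]
  exact hT.bounded x

/-- A letter occurs at most once in a column, and i only in the first a_i columns. -/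
theorem IsTableau.le (hT : IsTableau Λ Ω T) (i : Fin m) : Ω.a i ≤ Λ.a i := by
  have h := Finset.card_le_card (hT.image_col_subset i)
  rwa [Finset.card_image_of_injOn (hT.injOn_col i), hT.content, Finset.card_range] at h

theorem IsTableau.size_eq (hT : IsTableau Λ Ω T) : Ω.size = Λ.size := by
  have h1 : Fintype.card ↥((cup Λ.a Λ.lam).cells \ Ω.lam.cells) = ∑ i, Ω.a i := by
    rw [← Finset.card_univ, Finset.card_eq_sum_card_fiberwise (f := T) (t := Finset.univ)
      (fun _ _ => Finset.mem_coe.mpr (Finset.mem_univ _))]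
    exact Finset.sum_congr rfl fun i _ => hT.content i
  have hsub : Ω.lam.cells ⊆ (cup Λ.a Λ.lam).cells := hT.contained
  have h2 := Finset.card_sdiff_add_card_eq_card hsub
  rw [Fintype.card_coe] at h1
  have h3 : (cup Λ.a Λ.lam).cells.card = Λ.lam.card + ∑ i, Λ.a i := card_cup _ _
  have h4 : Ω.lam.cells.card = Ω.lam.card := rfl
  rw [MPart.size, MPart.size]
  omega

theorem mem_shape_iff (Λ Ω : MPart m) (r c : ℕ) :
    (r, c) ∈ (cup Λ.a Λ.lam).cells \ Ω.lam.cells ↔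
      Ω.lam.colLen c ≤ r ∧ r < (cup Λ.a Λ.lam).colLen c := by
  rw [Finset.mem_sdiff, YoungDiagram.mem_cells, YoungDiagram.mem_cells,
    YoungDiagram.mem_iff_lt_colLen, YoungDiagram.mem_iff_lt_colLen, not_lt, and_comm]

/-- If b = a, every letter i fills all its a_i columns. So column c of the skew shape has #{i : c <
a_i} cells, which is the height that a adds to λ. -/
theorem IsTableau.eq_of_a_eq (hT : IsTableau Λ Ω T) (ha : Ω.a = Λ.a) : Ω = Λ := by
  refine MPart.ext ha (diagram_ext_colLen fun c => ?_)
  have hle : Ω.lam.colLen c ≤ (cup Λ.a Λ.lam).colLen c := by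
    by_contra hlt
    have h1 : ((cup Λ.a Λ.lam).colLen c, c) ∈ Ω.lam :=
      YoungDiagram.mem_iff_lt_colLen.mpr (not_le.mp hlt)
    exact lt_irrefl _ (YoungDiagram.mem_iff_lt_colLen.mp (hT.contained h1))
  have hcard : (Finset.Ico (Ω.lam.colLen c) ((cup Λ.a Λ.lam).colLen c)).card =
      (Finset.univ.filter fun i => c < Λ.a i).card := by
    refine Finset.card_bij (fun r hr => T ⟨(r, c), (mem_shape_iff Λ Ω r c).mpr
      (Finset.mem_Ico.mp hr)⟩) ?_ ?_ ?_
    · intro r hr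
      rw [Finset.mem_filter]
      exact ⟨Finset.mem_univ _, hT.bounded ⟨(r, c), _⟩⟩
    · intro r hr s hs h
      exact congrArg (fun x => x.1.1) (hT.eq_of_col_eq
        (x := ⟨(r, c), _⟩) (y := ⟨(s, c), _⟩) rfl h)
    · intro i hi
      rw [Finset.mem_filter] at hi
      have himg : (Finset.univ.filter fun x => T x = i).image (fun x => x.1.2) =
          Finset.range (Λ.a i) := by
        refine Finset.eq_of_subset_of_card_le (hT.image_col_subset i) ?_
        rw [Finset.card_image_of_injOn (hT.injOn_col i), hT.content, Finset.card_range, ha]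
      have hc := Finset.mem_range.mpr hi.2
      rw [← himg, Finset.mem_image] at hc
      obtain ⟨⟨⟨r, c'⟩, hx⟩, hTx, hxc⟩ := hc
      simp only at hxc
      subst hxc
      rw [Finset.mem_filter] at hTx
      exact ⟨r, Finset.mem_Ico.mpr ((mem_shape_iff Λ Ω r c').mp hx), hTx.2⟩
  rw [Nat.card_Ico] at hcard
  rw [colLen_cup] at hcard hle
  omega

end Tableau

/-- For dominant a the letters allowed in column c form an initial segment; they are written in
order below λ. -/
theorem exists_isTableau_self {m : ℕ} {Λ : MPart m} (hΛ : Antitone Λ.a) :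
    ∃ T, IsTableau Λ Λ T := by
  classical
  have hcard : ∀ (c : ℕ) (i : Fin m), (i : ℕ) < (Finset.univ.filter fun j => c < Λ.a j).card ↔
      c < Λ.a i := by
    intro c i
    constructor
    · intro h
      by_contra h2
      have hsub : (Finset.univ.filter fun j => c < Λ.a j) ⊆ Finset.Iio i := by
        intro j hj
        rw [Finset.mem_filter] at hj
        rw [Finset.mem_Iio]
        by_contra h3
        have := hΛ (not_lt.mp h3)
        omega
      have := Finset.card_le_card hsub
      rw [Fin.card_Iio] at this
      omega
    · intro h
      have hsub : Finset.Iic i ⊆ (Finset.univ.filter fun j => c < Λ.a j) := by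
        intro j hj
        rw [Finset.mem_Iic] at hj
        rw [Finset.mem_filter]
        exact ⟨Finset.mem_univ _, h.trans_le (hΛ hj)⟩
      have := Finset.card_le_card hsub
      rw [Fin.card_Iic] at this
      omega
  have hle : ∀ c, (Finset.univ.filter fun j => c < Λ.a j).card ≤ m := fun c => by
    simpa using Finset.card_le_univ (Finset.univ.filter fun j => c < Λ.a j)
  have hx : ∀ x : ↥((cup Λ.a Λ.lam).cells \ Λ.lam.cells), Λ.lam.colLen x.1.2 ≤ x.1.1 ∧
      x.1.1 - Λ.lam.colLen x.1.2 < (Finset.univ.filter fun j => x.1.2 < Λ.a j).card := by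
    rintro ⟨⟨r, c⟩, hx⟩
    rw [mem_shape_iff, colLen_cup] at hx
    simp only
    omega
  refine ⟨fun x => ⟨x.1.1 - Λ.lam.colLen x.1.2, (hx x).2.trans_le (hle _)⟩, ?_, ?_, ?_, ?_, ?_⟩
  · intro x h
    rw [mem_cup]
    exact (YoungDiagram.mem_iff_lt_colLen.mp h).trans_le (Nat.le_add_right _ _)
  · intro x y h1 h2
    have := Λ.lam.colLen_anti x.1.2 y.1.2 h2.le
    rw [Fin.mk_le_mk]
    omega
  · intro x y h1 h2
    have := hx x
    rw [Fin.mk_lt_mk, h1]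
    rw [h1] at this
    omega
  · intro i
    have h1 : (Finset.range (Λ.a i)).card = Λ.a i := Finset.card_range _
    rw [← h1]
    symm
    have hmem : ∀ c ∈ Finset.range (Λ.a i), (Λ.lam.colLen c + i, c) ∈
        (cup Λ.a Λ.lam).cells \ Λ.lam.cells := by
      intro c hc
      rw [Finset.mem_range, ← hcard] at hc
      rw [mem_shape_iff, colLen_cup]
      omega
    refine Finset.card_bij (fun c hc => ⟨(Λ.lam.colLen c + i, c), hmem c hc⟩) ?_ ?_ ?_
    · intro c hc
      rw [Finset.mem_filter]
      refine ⟨Finset.mem_univ _, Fin.ext ?_⟩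
      simp
    · intro c _ c' _ h
      exact congrArg (fun x => x.1.2) h
    · rintro x hxi
      rw [Finset.mem_filter] at hxi
      have h2 := congrArg Fin.val hxi.2
      have h3 := hx x
      simp only at h2
      refine ⟨x.1.2, ?_, Subtype.ext (Prod.ext ?_ rfl)⟩
      · rw [Finset.mem_range, ← hcard]
        omega
      · simp only
        omega
  · intro x
    rw [← hcard]
    exact (hx x).2

open Classical in
theorem exists_isTableau_of_dominantD_ne_zero {m : ℕ} {Λ Ω : MPart m} (h : dominantD Λ Ω ≠ 0) :
    ∃ T, IsTableau Λ Ω T := by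
  by_contra hn
  push Not at hn
  refine h ?_
  rw [dominantD, Finset.filter_eq_empty_iff.mpr fun T _ => hn T, Finset.sum_empty]

/-- At t = 1 the sum becomes the number of its terms. -/
theorem sum_tt_pow_ne_zero {ι : Type*} {s : Finset ι} (hs : s.Nonempty) (e : ι → ℕ) :
    ∑ i ∈ s, tt ^ e i ≠ 0 := by
  have h : ∑ i ∈ s, tt ^ e i = algebraMap (MvPolynomial (Fin 2) ℚ) QT
      (∑ i ∈ s, MvPolynomial.X 1 ^ e i) := by
    rw [map_sum]
    exact Finset.sum_congr rfl fun i _ => (map_pow _ _ _).symm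
  rw [h, Ne, FaithfulSMul.algebraMap_eq_zero_iff]
  intro h0
  have h1 := congrArg (MvPolynomial.eval fun _ => (1 : ℚ)) h0
  simp only [map_sum, map_pow, MvPolynomial.eval_X, one_pow, Finset.sum_const, nsmul_eq_mul,
    mul_one, map_zero, Nat.cast_eq_zero, Finset.card_eq_zero] at h1
  exact hs.ne_empty h1

theorem dominantD_self_ne_zero {m : ℕ} {Λ : MPart m} (hΛ : Antitone Λ.a) : dominantD Λ Λ ≠ 0 := by
  classical
  obtain ⟨T, hT⟩ := exists_isTableau_self hΛ
  refine sum_tt_pow_ne_zero ⟨T, ?_⟩ _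
  rw [Finset.mem_filter]
  exact ⟨Finset.mem_univ _, hT⟩

/-- The span of the `k_Ω` with `|Ω| = n` and `|b| < s`, for `Ω = (b;μ)`. -/
noncomputable def lowerSpan (m n s : ℕ) : Submodule QT (R m) :=
  Submodule.span QT (kFun '' {Ω : MPart m | Ω.size = n ∧ ∑ i, Ω.a i < s})

theorem heckeTStar_mem_lowerSpan {m n s i : ℕ} (hi : i + 1 < m) {f : R m}
    (hf : f ∈ lowerSpan m n s) : heckeTStar m i hi f ∈ lowerSpan m n s := by
  have h : lowerSpan m n s ≤ (lowerSpan m n s).comap (heckeTStar m i hi) := by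
    rw [lowerSpan, Submodule.span_le]
    rintro _ ⟨Ω, ⟨h1, h2⟩, rfl⟩
    have hm : ∀ Ω' : MPart m, Ω'.size = n → ∑ i, Ω'.a i < s → kFun Ω' ∈ lowerSpan m n s :=
      fun Ω' h h' => Submodule.subset_span ⟨Ω', ⟨h, h'⟩, rfl⟩
    have hΩ := hm Ω h1 h2
    have hs := hm (Ω.swap i hi) ((Ω.size_swap i hi).trans h1) ((sum_swapAt Ω.a hi).trans_lt h2)
    change heckeTStar m i hi (kFun Ω) ∈ lowerSpan m n s
    rw [heckeTStar_kFun, starVal]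
    split_ifs
    · exact add_mem (Submodule.smul_mem _ _ hΩ) hs
    · exact Submodule.smul_mem _ _ hΩ
    · exact Submodule.smul_mem _ _ hs
  exact h hf

theorem support_dominantD_subset {m : ℕ} (Λ : MPart m) :
    (Function.support fun Ω : MPart m => dominantD Λ Ω • kFun Ω) ⊆
      (finite_size_eq m Λ.size).toFinset := by
  intro Ω hΩ
  rw [Function.mem_support] at hΩ
  obtain ⟨T, hT⟩ := exists_isTableau_of_dominantD_ne_zero (left_ne_zero_of_smul hΩ)
  rw [Finset.mem_coe, Set.Finite.mem_toFinset]
  exact hT.size_eq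

/-- The dual `m`-symmetric Schur functions are triangular in the `k_Ω(x;t)`. -/
theorem dualSchur_triangular {m : ℕ} (Λ : MPart m) : ∃ c : QT, c ≠ 0 ∧
    dualSchur Λ - c • kFun Λ ∈ lowerSpan m Λ.size (∑ i, Λ.a i) := by
  classical
  obtain ⟨a, lam⟩ := Λ
  induction hn : sortMeasure a using Nat.strong_induction_on generalizing a with
  | _ n ih =>
  subst hn
  by_cases h : ∃ i, IsAscent a i
  · obtain ⟨i, hi, hlt⟩ := h
    obtain ⟨c, hc, hmem⟩ := ih _ (sortMeasure_swapAt a i ⟨hi, hlt⟩) _ rfl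
    refine ⟨c, hc, ?_⟩
    set Λ : MPart m := ⟨a, lam⟩ with hΛ
    -- At a descent the adjoint gives exactly t times the exchanged function, so t⁻¹ T_i^* carries
    -- leading term to leading term with the same c.
    have hk : heckeTStar m i hi (kFun (Λ.swap i hi)) = tt • kFun Λ := by
      have h1 : (Λ.swap i hi).a ⟨i, by omega⟩ = Λ.a ⟨i + 1, hi⟩ := swapAt_left Λ.a hi
      have h2 : (Λ.swap i hi).a ⟨i + 1, hi⟩ = Λ.a ⟨i, by omega⟩ := swapAt_right Λ.a hi
      have h3 : Λ.a ⟨i, by omega⟩ < Λ.a ⟨i + 1, hi⟩ := hlt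
      rw [heckeTStar_kFun, starVal, h1, h2, if_neg h3.not_gt, if_neg h3.ne', MPart.swap_swap]
    have h4 := Submodule.smul_mem _ tt⁻¹ (heckeTStar_mem_lowerSpan hi hmem)
    change tt⁻¹ • heckeTStar m i hi (dualSchur (Λ.swap i hi) - c • kFun (Λ.swap i hi)) ∈
      lowerSpan m (Λ.swap i hi).size (∑ j, swapAt a i hi j) at h4
    rwa [map_sub, map_smul, hk, smul_sub, ← dualSchur_of_ascent Λ i ⟨hi, hlt⟩, smul_comm tt⁻¹ c,
      inv_smul_smul₀ tt_ne_zero, MPart.size_swap, sum_swapAt] at h4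
  · have hanti := antitone_of_no_ascent h
    set Λ : MPart m := ⟨a, lam⟩ with hΛ
    refine ⟨dominantD Λ Λ, dominantD_self_ne_zero hanti, ?_⟩
    rw [dualSchur_of_antitone (Λ := Λ) hanti,
      finsum_eq_sum_of_support_subset _ (support_dominantD_subset Λ),
      ← Finset.add_sum_erase _ _ ((finite_size_eq m Λ.size).mem_toFinset.mpr rfl),
      add_sub_cancel_left]
    refine Submodule.sum_mem _ fun Ω hΩ => ?_
    by_cases h0 : dominantD Λ Ω = 0
    · rw [h0, zero_smul]
      exact zero_mem _
    obtain ⟨T, hT⟩ := exists_isTableau_of_dominantD_ne_zero h0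
    refine Submodule.smul_mem _ _ (Submodule.subset_span ⟨Ω, ⟨hT.size_eq, ?_⟩, rfl⟩)
    -- b ≤ a entrywise, and b = a would force Ω = Λ.
    refine Finset.sum_lt_sum (fun i _ => hT.le i) ?_
    by_contra hall
    push Not at hall
    refine Finset.ne_of_mem_erase hΩ (hT.eq_of_a_eq (funext fun i => ?_))
    exact le_antisymm (hT.le i) (hall i (Finset.mem_univ i))

theorem kBasis_repr_dualSchur {m : ℕ} (Λ Ω : MPart m)
    (h : (kBasis m).repr (dualSchur Λ) Ω ≠ 0) : Ω.size = Λ.size := by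
  obtain ⟨c, _, hmem⟩ := dualSchur_triangular Λ
  have h1 : dualSchur Λ ∈ Submodule.span QT (kBasis m '' {Ω | Ω.size = Λ.size}) := by
    have h2 : dualSchur Λ = (dualSchur Λ - c • kFun Λ) + c • kFun Λ := by abel
    rw [h2]
    refine add_mem (Submodule.span_mono ?_ hmem) (Submodule.smul_mem _ _
      (Submodule.subset_span ⟨Λ, rfl, kBasis_apply Λ⟩))
    rintro _ ⟨Ω, ⟨h3, _⟩, rfl⟩
    exact ⟨Ω, h3, kBasis_apply Ω⟩
  rw [Module.Basis.mem_span_image] at h1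
  exact h1 (Finsupp.mem_support_iff.mpr h)

/-- The triangular system is solved for k_Λ by induction on |a|. -/
theorem span_dualSchur (m : ℕ) : ⊤ ≤ Submodule.span QT (Set.range (dualSchur (m := m))) := by
  have h : ∀ Λ : MPart m, kFun Λ ∈ Submodule.span QT (Set.range (dualSchur (m := m))) := by
    intro Λ
    induction hn : ∑ i, Λ.a i using Nat.strong_induction_on generalizing Λ with
    | _ n ih =>
    obtain ⟨c, hc, hmem⟩ := dualSchur_triangular Λ
    have hle : lowerSpan m Λ.size (∑ i, Λ.a i) ≤
        Submodule.span QT (Set.range (dualSchur (m := m))) := by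
      rw [lowerSpan, Submodule.span_le]
      rintro _ ⟨Ω, ⟨_, hlt⟩, rfl⟩
      exact ih _ (hlt.trans_eq hn) Ω rfl
    have h1 := sub_mem (Submodule.subset_span (Set.mem_range_self Λ)) (hle hmem)
    rw [sub_sub_cancel] at h1
    have h2 := Submodule.smul_mem _ c⁻¹ h1
    rwa [inv_smul_smul₀ hc] at h2
  refine (span_kFun m).trans (Submodule.span_le.mpr ?_)
  rintro _ ⟨Λ, rfl⟩
  exact h Λ

theorem eq_of_scalarProduct_dualSchur {m : ℕ} {f f' : R m}
    (h : ∀ Ω, scalarProduct m f (dualSchur Ω) = scalarProduct m f' (dualSchur Ω)) : f = f' := by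
  refine ext_scalarProduct_left fun g => ?_
  have h1 : scalarProduct m f = scalarProduct m f' := by
    refine LinearMap.ext_on (s := Set.range (dualSchur (m := m)))
      (top_unique (span_dualSchur m)) ?_
    rintro _ ⟨Ω, rfl⟩
    exact h Ω
  rw [h1]

/-- The s^*_Λ are homogeneous and span, so they have dual functionals; the orthonormal basis k turns
these into functions. -/
theorem exists_isSchurFamily (m : ℕ) : ∃ s, IsSchurFamily m s := by
  classical
  choose w _ hw using exists_dual_of_homogeneous (kBasis m) MPart.size (finite_size_eq m)
    dualSchur kBasis_repr_dualSchur (span_dualSchur m)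
  refine ⟨fun Λ => (w Λ).sum fun Ω x => x • kFun Ω, fun Λ Ω => ?_⟩
  simp only [Finsupp.sum, map_sum, LinearMap.sum_apply, map_smul, LinearMap.smul_apply, scalarProduct_kFun_left, smul_eq_mul]
  have h := hw Λ Ω
  rw [Finsupp.sum] at h
  rw [h, Finsupp.single_apply]
  exact if_congr eq_comm rfl rfl

theorem isSchurFamily_schur (m : ℕ) : IsSchurFamily m schur :=
  Classical.epsilon_spec (exists_isSchurFamily m)

theorem IsSchurFamily.eq {m : ℕ} {s s' : MPart m → R m} (h : IsSchurFamily m s)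
    (h' : IsSchurFamily m s') : s = s' :=
  funext fun Λ => eq_of_scalarProduct_dualSchur fun Ω => by rw [h, h']

/-! ## Charge of words: adding a smallest letter -/

/-- All letters of the word are raised by one, and `N` letters `0` are appended. -/
def shiftWord (N : ℕ) (w : List ℕ) : List ℕ := w.map (· + 1) ++ List.replicate N 0

theorem marryStep_succ (i : ℕ) (st : List (ℕ × ℕ)) (p : ℕ × ℕ) :
    marryStep (i + 1) (st.map (Prod.map (· + 1) id)) (Prod.map (· + 1) id p) =
      (marryStep i st p).map (Prod.map (· + 1) id) := by
  obtain ⟨x, k⟩ := p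
  cases st with
  | nil =>
    simp only [marryStep, Prod.map, Nat.add_right_cancel_iff, List.map_nil]
    split_ifs <;> rfl
  | cons b rest =>
    simp only [marryStep, Prod.map, Nat.add_right_cancel_iff, List.map_cons]
    split_ifs <;> rfl

theorem foldl_marryStep_succ (i : ℕ) (l st : List (ℕ × ℕ)) :
    (l.map (Prod.map (· + 1) id)).foldl (marryStep (i + 1)) (st.map (Prod.map (· + 1) id)) =
      (l.foldl (marryStep i) st).map (Prod.map (· + 1) id) := by
  induction l generalizing st with
  | nil => rfl
  | cons p l ih => rw [List.map_cons, List.foldl_cons, marryStep_succ, ih, List.foldl_cons]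

theorem foldl_marryStep_zero (i : ℕ) (l st : List (ℕ × ℕ)) (h : ∀ p ∈ l, p.1 = 0) :
    l.foldl (marryStep (i + 1)) st = st := by
  induction l generalizing st with
  | nil => rfl
  | cons p l ih =>
    have hp := h p List.mem_cons_self
    have h1 : marryStep (i + 1) st p = st := by
      unfold marryStep
      rw [if_neg (by omega), if_neg (by omega)]
    rw [List.foldl_cons, h1, ih _ fun q hq => h q (List.mem_cons_of_mem _ hq)]

/-- The marriage of i+1 and i+2 ignores zeros, and zeros at the end do not move the positions of the
other letters. -/
theorem unmarried_shiftWord (i N : ℕ) (w : List ℕ) :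
    unmarried (i + 1) (shiftWord N w) = (unmarried i w).map (Prod.map (· + 1) id) := by
  rw [unmarried, unmarried, shiftWord, List.zipIdx_append, List.foldl_append,
    foldl_marryStep_zero, List.zipIdx_map, ← List.map_nil (f := Prod.map (· + 1) id),
    foldl_marryStep_succ, List.map_reverse]
  · rfl
  · rintro ⟨x, k⟩ hp
    have := List.fst_mem_of_mem_zipIdx hp
    exact List.eq_of_mem_replicate this

theorem marryStep_sublist (i : ℕ) (st : List (ℕ × ℕ)) (p : ℕ × ℕ) :
    (marryStep i st p).Sublist (p :: st) := by
  cases st with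
  | nil =>
    simp only [marryStep]
    split_ifs <;> simp
  | cons b rest =>
    simp only [marryStep]
    split_ifs
    · exact List.Sublist.refl _
    · exact ((List.sublist_cons_self b rest).trans (List.sublist_cons_self p _))
    · exact List.Sublist.refl _
    · exact List.sublist_cons_self p _

theorem foldl_marryStep_sublist (i : ℕ) (l st : List (ℕ × ℕ)) :
    (l.foldl (marryStep i) st).Sublist (l.reverse ++ st) := by
  induction l generalizing st with
  | nil => exact List.Sublist.refl _
  | cons p l ih =>
    rw [List.foldl_cons, List.reverse_cons, List.append_assoc, List.singleton_append]
    exact (ih _).trans ((List.Sublist.refl _).append (marryStep_sublist i st p))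

theorem unmarried_sublist (i : ℕ) (w : List ℕ) : (unmarried i w).Sublist w.zipIdx := by
  have h := (foldl_marryStep_sublist i w.zipIdx []).reverse
  rwa [List.append_nil, List.reverse_reverse] at h

theorem foldl_marryStep_letters (i : ℕ) (l st : List (ℕ × ℕ))
    (h : ∀ p ∈ st, p.1 = i ∨ p.1 = i + 1) :
    ∀ p ∈ l.foldl (marryStep i) st, p.1 = i ∨ p.1 = i + 1 := by
  induction l generalizing st with
  | nil => exact h
  | cons p l ih =>
    rw [List.foldl_cons]
    refine ih _ fun q hq => ?_
    by_cases hp : p.1 = i ∨ p.1 = i + 1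
    · rcases List.mem_cons.mp ((marryStep_sublist i st p).subset hq) with rfl | h1
      · exact hp
      · exact h q h1
    · push Not at hp
      unfold marryStep at hq
      rw [if_neg hp.2, if_neg hp.1] at hq
      exact h q hq

/-- Each marriage removes one letter of each kind, so the difference of their numbers is preserved;
subtractions are avoided by moving terms across. -/
theorem foldl_marryStep_countP (i : ℕ) (l st : List (ℕ × ℕ)) :
    (l.foldl (marryStep i) st).countP (fun p => p.1 = i) + l.countP (fun p => p.1 = i + 1) +
      st.countP (fun p => p.1 = i + 1) =
    (l.foldl (marryStep i) st).countP (fun p => p.1 = i + 1) + l.countP (fun p => p.1 = i) +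
      st.countP (fun p => p.1 = i) := by
  induction l generalizing st with
  | nil => simp only [List.foldl_nil, List.countP_nil]; omega
  | cons p l ih =>
    have h := ih (marryStep i st p)
    rw [List.foldl_cons, List.countP_cons, List.countP_cons]
    have h2 : (marryStep i st p).countP (fun p => p.1 = i + 1) + (if p.1 = i then 1 else 0) +
        st.countP (fun p => p.1 = i) = (marryStep i st p).countP (fun p => p.1 = i) +
        (if p.1 = i + 1 then 1 else 0) + st.countP (fun p => p.1 = i + 1) := by
      unfold marryStep
      split_ifs with h1 h3 h3
      · omega
      · simp only [List.countP_cons, h1, decide_true, if_true]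
        simp
        omega
      · cases st with
        | nil => simp [h3]
        | cons b rest =>
          simp only
          split_ifs with h4
          · simp only [List.countP_cons, h4]
            simp
            omega
          · simp only [List.countP_cons, h3]
            simp
            omega
      · omega
    simp only [decide_eq_true_eq]
    omega

theorem map_idxOf_of_nodup {l : List ℕ} (h : l.Nodup) :
    l.map (fun x => l.idxOf x) = List.range l.length := by
  refine List.ext_getElem (by simp) fun k h1 h2 => ?_
  rw [List.getElem_map, List.getElem_range]
  exact h.idxOf_getElem k (by simpa using h1)

theorem countP_lt_range (n s : ℕ) : (List.range n).countP (fun k => k < s) = min n s := by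
  induction n with
  | zero => simp
  | succ n ih =>
    rw [List.range_succ, List.countP_append, ih, List.countP_singleton]
    simp only [decide_eq_true_eq]
    split_ifs <;> omega

theorem count_map_ite (i j s : ℕ) (L : List ℕ) (hs : s = L.countP (fun k => k < s)) :
    (L.map fun k => if k < s then i else i + 1).count j =
      if j = i then s else if j = i + 1 then L.length - s else 0 := by
  have hlen := List.length_eq_countP_add_countP (fun k => decide (k < s)) (l := L)
  rw [List.count, List.countP_map]
  split_ifs with h1 h2
  · conv_rhs => rw [hs]
    refine List.countP_congr fun k _ => ?_
    simp only [Function.comp, beq_iff_eq, decide_eq_true_eq]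
    split_ifs <;> omega
  · have : L.countP ((fun x => x == j) ∘ fun k => if k < s then i else i + 1) =
        L.countP (fun k => decide ¬ (decide (k < s) = true)) := by
      refine List.countP_congr fun k _ => ?_
      simp only [Function.comp, beq_iff_eq, decide_eq_true_eq]
      split_ifs <;> omega
    rw [this]
    omega
  · rw [List.countP_eq_zero]
    intro k _
    simp only [Function.comp, beq_iff_eq]
    split_ifs <;> omega

/-- The operator `σ_i` exchanges the numbers of letters `i` and `i+1`. -/
theorem count_wordSigma (i j : ℕ) (w : List ℕ) : (wordSigma i w).count j =
    if j = i then w.count (i + 1) else if j = i + 1 then w.count i else w.count j := by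
  set U := unmarried i w with hU
  set pos := U.map Prod.snd with hpos
  set s := U.countP (fun p => p.1 = i + 1) with hs
  have hsub := unmarried_sublist i w
  obtain ⟨V, hV⟩ := hsub.exists_perm_append
  have hZ : (w.zipIdx.map Prod.snd).Nodup := by
    rw [List.zipIdx_map_snd]
    exact List.nodup_range'
  have hnod := (hV.map Prod.snd).nodup_iff.mp hZ
  rw [List.map_append, List.nodup_append] at hnod
  have hposn : pos.Nodup := hnod.1
  have hlet : ∀ p ∈ U, p.1 = i ∨ p.1 = i + 1 := fun p hp =>
    foldl_marryStep_letters i w.zipIdx [] (by simp) p (List.mem_reverse.mp hp)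
  -- The unmarried letters i and i+1 differ in number exactly as they do in w, so exchanging their
  -- numbers exchanges the total counts.
  have hcnt : U.countP (fun p => p.1 = i) + w.count (i + 1) = s + w.count i := by
    have h := foldl_marryStep_countP i w.zipIdx []
    have e : ∀ k, w.zipIdx.countP (fun p => p.1 = k) = w.count k := by
      intro k
      conv_rhs => rw [← List.zipIdx_map_fst 0 w]
      rw [List.count, List.countP_map]
      refine List.countP_congr fun p _ => ?_
      simp
    rw [e, e] at h
    rw [hs, hU, unmarried, List.countP_reverse, List.countP_reverse]
    simpa using h
  set F : ℕ × ℕ → ℕ := fun p => if p.2 ∈ pos then (if pos.idxOf p.2 < s then i else i + 1)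
    else p.1 with hF
  have hw : wordSigma i w = w.zipIdx.map F := by
    rw [wordSigma, List.mapIdx_eq_zipIdx_map]
  have hFV : V.map F = V.map Prod.fst := by
    refine List.map_congr_left fun p hp => ?_
    have : p.2 ∉ pos := fun h => hnod.2.2 p.2 h p.2 (List.mem_map_of_mem hp) rfl
    simp only [hF]
    rw [if_neg this]
  have hFU : U.map F = (List.range pos.length).map fun k => if k < s then i else i + 1 := by
    rw [← map_idxOf_of_nodup hposn, List.map_map, hpos, List.map_map]
    refine List.map_congr_left fun p hp => ?_
    simp only [hF, Function.comp]
    rw [if_pos (List.mem_map_of_mem hp)]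
  have hlen : pos.length = U.length := List.length_map _
  have hle : s ≤ U.length := List.countP_le_length
  have hcU : ∀ k, (U.map Prod.fst).count k = U.countP (fun p => p.1 = k) := by
    intro k
    rw [List.count, List.countP_map]
    exact List.countP_congr fun p _ => by simp
  have hUi : U.countP (fun p => p.1 = i) = U.length - s := by
    have h1 := List.length_eq_countP_add_countP (fun p : ℕ × ℕ => decide (p.1 = i + 1)) (l := U)
    have h2 : U.countP (fun p => decide ¬ (decide (p.1 = i + 1) = true)) =
        U.countP (fun p => p.1 = i) := by
      refine List.countP_congr fun p hp => ?_
      have := hlet p hp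
      simp only [decide_eq_true_eq]
      omega
    omega
  have hold : ∀ k, w.count k = U.countP (fun p => p.1 = k) + (V.map Prod.fst).count k := by
    intro k
    conv_lhs => rw [← List.zipIdx_map_fst 0 w, (hV.map Prod.fst).count_eq, List.map_append,
      List.count_append, hcU]
  have hnew : (wordSigma i w).count j =
      (if j = i then s else if j = i + 1 then U.length - s else 0) +
        (V.map Prod.fst).count j := by
    rw [hw, (hV.map F).count_eq, List.map_append, List.count_append, hFV, hFU, count_map_ite,
      List.length_range, hlen]
    rw [countP_lt_range, hlen, min_eq_right hle]
  rw [hnew]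
  have h1 := hold i
  have h2 := hold (i + 1)
  split_ifs with h3 h4
  · subst h3; omega
  · subst h4; omega
  · have h5 := hold j
    have h6 : U.countP (fun p => p.1 = j) = 0 := by
      rw [List.countP_eq_zero]
      intro p hp
      have := hlet p hp
      simp only [decide_eq_true_eq]
      omega
    omega

theorem wordSigma_shiftWord (i N : ℕ) (w : List ℕ) :
    wordSigma (i + 1) (shiftWord N w) = shiftWord N (wordSigma i w) := by
  have hpos : ((unmarried (i + 1) (shiftWord N w)).map Prod.snd) =
      (unmarried i w).map Prod.snd := by
    rw [unmarried_shiftWord, List.map_map]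
    rfl
  have hs : ((unmarried (i + 1) (shiftWord N w)).countP fun p => p.1 = i + 1 + 1) =
      (unmarried i w).countP fun p => p.1 = i + 1 := by
    rw [unmarried_shiftWord, List.countP_map]
    exact List.countP_congr fun p _ => by simp
  have hlt : ∀ p ∈ (unmarried i w).map Prod.snd, p < w.length := by
    intro p hp
    have h := ((unmarried_sublist i w).map Prod.snd).subset hp
    rw [List.zipIdx_map_snd, List.mem_range'_1] at h
    omega
  rw [wordSigma, wordSigma, hpos, hs]
  simp only [shiftWord]
  rw [List.mapIdx_append]
  congr 1
  · refine List.ext_getElem (by simp) fun k h1 h2 => ?_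
    simp only [List.getElem_mapIdx, List.getElem_map]
    split_ifs <;> rfl
  · refine List.ext_getElem (by simp) fun k h1 h2 => ?_
    rw [List.getElem_mapIdx, if_neg]
    intro h
    have := hlt _ h
    rw [List.length_map] at this
    omega

theorem count_shiftWord_succ (N j : ℕ) (w : List ℕ) :
    (shiftWord N w).count (j + 1) = w.count j := by
  rw [shiftWord, List.count_append, List.count_replicate, if_neg (by simp), add_zero,
    List.count_map_of_injective _ _ (add_left_injective 1)]

theorem count_shiftWord_zero (N : ℕ) (w : List ℕ) : (shiftWord N w).count 0 = N := by
  rw [shiftWord, List.count_append, List.count_replicate_self, List.count_eq_zero.mpr, zero_add]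
  simp

theorem condSigma_shiftWord_succ (i N : ℕ) (w : List ℕ) :
    condSigma (shiftWord N w) (i + 1) = shiftWord N (condSigma w i) := by
  rw [condSigma, condSigma, count_shiftWord_succ, count_shiftWord_succ]
  split_ifs
  · exact wordSigma_shiftWord i N w
  · rfl

/-- Nothing occurs more often than the appended letter, so the sorting never has to raise its count.
-/
theorem condSigma_shiftWord_zero {N : ℕ} {w : List ℕ} (h : w.count 0 ≤ N) :
    condSigma (shiftWord N w) 0 = shiftWord N w := by
  rw [condSigma, if_neg]
  rw [count_shiftWord_succ, count_shiftWord_zero]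
  omega

theorem count_condSigma_le {N : ℕ} {w : List ℕ} (h : ∀ j, w.count j ≤ N) (i j : ℕ) :
    (condSigma w i).count j ≤ N := by
  rw [condSigma]
  split_ifs
  · rw [count_wordSigma]
    split_ifs <;> exact h _
  · exact h j

theorem foldl_condSigma_shiftWord {N : ℕ} (l : List ℕ) {w : List ℕ} (h : ∀ j, w.count j ≤ N) :
    (l.map (· + 1)).foldl condSigma (shiftWord N w) = shiftWord N (l.foldl condSigma w) ∧
      ∀ j, (l.foldl condSigma w).count j ≤ N := by
  induction l generalizing w with
  | nil => exact ⟨rfl, h⟩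
  | cons i l ih =>
    rw [List.map_cons, List.foldl_cons, List.foldl_cons, condSigma_shiftWord_succ]
    exact ih (count_condSigma_le h i)

/-- Each insertion step for the longer alphabet is the raised old step followed by σ_0, which does
nothing. The bound N persists because σ_i only exchanges counts. -/
theorem makeDominant_shiftWord {N : ℕ} (m : ℕ) {w : List ℕ} (h : ∀ j, w.count j ≤ N) :
    makeDominant (m + 1) (shiftWord N w) = shiftWord N (makeDominant m w) ∧
      ∀ j, (makeDominant m w).count j ≤ N := by
  induction m with
  | zero => exact ⟨rfl, h⟩
  | succ m ih =>
    have e : ∀ (k : ℕ) (v : List ℕ), makeDominant (k + 1) v =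
        (List.range k).reverse.foldl condSigma (makeDominant k v) := by
      intro k v
      rw [makeDominant, List.range_succ, List.foldl_append]
      rfl
    have h1 := foldl_condSigma_shiftWord (List.range m).reverse ih.2
    rw [e (m + 1), e m w, ih.1, List.range_succ_eq_map, List.reverse_cons, List.foldl_append,
      ← List.map_reverse]
    change List.foldl condSigma (((List.range m).reverse.map (· + 1)).foldl condSigma _) [0] = _ ∧ _
    rw [h1.1]
    exact ⟨condSigma_shiftWord_zero (h1.2 0), h1.2⟩

/-- Every recursive step uses up a letter, so a step bound equal to the number of letters suffices.
-/
theorem chargeRound_length (n k l : ℕ) (b a : List ℕ) (h : b.length + a.length ≤ n) :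
    chargeRound (n + 1) k l b a = chargeRound n k l b a := by
  induction n generalizing k l b a with
  | zero =>
    have hb : b = [] := List.length_eq_zero_iff.mp (by omega)
    have ha : a = [] := List.length_eq_zero_iff.mp (by omega)
    subst hb ha
    rfl
  | succ n ih =>
    have hd : ∀ v : List ℕ, k ∈ v → (v.takeWhile (· ≠ k)).length +
        (v.dropWhile (· ≠ k)).tail.length + 1 = v.length := by
      intro v hv
      have h1 := congrArg List.length (List.takeWhile_append_dropWhile (p := (· ≠ k)) (l := v))
      rw [List.length_append] at h1
      have h2 : v.dropWhile (· ≠ k) ≠ [] := by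
        intro h3
        rw [List.dropWhile_eq_nil_iff] at h3
        simpa using h3 k hv
      have h4 := List.length_pos_iff.mpr h2
      rw [List.length_tail]
      omega
    conv_lhs => rw [chargeRound]
    conv_rhs => rw [chargeRound]
    split_ifs with h1 h2
    · have := hd a h1
      rw [ih]
      rw [List.length_append]
      omega
    · have := hd b h2
      rw [ih]
      rw [List.length_append]
      omega
    · rfl

theorem chargeRound_eq {n n' : ℕ} (k l : ℕ) (b a : List ℕ) (h : b.length + a.length ≤ n)
    (h' : b.length + a.length ≤ n') : chargeRound n k l b a = chargeRound n' k l b a := by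
  have key : ∀ p, chargeRound (b.length + a.length + p) k l b a =
      chargeRound (b.length + a.length) k l b a := by
    intro p
    induction p with
    | zero => rfl
    | succ p ih => rw [← add_assoc, chargeRound_length _ _ _ _ _ (by omega), ih]
  obtain ⟨p, rfl⟩ := Nat.exists_eq_add_of_le h
  obtain ⟨q, rfl⟩ := Nat.exists_eq_add_of_le h'
  rw [key, key]

/-! ### Rounds of labelling in the shifted word -/

theorem takeWhile_map_succ (k : ℕ) (v : List ℕ) :
    (v.map (· + 1)).takeWhile (· ≠ k + 1) = (v.takeWhile (· ≠ k)).map (· + 1) := by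
  rw [List.takeWhile_map]
  congr 2
  ext x
  simp

theorem dropWhile_map_succ (k : ℕ) (v : List ℕ) :
    (v.map (· + 1)).dropWhile (· ≠ k + 1) = (v.dropWhile (· ≠ k)).map (· + 1) := by
  rw [List.dropWhile_map]
  congr 2
  ext x
  simp

theorem mem_map_succ_iff (k : ℕ) (v : List ℕ) : k + 1 ∈ v.map (· + 1) ↔ k ∈ v := by simp

theorem mem_zeros_append_iff (N k : ℕ) (v : List ℕ) :
    k + 1 ∈ List.replicate N 0 ++ v.map (· + 1) ↔ k ∈ v := by
  rw [List.mem_append, mem_map_succ_iff, or_iff_right]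
  intro h
  exact absurd (List.eq_of_mem_replicate h) (by simp)

theorem takeWhile_zeros_append (N k : ℕ) (v : List ℕ) :
    (List.replicate N 0 ++ v.map (· + 1)).takeWhile (· ≠ k + 1) =
      List.replicate N 0 ++ (v.takeWhile (· ≠ k)).map (· + 1) := by
  rw [List.takeWhile_append_of_pos, takeWhile_map_succ]
  intro x hx
  rw [List.eq_of_mem_replicate hx]
  simp

theorem dropWhile_zeros_append (N k : ℕ) (v : List ℕ) :
    (List.replicate N 0 ++ v.map (· + 1)).dropWhile (· ≠ k + 1) =
      (v.dropWhile (· ≠ k)).map (· + 1) := by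
  rw [List.dropWhile_append_of_pos, dropWhile_map_succ]
  intro x hx
  rw [List.eq_of_mem_replicate hx]
  simp

/-- Past the start of a round only positive letters are sought, so zeros behind the reading head
stay there untouched. -/
theorem chargeRound_succ (N n k l : ℕ) (b a : List ℕ) :
    chargeRound n (k + 1) l (List.replicate N 0 ++ b.map (· + 1)) (a.map (· + 1)) =
      ((chargeRound n k l b a).1, List.replicate N 0 ++ (chargeRound n k l b a).2.map (· + 1)) := by
  induction n generalizing k l b a with
  | zero => simp [chargeRound]
  | succ n ih =>
    rw [chargeRound, chargeRound]
    simp only [mem_map_succ_iff, mem_zeros_append_iff]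
    split_ifs with h1 h2
    · have h := ih (k + 1) l (b ++ a.takeWhile (· ≠ k)) (a.dropWhile (· ≠ k)).tail
      rw [takeWhile_map_succ, dropWhile_map_succ, ← List.map_tail, List.append_assoc,
        ← List.map_append, h]
    · have h := ih (k + 1) (l + 1) (b.takeWhile (· ≠ k)) ((b.dropWhile (· ≠ k)).tail ++ a)
      rw [takeWhile_zeros_append, dropWhile_zeros_append, ← List.map_tail, ← List.map_append, h]
    · simp

/-- A round of labelling that starts with an additional letter `0` at the beginning. -/
theorem chargeRound_zeros (N n : ℕ) (v : List ℕ) (h0 : 0 ∈ v) (hn : v.length ≤ n) :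
    chargeRound (n + 1) 0 0 [] (List.replicate (N + 1) 0 ++ v.map (· + 1)) =
      ((chargeRound n 0 0 [] v).1,
        List.replicate N 0 ++ (chargeRound n 0 0 [] v).2.map (· + 1)) := by
  obtain ⟨n, rfl⟩ : ∃ p, n = p + 1 := ⟨n - 1, by
    have := List.length_pos_of_mem h0
    omega⟩
  -- The leading zero gets label 0 with nothing before it. The next letter 1 then lies ahead, so it
  -- too gets label 0, as the corresponding 0 does in v.
  have h1 : chargeRound (n + 1 + 1) 0 0 [] (List.replicate (N + 1) 0 ++ v.map (· + 1)) =
      chargeRound (n + 1) 1 0 [] (List.replicate N 0 ++ v.map (· + 1)) := by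
    rw [chargeRound, if_pos (by rw [List.replicate_succ]; simp)]
    simp only [List.replicate_succ, List.cons_append, List.nil_append]
    rw [List.takeWhile_cons_of_neg (by simp), List.dropWhile_cons_of_neg (by simp), List.tail_cons]
    simp
  rw [h1, chargeRound, chargeRound, if_pos ((mem_zeros_append_iff N 0 v).mpr h0), if_pos h0]
  have h := chargeRound_succ N n 1 0 (v.takeWhile (· ≠ 0)) (v.dropWhile (· ≠ 0)).tail
  have ht := takeWhile_zeros_append N 0 v
  have hd := dropWhile_zeros_append N 0 v
  simp only [zero_add] at ht hd
  simp only [List.nil_append, zero_add]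
  rw [ht, hd, ← List.map_tail, h]

theorem chargeRound_of_not_mem (n k l : ℕ) (a : List ℕ) (h : k ∉ a) :
    chargeRound n k l [] a = (0, a) := by
  cases n with
  | zero => rfl
  | succ n => rw [chargeRound, if_neg h, if_neg (by simp)]; rfl

theorem chargeRounds_of_not_mem (n : ℕ) (a : List ℕ) (h : 0 ∉ a) : chargeRounds n a = 0 := by
  induction n with
  | zero => rfl
  | succ n ih =>
    rw [chargeRounds, chargeRound_of_not_mem _ _ _ _ h]
    simpa using ih

theorem count_chargeRound_le (n k l j : ℕ) (b a : List ℕ) :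
    (chargeRound n k l b a).2.count j ≤ (b ++ a).count j := by
  induction n generalizing k l b a with
  | zero => exact le_rfl
  | succ n ih =>
    have hd : ∀ v : List ℕ, (v.takeWhile (· ≠ k)).count j + (v.dropWhile (· ≠ k)).tail.count j ≤
        v.count j := by
      intro v
      conv_rhs => rw [← List.takeWhile_append_dropWhile (p := (· ≠ k)) (l := v), List.count_append]
      have := (List.tail_sublist (v.dropWhile (· ≠ k))).count_le j
      omega
    rw [chargeRound]
    split_ifs
    · refine (ih _ _ _ _).trans ?_
      have := hd a
      simp only [List.count_append]
      omega
    · refine (ih _ _ _ _).trans ?_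
      have := hd b
      simp only [List.count_append]
      omega
    · exact le_rfl

theorem count_chargeRound_lt (n : ℕ) (v : List ℕ) (h0 : 0 ∈ v) (hn : v.length ≤ n) :
    (chargeRound n 0 0 [] v).2.count 0 < v.count 0 := by
  obtain ⟨n, rfl⟩ : ∃ p, n = p + 1 := ⟨n - 1, by
    have := List.length_pos_of_mem h0
    omega⟩
  rw [chargeRound, if_pos h0]
  refine (count_chargeRound_le _ _ _ _ _ _).trans_lt ?_
  conv_rhs => rw [← List.takeWhile_append_dropWhile (p := (· ≠ 0)) (l := v), List.count_append]
  simp only [List.nil_append, List.count_append]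
  have h2 : v.dropWhile (· ≠ 0) ≠ [] := by
    intro h3
    rw [List.dropWhile_eq_nil_iff] at h3
    simpa using h3 0 h0
  have h3 : (v.dropWhile (· ≠ 0)).head h2 = 0 := by
    have := List.head_dropWhile_not (p := (· ≠ 0)) (l := v) h2
    simpa using this
  have h4 : (v.dropWhile (· ≠ 0)).count 0 = (v.dropWhile (· ≠ 0)).tail.count 0 + 1 := by
    conv_lhs => rw [← List.cons_head_tail h2, h3]
    exact List.count_cons_self
  omega

/-- Each round uses one added zero together with one 0 of v while there are any; afterwards the
rounds contribute 0. The hypothesis v.count 0 ≤ N provides an added zero for every round of v, and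
n, n' only have to be large enough. -/
theorem chargeRounds_zeros (N : ℕ) (v : List ℕ) (n n' : ℕ) (h1 : v.count 0 ≤ N) (h2 : N ≤ n)
    (h3 : v.count 0 ≤ n') :
    chargeRounds n (List.replicate N 0 ++ v.map (· + 1)) = chargeRounds n' v := by
  induction N generalizing v n n' with
  | zero =>
    have h0 : 0 ∉ v := List.count_eq_zero.mp (by omega)
    rw [chargeRounds_of_not_mem n' v h0, chargeRounds_of_not_mem]
    simp
  | succ N ih =>
    obtain ⟨n, rfl⟩ : ∃ p, n = p + 1 := ⟨n - 1, by omega⟩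
    have hlen : (List.replicate (N + 1) 0 ++ v.map (· + 1)).length = v.length + N + 1 := by
      simp; omega
    by_cases h0 : 0 ∈ v
    · have hpos := List.count_pos_iff.mpr h0
      obtain ⟨n', rfl⟩ : ∃ p, n' = p + 1 := ⟨n' - 1, by omega⟩
      rw [chargeRounds, chargeRounds, hlen, chargeRound_zeros N _ v h0 (by omega),
        chargeRound_eq (n := v.length + N) (n' := v.length) 0 0 [] v (by simp) (by simp)]
      have hlt := count_chargeRound_lt v.length v h0 le_rfl
      simp only
      rw [ih _ n n' (by omega) (by omega) (by omega)]
    · have hz : v.count 0 = 0 := List.count_eq_zero.mpr h0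
      have hr : ∀ p, chargeRound (p + 1) 0 0 [] (List.replicate (N + 1) 0 ++ v.map (· + 1)) =
          (0, List.replicate N 0 ++ v.map (· + 1)) := by
        intro p
        rw [chargeRound, if_pos (by rw [List.replicate_succ]; simp)]
        simp only [List.replicate_succ, List.cons_append, List.nil_append]
        rw [List.takeWhile_cons_of_neg (by simp), List.dropWhile_cons_of_neg (by simp),
          List.tail_cons, chargeRound_of_not_mem _ _ _ _ fun h =>
            h0 ((mem_zeros_append_iff N 0 v).mp (by simpa using h))]
        simp
      rw [chargeRounds, hlen, hr]
      simp only
      rw [zero_add, ih v n n' (by omega) (by omega) h3]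

/-- Words are read from the right, so the appended zeros are met first. -/
theorem charge_shiftWord {N : ℕ} (m : ℕ) {w : List ℕ} (h : ∀ j, w.count j ≤ N) :
    charge (m + 1) (shiftWord N w) = charge m w := by
  have hm := makeDominant_shiftWord m h
  have hlen : ∀ k v, (makeDominant k v).length = v.length := by
    intro k v
    have hc : ∀ (u : List ℕ) i, (condSigma u i).length = u.length := by
      intro u i
      rw [condSigma]
      split_ifs
      · rw [wordSigma, List.length_mapIdx]
      · rfl
    have hl : ∀ (l u : List ℕ), (l.foldl condSigma u).length = u.length := by
      intro l
      induction l with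
      | nil => intro u; rfl
      | cons i l ih => intro u; rw [List.foldl_cons, ih, hc]
    have hl' : ∀ (l u : List ℕ), (l.foldl
        (fun w k => (List.range k).reverse.foldl condSigma w) u).length = u.length := by
      intro l
      induction l with
      | nil => intro u; rfl
      | cons i l ih => intro u; rw [List.foldl_cons, ih, hl]
    exact hl' _ _
  rw [charge, charge, hm.1]
  have hrev : (shiftWord N (makeDominant m w)).reverse =
      List.replicate N 0 ++ (makeDominant m w).reverse.map (· + 1) := by
    rw [shiftWord, List.reverse_append, List.reverse_replicate, List.map_reverse]
  rw [hrev]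
  refine chargeRounds_zeros N _ _ _ ?_ ?_ ?_
  · rw [List.count_reverse]; exact hm.2 0
  · rw [shiftWord, List.length_append, List.length_replicate]; omega
  · rw [← hlen m w, ← List.length_reverse]
    exact List.count_le_length

/-! ## Tableaux and the addition of a vanishing entry -/

section SnocZero

variable {m : ℕ}

theorem card_filter_snoc_zero (a : Fin m → ℕ) (c : ℕ) :
    (Finset.univ.filter fun i => c < (Fin.snoc a 0 : Fin (m + 1) → ℕ) i).card =
      (Finset.univ.filter fun i => c < a i).card := by
  rw [Finset.card_filter, Finset.card_filter, Fin.sum_univ_castSucc]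
  simp

theorem cup_snoc_zero (a : Fin m → ℕ) (lam : YoungDiagram) :
    cup (Fin.snoc a 0 : Fin (m + 1) → ℕ) lam = cup a lam :=
  diagram_ext_colLen fun c => by rw [colLen_cup, colLen_cup, card_filter_snoc_zero]

theorem MPart.snocZero_injective : Function.Injective (MPart.snocZero (m := m)) := by
  intro Λ Ω h
  have h1 : (Fin.snoc Λ.a 0 : Fin (m + 1) → ℕ) = Fin.snoc Ω.a 0 := congrArg MPart.a h
  refine MPart.ext (funext fun i => ?_) (by
    have h2 : Λ.snocZero.lam = Ω.snocZero.lam := congrArg MPart.lam h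
    exact h2)
  simpa using congrFun h1 i.castSucc

theorem MPart.snocZero_init (Λ : MPart (m + 1)) (h : Λ.a (Fin.last m) = 0) :
    Λ.init.snocZero = Λ := by
  refine MPart.ext ?_ rfl
  change (Fin.snoc (Fin.init Λ.a) 0 : Fin (m + 1) → ℕ) = Λ.a
  rw [← h]
  exact Fin.snoc_init_self Λ.a

theorem MPart.snocZero_last (Λ : MPart m) : Λ.snocZero.a (Fin.last m) = 0 := by
  simp [MPart.snocZero]

/-- The skew shapes of `Λ, Ω` and of `Λ⁰, Ω⁰` have the same cells. -/
def shapeEquiv (Λ Ω : MPart m) :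
    ↥((cup Λ.snocZero.a Λ.snocZero.lam).cells \ Ω.snocZero.lam.cells) ≃
      ↥((cup Λ.a Λ.lam).cells \ Ω.lam.cells) :=
  Equiv.subtypeEquivRight fun x => by
    change x ∈ (cup (Fin.snoc Λ.a 0 : Fin (m + 1) → ℕ) Λ.lam).cells \ Ω.lam.cells ↔ _
    rw [cup_snoc_zero]

theorem shapeEquiv_val (Λ Ω : MPart m) (x) : (shapeEquiv Λ Ω x).1 = x.1 := rfl

variable {Λ Ω : MPart m}

/-- A filling with the letters `1,…,m` as a filling with the letters `1,…,m+1`. -/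
def liftFilling (T : Filling Λ Ω) : Filling Λ.snocZero Ω.snocZero :=
  fun x => (T (shapeEquiv Λ Ω x)).castSucc

theorem liftFilling_apply (T : Filling Λ Ω) (x) :
    liftFilling T x = (T (shapeEquiv Λ Ω x)).castSucc := rfl

theorem liftFilling_symm (T : Filling Λ Ω) (x) :
    liftFilling T ((shapeEquiv Λ Ω).symm x) = (T x).castSucc := by
  rw [liftFilling_apply, Equiv.apply_symm_apply]

theorem liftFilling_injective : Function.Injective (liftFilling (Λ := Λ) (Ω := Ω)) := by
  intro T T' h
  funext x
  have h1 := congrFun h ((shapeEquiv Λ Ω).symm x)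
  rw [liftFilling_symm, liftFilling_symm] at h1
  exact Fin.castSucc_injective m h1

theorem MPart.snocZero_castSucc (Λ : MPart m) (i : Fin m) : Λ.snocZero.a i.castSucc = Λ.a i := by
  simp [MPart.snocZero]

theorem card_liftFilling (T : Filling Λ Ω) (i : Fin m) :
    (Finset.univ.filter fun x => liftFilling T x = i.castSucc).card =
      (Finset.univ.filter fun x => T x = i).card := by
  refine Finset.card_equiv (shapeEquiv Λ Ω) fun x => ?_
  simp only [Finset.mem_filter, Finset.mem_univ, true_and, liftFilling_apply,
    Fin.castSucc_inj]

theorem isTableau_liftFilling_iff (T : Filling Λ Ω) :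
    IsTableau Λ.snocZero Ω.snocZero (liftFilling T) ↔ IsTableau Λ Ω T := by
  have hcup : cup Λ.snocZero.a Λ.snocZero.lam = cup Λ.a Λ.lam := cup_snoc_zero Λ.a Λ.lam
  constructor
  · intro h
    refine ⟨?_, fun x y h1 h2 => ?_, fun x y h1 h2 => ?_, fun i => ?_, fun x => ?_⟩
    · have := h.contained
      rwa [hcup] at this
    · have := h.row_weak ((shapeEquiv Λ Ω).symm x) ((shapeEquiv Λ Ω).symm y) h1 h2
      rwa [liftFilling_symm, liftFilling_symm, Fin.castSucc_le_castSucc_iff] at this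
    · have := h.col_strict ((shapeEquiv Λ Ω).symm x) ((shapeEquiv Λ Ω).symm y) h1 h2
      rwa [liftFilling_symm, liftFilling_symm, Fin.castSucc_lt_castSucc_iff] at this
    · have := h.content i.castSucc
      rwa [card_liftFilling, MPart.snocZero_castSucc] at this
    · have := h.bounded ((shapeEquiv Λ Ω).symm x)
      rwa [liftFilling_symm, MPart.snocZero_castSucc] at this
  · intro h
    refine ⟨?_, fun x y h1 h2 => ?_, fun x y h1 h2 => ?_, fun i => ?_, fun x => ?_⟩
    · rw [hcup]
      exact h.contained
    · exact Fin.castSucc_le_castSucc_iff.mpr (h.row_weak _ _ h1 h2)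
    · exact Fin.castSucc_lt_castSucc_iff.mpr (h.col_strict _ _ h1 h2)
    · induction i using Fin.lastCases with
      | last =>
        rw [MPart.snocZero_last, Finset.card_eq_zero, Finset.filter_eq_empty_iff]
        exact fun x _ => (Fin.castSucc_lt_last _).ne
      | cast i => rw [card_liftFilling, MPart.snocZero_castSucc, h.content]
    · rw [liftFilling_apply, MPart.snocZero_castSucc]
      exact h.bounded (shapeEquiv Λ Ω x)

/-- The last letter would have to lie in the first 0 columns. -/
theorem IsTableau.exists_liftFilling {T : Filling Λ.snocZero Ω.snocZero}
    (hT : IsTableau Λ.snocZero Ω.snocZero T) : ∃ T' : Filling Λ Ω, liftFilling T' = T := by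
  have hne : ∀ x, T x ≠ Fin.last m := by
    intro x hx
    have := hT.bounded x
    rw [hx, MPart.snocZero_last] at this
    omega
  refine ⟨fun x => (T ((shapeEquiv Λ Ω).symm x)).castPred (hne _), funext fun x => ?_⟩
  rw [liftFilling_apply, Fin.castSucc_castPred, Equiv.symm_apply_apply]

/-- The barred last letter is absent as well: c < 0 fails for every column. -/
theorem barColumn_liftFilling (T : Filling Λ Ω) (c : ℕ) :
    barColumn (liftFilling T) c = (barColumn T c).map Fin.castSucc := by
  have h : (Finset.univ.filter fun i => c < Λ.snocZero.a i ∧ ∀ x, x.1.2 = c →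
      liftFilling T x ≠ i) = (Finset.univ.filter fun i => c < Λ.a i ∧ ∀ x, x.1.2 = c →
        T x ≠ i).map Fin.castSuccEmb := by
    ext i
    induction i using Fin.lastCases with
    | last =>
      simp [MPart.snocZero_last]
    | cast i =>
      have h1 : (∀ x, x.1.2 = c → liftFilling T x ≠ i.castSucc) ↔
          ∀ x, x.1.2 = c → T x ≠ i := by
        refine (shapeEquiv Λ Ω).forall_congr fun x => ?_
        rw [liftFilling_apply, Ne, Fin.castSucc_inj, shapeEquiv_val]
      simp only [Finset.mem_filter, Finset.mem_univ, true_and, MPart.snocZero_castSucc, h1,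
        Finset.mem_map, Fin.coe_castSuccEmb, Fin.castSucc_inj, exists_eq_right]
  rw [barColumn, barColumn, h]
  symm
  refine Finset.map_sort Fin.castSuccEmb _ _ _ ?_
  intro i _ j _
  exact Fin.castSucc_le_castSucc_iff.symm

theorem barWord_liftFilling (T : Filling Λ Ω) :
    barWord (liftFilling T) = (barWord T).map Fin.castSucc := by
  rw [barWord, barWord, List.map_flatMap]
  refine List.flatMap_congr fun r _ => ?_
  rw [List.map_filterMap]
  refine List.filterMap_congr fun c _ => ?_
  rw [barColumn_liftFilling, List.getElem?_map]
  rfl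

theorem sup_snoc_zero (a : Fin m → ℕ) :
    Finset.univ.sup (Fin.snoc a 0 : Fin (m + 1) → ℕ) = Finset.univ.sup a := by
  refine le_antisymm (Finset.sup_le fun i _ => ?_) (Finset.sup_le fun i _ => ?_)
  · induction i using Fin.lastCases with
    | last => simp
    | cast i =>
      rw [Fin.snoc_castSucc]
      exact Finset.le_sup (f := a) (Finset.mem_univ i)
  · have := Finset.le_sup (f := (Fin.snoc a 0 : Fin (m + 1) → ℕ)) (Finset.mem_univ i.castSucc)
    rwa [Fin.snoc_castSucc] at this

/-- The new entry is 0, so its barred letter occurs as often as the largest entry of a, at the end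
of the word. -/
theorem uWord_snoc_zero (a : Fin m → ℕ) :
    uWord (Fin.snoc a 0 : Fin (m + 1) → ℕ) =
      (uWord a).map Fin.castSucc ++ List.replicate (Finset.univ.sup a) (Fin.last m) := by
  rw [uWord, uWord, sup_snoc_zero, List.finRange_succ_last, List.flatMap_append, List.map_flatMap,
    List.flatMap_map]
  simp [List.flatMap]

theorem inv_snoc_zero (b : Fin m → ℕ) : inv (Fin.snoc b 0 : Fin (m + 1) → ℕ) = inv b := by
  rw [inv, inv]
  symm
  refine Finset.card_bij (fun p _ => (p.1.castSucc, p.2.castSucc)) ?_ ?_ ?_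
  · rintro ⟨i, j⟩ h
    simpa using h
  · rintro ⟨i, j⟩ _ ⟨i', j'⟩ _ h
    simpa using h
  · rintro ⟨i, j⟩ h
    simp only [Finset.mem_filter, Finset.mem_univ, true_and] at h
    obtain ⟨h1, h2⟩ := h
    induction j using Fin.lastCases with
    | last => simp at h2
    | cast j =>
      induction i using Fin.lastCases with
      | last => exact absurd h1 (Fin.castSucc_lt_last j).not_gt
      | cast i =>
        refine ⟨(i, j), ?_, rfl⟩
        simpa using And.intro h1 h2

theorem count_uWord (a : Fin m → ℕ) (i : Fin m) :
    (uWord a).count i = Finset.univ.sup a - a i := by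
  rw [uWord, List.count_flatMap]
  have : (List.map (List.count i ∘ fun i => List.replicate (Finset.univ.sup a - a i) i)
      (List.finRange m)).sum = ∑ j, if j = i then Finset.univ.sup a - a j else 0 := by
    rw [Fin.sum_univ_def]
    congr 1
    refine List.map_congr_left fun j _ => ?_
    simp [List.count_replicate]
  rw [this, Finset.sum_ite_eq' Finset.univ i]
  simp

theorem nodup_barColumn (T : Filling Λ Ω) (c : ℕ) : (barColumn T c).Nodup :=
  Finset.sort_nodup _ _

/-- A barred letter occurs at most once per column, in columns c < a_i. With the a_1 - a_i copies in
u_a this bounds each letter of the whole word by a_1, as `charge_shiftWord` requires. -/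
theorem count_barWord_le (T : Filling Λ Ω) (i : Fin m) : (barWord T).count i ≤ Λ.a i := by
  let L : List ℕ := (List.range (Ω.lam.colLen 0)).reverse.flatMap fun r =>
    (List.range' (Λ.lam.rowLen r) (Ω.lam.rowLen r - Λ.lam.rowLen r)).filter fun c =>
      (barColumn T c)[r - Λ.lam.colLen c]? = some i
  have hlen : (barWord T).count i = L.length := by
    rw [barWord, List.count_flatMap, List.length_flatMap]
    congr 1
    refine List.map_congr_left fun r _ => ?_
    rw [Function.comp_apply, List.count_filterMap, ← List.countP_eq_length_filter]
    refine List.countP_congr fun c _ => ?_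
    simp
  -- Beyond the end of row r of λ, column c of λ has height at most r, so the truncated subtraction
  -- in the row index is exact.
  have hmem : ∀ r c, c ∈ ((List.range' (Λ.lam.rowLen r)
      (Ω.lam.rowLen r - Λ.lam.rowLen r)).filter fun c =>
        (barColumn T c)[r - Λ.lam.colLen c]? = some i) →
      Λ.lam.colLen c ≤ r ∧ (barColumn T c)[r - Λ.lam.colLen c]? = some i := by
    intro r c h
    rw [List.mem_filter, List.mem_range'_1, decide_eq_true_eq] at h
    refine ⟨?_, h.2⟩
    by_contra hlt
    have := (lt_rowLen_iff_lt_colLen _ _ _).mpr (not_le.mp hlt)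
    omega
  have hnodup : L.Nodup := by
    rw [List.nodup_flatMap]
    refine ⟨fun r _ => List.Nodup.filter _ List.nodup_range', ?_⟩
    refine List.Nodup.pairwise_of_forall_ne (List.nodup_reverse.mpr List.nodup_range) ?_
    intro r _ s _ hrs c h1 h2
    obtain ⟨h3, h4⟩ := hmem r c h1
    obtain ⟨h5, h6⟩ := hmem s c h2
    rw [List.getElem?_eq_some_iff] at h4 h6
    obtain ⟨h7, h8⟩ := h4
    obtain ⟨h9, h10⟩ := h6
    have := (nodup_barColumn T c).getElem_inj_iff.mp (h8.trans h10.symm)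
    omega
  have hsub : L.toFinset ⊆ Finset.range (Λ.a i) := by
    intro c hc
    rw [List.mem_toFinset, List.mem_flatMap] at hc
    obtain ⟨r, _, h⟩ := hc
    have h1 := List.mem_of_getElem? (hmem r c h).2
    rw [barColumn, Finset.mem_sort, Finset.mem_filter] at h1
    exact Finset.mem_range.mpr h1.2.1
  rw [hlen, ← List.toFinset_card_of_nodup hnodup]
  exact (Finset.card_le_card hsub).trans_eq (Finset.card_range _)

/-- With one more letter, the reversal sends old letters one higher and the new letter to 0, so the
word becomes `shiftWord` of the old one. -/
theorem tableauCharge_liftFilling (T : Filling Λ Ω) :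
    tableauCharge (liftFilling T) = tableauCharge T := by
  have hword : (barWord (liftFilling T) ++ uWord Λ.snocZero.a).map (fun i => (Fin.rev i : ℕ)) =
      shiftWord (Finset.univ.sup Λ.a)
        ((barWord T ++ uWord Λ.a).map fun i => (Fin.rev i : ℕ)) := by
    change (barWord (liftFilling T) ++ uWord (Fin.snoc Λ.a 0 : Fin (m + 1) → ℕ)).map _ = _
    rw [barWord_liftFilling, uWord_snoc_zero, ← List.append_assoc, ← List.map_append,
      List.map_append, shiftWord, List.map_map, List.map_map, List.map_replicate, Fin.rev_last]
    congr 1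
    refine List.map_congr_left fun i _ => ?_
    simp only [Function.comp_apply, Fin.rev_castSucc, Fin.val_succ]
  have hcount : ∀ j, ((barWord T ++ uWord Λ.a).map fun i => (Fin.rev i : ℕ)).count j ≤
      Finset.univ.sup Λ.a := by
    intro j
    by_cases hj : j < m
    · have hinj : Function.Injective fun i : Fin m => (Fin.rev i : ℕ) :=
        Fin.val_injective.comp Fin.rev_injective
      have h1 : j = (fun i : Fin m => (Fin.rev i : ℕ)) (Fin.rev ⟨j, hj⟩) := by simp
      rw [h1, List.count_map_of_injective _ _ hinj, List.count_append, count_uWord]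
      have h2 := count_barWord_le T (Fin.rev ⟨j, hj⟩)
      have h3 : Λ.a (Fin.rev ⟨j, hj⟩) ≤ Finset.univ.sup Λ.a := Finset.le_sup (Finset.mem_univ _)
      omega
    · rw [List.count_eq_zero.mpr]
      · exact Nat.zero_le _
      · intro h
        rw [List.mem_map] at h
        obtain ⟨i, _, rfl⟩ := h
        exact hj (Fin.is_lt _)
  rw [tableauCharge, tableauCharge, hword, charge_shiftWord m hcount]
  congr 1
  exact inv_snoc_zero Ω.a

theorem dominantD_snocZero (Λ Ω : MPart m) :
    dominantD Λ.snocZero Ω.snocZero = dominantD Λ Ω := by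
  classical
  rw [dominantD, dominantD]
  symm
  refine Finset.sum_bij (fun T _ => liftFilling T) ?_ ?_ ?_ ?_
  · intro T hT
    rw [Finset.mem_filter] at hT ⊢
    exact ⟨Finset.mem_univ _, (isTableau_liftFilling_iff T).mpr hT.2⟩
  · exact fun T _ T' _ h => liftFilling_injective h
  · intro T hT
    rw [Finset.mem_filter] at hT
    obtain ⟨T', rfl⟩ := hT.2.exists_liftFilling
    exact ⟨T', Finset.mem_filter.mpr
      ⟨Finset.mem_univ _, (isTableau_liftFilling_iff T').mp hT.2⟩, rfl⟩
  · intro T _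
    rw [tableauCharge_liftFilling]

end SnocZero

/-! ## The inclusion of the dual `m`-symmetric Schur functions -/

section Inclusion

variable {m : ℕ}

theorem swapAt_snoc_zero (a : Fin m → ℕ) {i : ℕ} (hi : i + 1 < m) :
    swapAt (Fin.snoc a 0 : Fin (m + 1) → ℕ) i (by omega) = Fin.snoc (swapAt a i hi) 0 := by
  funext j
  rw [swapAt_apply]
  have h1 : (Fin.snoc a 0 : Fin (m + 1) → ℕ) ⟨i + 1, by omega⟩ = a ⟨i + 1, hi⟩ :=
    Fin.snoc_castSucc (α := fun _ => ℕ) 0 a ⟨i + 1, hi⟩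
  have h2 : (Fin.snoc a 0 : Fin (m + 1) → ℕ) ⟨i, by omega⟩ = a ⟨i, by omega⟩ :=
    Fin.snoc_castSucc (α := fun _ => ℕ) 0 a ⟨i, by omega⟩
  rw [h1, h2]
  induction j using Fin.lastCases with
  | last =>
    rw [Fin.snoc_last, Fin.snoc_last, if_neg, if_neg]
    · simp; omega
    · simp; omega
  | cast j => rw [Fin.snoc_castSucc, Fin.snoc_castSucc, swapAt_apply, Fin.val_castSucc]

theorem isAscent_snoc_zero {a : Fin m → ℕ} {i : ℕ} (h : IsAscent a i) :
    IsAscent (Fin.snoc a 0 : Fin (m + 1) → ℕ) i := by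
  obtain ⟨hi, hlt⟩ := h
  refine ⟨by omega, ?_⟩
  have h1 : (Fin.snoc a 0 : Fin (m + 1) → ℕ) ⟨i + 1, by omega⟩ = a ⟨i + 1, hi⟩ :=
    Fin.snoc_castSucc (α := fun _ => ℕ) 0 a ⟨i + 1, hi⟩
  have h2 : (Fin.snoc a 0 : Fin (m + 1) → ℕ) ⟨i, by omega⟩ = a ⟨i, by omega⟩ :=
    Fin.snoc_castSucc (α := fun _ => ℕ) 0 a ⟨i, by omega⟩
  rwa [h1, h2]

theorem antitone_snoc_zero {a : Fin m → ℕ} (h : Antitone a) :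
    Antitone (Fin.snoc a 0 : Fin (m + 1) → ℕ) := by
  intro i j hij
  induction j using Fin.lastCases with
  | last => simp
  | cast j =>
    induction i using Fin.lastCases with
    | last => exact absurd hij (Fin.castSucc_lt_last j).not_ge
    | cast i =>
      rw [Fin.snoc_castSucc, Fin.snoc_castSucc]
      exact h (Fin.castSucc_le_castSucc_iff.mp hij)

theorem incl_xPow (a : Fin m → ℕ) : incl m (xPow a) = xPow (Fin.snoc a 0 : Fin (m + 1) → ℕ) := by
  refine Subtype.ext ?_
  change monomial _ _ = monomial _ _
  congr 1
  have happ : ∀ {n : ℕ} (b : Fin n → ℕ) (j : ℕ), Finsupp.embDomain Fin.valEmbedding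
      (Finsupp.equivFunOnFinite.symm b) j = if h : j < n then b ⟨j, h⟩ else 0 := by
    intro n b j
    split_ifs with h
    · exact Finsupp.embDomain_apply_self Fin.valEmbedding (Finsupp.equivFunOnFinite.symm b) ⟨j, h⟩
    · refine Finsupp.embDomain_of_notMem_range _ _ _ ?_
      rintro ⟨x, rfl⟩
      exact h x.2
  congr 1
  ext j
  rw [happ, happ]
  split_ifs with h1 h2 h2
  · exact (Fin.snoc_castSucc (α := fun _ => ℕ) 0 a ⟨j, h1⟩).symm
  · omega
  · obtain rfl : j = m := by omega
    exact (Fin.snoc_last (α := fun _ => ℕ) 0 a).symm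
  · rfl

/-- T_i is the same operator on power series for all m. -/
theorem incl_heckeT {i : ℕ} (hi : i + 1 < m) (f : R m) :
    incl m (heckeT m i hi f) = heckeT (m + 1) i (by omega) (incl m f) := Subtype.ext rfl

theorem incl_hallLittlewood (a : Fin m → ℕ) :
    incl m (hallLittlewood a) = hallLittlewood (Fin.snoc a 0 : Fin (m + 1) → ℕ) := by
  induction hn : sortMeasure a using Nat.strong_induction_on generalizing a with
  | _ n ih =>
  subst hn
  by_cases h : ∃ i, IsAscent a i
  · obtain ⟨i, h⟩ := h
    rw [hallLittlewood_of_ascent a i h, incl_heckeT, ih _ (sortMeasure_swapAt a i h) _ rfl,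
      hallLittlewood_of_ascent _ i (isAscent_snoc_zero h), swapAt_snoc_zero]
  · have h1 := antitone_of_no_ascent h
    rw [hallLittlewood_of_antitone h1, hallLittlewood_of_antitone (antitone_snoc_zero h1),
      incl_xPow]

theorem incl_schurFn (lam : YoungDiagram) : incl m (schurFn m lam) = schurFn (m + 1) lam := by
  rw [schurFn, schurFn, AlgHom.map_det]
  rfl

theorem incl_kFun (Λ : MPart m) : incl m (kFun Λ) = kFun Λ.snocZero := by
  rw [kFun, kFun, map_mul, incl_hallLittlewood, incl_schurFn]
  rfl

theorem MPart.snocZero_swap (Λ : MPart m) {i : ℕ} (hi : i + 1 < m) :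
    Λ.snocZero.swap i (by omega) = (Λ.swap i hi).snocZero :=
  MPart.ext (swapAt_snoc_zero Λ.a hi) rfl

theorem incl_starVal {i : ℕ} (hi : i + 1 < m) (Λ : MPart m) :
    incl m (starVal i hi Λ) = starVal i (by omega) Λ.snocZero := by
  have h1 : Λ.snocZero.a ⟨i + 1, by omega⟩ = Λ.a ⟨i + 1, hi⟩ := Λ.snocZero_castSucc ⟨i + 1, hi⟩
  have h2 : Λ.snocZero.a ⟨i, by omega⟩ = Λ.a ⟨i, by omega⟩ := Λ.snocZero_castSucc ⟨i, by omega⟩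
  rw [starVal, starVal, h1, h2, MPart.snocZero_swap Λ hi, ← incl_kFun, ← incl_kFun]
  split_ifs <;> simp only [map_add, map_smul]

/-- The adjoint depends on the form, hence on m; the comparison therefore uses its explicit values
on the basis k. -/
theorem incl_heckeTStar {i : ℕ} (hi : i + 1 < m) (f : R m) :
    incl m (heckeTStar m i hi f) = heckeTStar (m + 1) i (by omega) (incl m f) := by
  have h : (incl m).toLinearMap ∘ₗ heckeTStar m i hi =
      heckeTStar (m + 1) i (by omega) ∘ₗ (incl m).toLinearMap := by
    refine (kBasis m).ext fun Λ => ?_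
    rw [kBasis_apply]
    change incl m (heckeTStar m i hi (kFun Λ)) = heckeTStar (m + 1) i _ (incl m (kFun Λ))
    rw [heckeTStar_kFun, incl_kFun, heckeTStar_kFun, incl_starVal]
  exact LinearMap.congr_fun h f

theorem dominantD_eq_zero_of_last {Λ : MPart m} {Ω : MPart (m + 1)}
    (h : 0 < Ω.a (Fin.last m)) : dominantD Λ.snocZero Ω = 0 := by
  by_contra hne
  obtain ⟨T, hT⟩ := exists_isTableau_of_dominantD_ne_zero hne
  have := hT.le (Fin.last m)
  rw [MPart.snocZero_last] at this
  omega

/-- The inclusion `R_m → R_{m+1}` sends `s^*_Λ` to `s^*_{Λ⁰}`. -/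
theorem incl_dualSchur (Λ : MPart m) : incl m (dualSchur Λ) = dualSchur Λ.snocZero := by
  obtain ⟨a, lam⟩ := Λ
  induction hn : sortMeasure a using Nat.strong_induction_on generalizing a with
  | _ n ih =>
  subst hn
  by_cases h : ∃ i, IsAscent a i
  · obtain ⟨i, h⟩ := h
    have h1 := ih _ (sortMeasure_swapAt a i h) _ rfl
    rw [dualSchur_of_ascent ⟨a, lam⟩ i h, map_smul, incl_heckeTStar,
      dualSchur_of_ascent (MPart.snocZero ⟨a, lam⟩) i (isAscent_snoc_zero h), MPart.snocZero_swap ⟨a, lam⟩ h.1]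
    exact congrArg (fun f => tt⁻¹ • heckeTStar (m + 1) i _ f) h1
  · have h1 := antitone_of_no_ascent h
    set Λ : MPart m := ⟨a, lam⟩ with hΛ
    have h2 : Antitone Λ.snocZero.a := antitone_snoc_zero h1
    have hfin : (Function.support fun Ω : MPart m => dominantD Λ Ω • kFun Ω).Finite :=
      (Finset.finite_toSet _).subset (support_dominantD_subset Λ)
    rw [dualSchur_of_antitone (Λ := Λ) h1, dualSchur_of_antitone h2, map_finsum _ hfin]
    have h3 : ∀ Ω : MPart m, incl m (dominantD Λ Ω • kFun Ω) =
        dominantD Λ.snocZero Ω.snocZero • kFun Ω.snocZero := fun Ω => by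
      rw [map_smul, incl_kFun, dominantD_snocZero]
    -- The sum over R_m becomes the part of the sum for Λ⁰ over indices Ω⁰; all other coefficients
    -- vanish because b_{m+1} > 0.
    rw [finsum_congr h3,
      ← finsum_mem_range (f := fun Ω => dominantD Λ.snocZero Ω • kFun Ω) MPart.snocZero_injective]
    refine (finsum_mem_inter_support_eq' _ _ Set.univ fun Ω hΩ => ?_).trans (finsum_mem_univ _)
    refine iff_of_true ?_ trivial
    refine ⟨Ω.init, MPart.snocZero_init Ω ?_⟩
    by_contra hne
    exact left_ne_zero_of_smul hΩ (dominantD_eq_zero_of_last (Nat.pos_of_ne_zero hne))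

end Inclusion

/-! ## The restriction of the `m`-symmetric Schur functions -/

/-- Setting x_i = 0 keeps exactly the coefficients of monomials without x_i. -/
theorem restrPS_eq_zero_iff (i : ℕ) (f : PS) : restrPS i f = 0 ↔ X i ∣ f := by
  have hr : ∀ j, j ≠ i → j ∈ Set.range (skip i) := by
    intro j hj
    rcases lt_or_gt_of_ne hj with h | h
    · exact ⟨j, by rw [skip_apply, if_pos h]⟩
    · exact ⟨j - 1, by rw [skip_apply, if_neg (by omega)]; omega⟩
  rw [X_dvd_iff]
  constructor
  · intro h d hd
    have hs : ↑d.support ⊆ Set.range (skip i) := by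
      intro j hj
      refine hr j ?_
      rintro rfl
      exact Finsupp.mem_support_iff.mp hj hd
    have h1 := congrArg (coeff (d.comapDomain (skip i) (skip i).injective.injOn)) h
    rwa [restrPS, coeff_killCompl, Finsupp.embDomain_comapDomain hs, map_zero] at h1
  · intro h
    ext d
    rw [restrPS, coeff_killCompl, map_zero]
    refine h _ (Finsupp.embDomain_of_notMem_range _ _ _ ?_)
    rintro ⟨j, hj⟩
    rw [skip_apply] at hj
    split_ifs at hj <;> omega

/-- x_i is prime, since it generates the kernel of a homomorphism to a domain. -/
theorem X_dvd_of_X_dvd_mul {i : ℕ} {f g : PS} (hf : ¬ X i ∣ f) (h : X i ∣ f * g) : X i ∣ g := by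
  rw [← restrPS_eq_zero_iff] at *
  rw [map_mul] at h
  exact (mul_eq_zero.mp h).resolve_left hf

theorem not_X_dvd_X_sub_X {i j k : ℕ} (hjk : j ≠ k) : ¬ (X i : PS) ∣ X j - X k := by
  classical
  rw [X_dvd_iff]
  intro h
  rcases eq_or_ne i j with rfl | hij
  · have h1 := h (Finsupp.single k 1) (by simp [hjk.symm])
    rw [map_sub, coeff_index_single_X, coeff_index_single_X] at h1
    simp [hjk.symm] at h1
  · have h1 := h (Finsupp.single j 1) (by simp [hij.symm])
    rw [map_sub, coeff_index_single_X, coeff_index_single_X] at h1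
    simp [hjk] at h1

theorem X_dvd_xPow {m : ℕ} {a : Fin m → ℕ} {i : Fin m} (h : 0 < a i) :
    (X (i : ℕ) : PS) ∣ (xPow a : PS) := by
  classical
  rw [X_dvd_iff]
  intro d hd
  change coeff d (monomial _ _) = 0
  rw [coeff_monomial, if_neg]
  rintro rfl
  have h1 := Finsupp.embDomain_apply_self Fin.valEmbedding (Finsupp.equivFunOnFinite.symm a) i
  change _ = a i at h1
  change Finsupp.embDomain Fin.valEmbedding (Finsupp.equivFunOnFinite.symm a)
    (Fin.valEmbedding i) = 0 at hd
  omega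

theorem X_dvd_exch {i j k : ℕ} {f : PS} (h : X (Equiv.swap i j k) ∣ f) : X k ∣ exch i j f := by
  have h1 := map_dvd (exch i j) h
  rwa [exch_X, Equiv.swap_apply_self] at h1

/-- T_j preserves this divisibility: the cleared formula exhibits x_i in its right side, and x_i
does not divide the denominator x_j - x_{j+1}. If i = j+1, the first term has x_{j+1} as an explicit
factor. -/
theorem X_dvd_hallLittlewood {m : ℕ} {a : Fin m → ℕ} {i : Fin m} (h : 0 < a i) :
    (X (i : ℕ) : PS) ∣ (hallLittlewood a : PS) := by
  induction hn : sortMeasure a using Nat.strong_induction_on generalizing a i with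
  | _ n ih =>
  subst hn
  by_cases hasc : ∃ j, IsAscent a j
  · obtain ⟨j, hj, hlt⟩ := hasc
    have ih' : ∀ {k : Fin m}, 0 < swapAt a j hj k →
        (X (k : ℕ) : PS) ∣ (hallLittlewood (swapAt a j hj) : PS) := fun hk =>
      ih _ (sortMeasure_swapAt a j ⟨hj, hlt⟩) hk rfl
    rw [hallLittlewood_of_ascent a j ⟨hj, hlt⟩]
    refine X_dvd_of_X_dvd_mul (not_X_dvd_X_sub_X (j := j) (k := j + 1) (by omega)) ?_
    rw [heckeT_spec]
    rcases eq_or_ne (i : ℕ) (j + 1) with hi | hi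
    · have h1 := ih' (k := ⟨j, by omega⟩) (by
        rw [swapAt_left]
        omega)
      rw [hi]
      refine dvd_add (Dvd.dvd.mul_right (dvd_mul_left _ _) _) (Dvd.dvd.mul_left (X_dvd_exch ?_) _)
      rwa [Equiv.swap_apply_right]
    rcases eq_or_ne (i : ℕ) j with hi' | hi'
    · have h0 : a ⟨j, by omega⟩ = a i := congrArg a (Fin.ext hi'.symm)
      have h1 := ih' (k := ⟨j, by omega⟩) (by rw [swapAt_left]; omega)
      have h2 := ih' (k := ⟨j + 1, hj⟩) (by rw [swapAt_right]; omega)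
      rw [hi']
      refine dvd_add (Dvd.dvd.mul_left h1 _) (Dvd.dvd.mul_left (X_dvd_exch ?_) _)
      rwa [Equiv.swap_apply_left]
    · have h1 := ih' (k := i) (by rwa [swapAt_of_ne a hj i hi' hi])
      refine dvd_add (Dvd.dvd.mul_left h1 _) (Dvd.dvd.mul_left (X_dvd_exch ?_) _)
      rwa [Equiv.swap_apply_of_ne_of_ne hi' hi]
  · rw [hallLittlewood_of_antitone (antitone_of_no_ascent hasc)]
    exact X_dvd_xPow h

theorem restr_kFun_of_pos {m : ℕ} {Λ : MPart (m + 1)} (h : 0 < Λ.a (Fin.last m)) :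
    restr m (kFun Λ) = 0 := by
  have h1 : restr m (hallLittlewood Λ.a) = 0 :=
    Subtype.ext ((restrPS_eq_zero_iff m _).mpr (X_dvd_hallLittlewood (i := Fin.last m) h))
  rw [kFun, map_mul, h1, zero_mul]

theorem mtype_embDomain_skip (m : ℕ) (d : ℕ →₀ ℕ) :
    mtype m (d.embDomain (skip m)) = mtype m d := by
  rw [mtype_eq_iff]
  refine ⟨fun i => ?_, fun c => ?_⟩
  · have h : skip m i = i := by rw [skip_apply, if_pos i.2]
    conv_lhs => rw [← h]
    exact Finsupp.embDomain_apply_self _ _ _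
  · rw [colLen_mtype, tailCount, tailCount]
    symm
    refine Finset.card_bij (fun j _ => skip m j) ?_ ?_ ?_
    · intro j hj
      rw [Finset.mem_filter] at hj ⊢
      rw [Finsupp.support_embDomain, Finsupp.embDomain_apply_self]
      refine ⟨Finset.mem_map_of_mem _ hj.1, ?_, hj.2.2⟩
      rw [skip_apply]
      split_ifs <;> omega
    · exact fun _ _ _ _ h => (skip m).injective h
    · intro j hj
      rw [Finset.mem_filter, Finsupp.support_embDomain, Finset.mem_map] at hj
      obtain ⟨⟨k, hk, rfl⟩, h1, h2⟩ := hj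
      rw [Finsupp.embDomain_apply_self] at h2
      refine ⟨k, Finset.mem_filter.mpr ⟨hk, ?_, h2⟩, rfl⟩
      rw [skip_apply] at h1
      split_ifs at h1 <;> omega

/-- A function symmetric from x_{m+1} on keeps its coefficients when a tail variable with exponent 0
is skipped, because the orbit stays the same. -/
theorem restr_incl {m : ℕ} (f : R m) : restr m (incl m f) = f := by
  refine Subtype.ext ?_
  change restrPS m (f : PS) = f
  ext d
  rw [restrPS, coeff_killCompl, coeff_eq_coeff_expo, mtype_embDomain_skip, ← coeff_eq_coeff_expo]

theorem restr_kFun_of_eq_zero {m : ℕ} {Λ : MPart (m + 1)} (h : Λ.a (Fin.last m) = 0) :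
    restr m (kFun Λ) = kFun Λ.init := by
  conv_lhs => rw [← MPart.snocZero_init Λ h, ← incl_kFun, restr_incl]

/-- The restriction and the inclusion are adjoint to each other. -/
theorem scalarProduct_restr {m : ℕ} (f : R (m + 1)) (g : R m) :
    scalarProduct m (restr m f) g = scalarProduct (m + 1) f (incl m g) := by
  classical
  have h : (scalarProduct m).compl₁₂ (restr m).toLinearMap LinearMap.id =
      (scalarProduct (m + 1)).compl₁₂ LinearMap.id (incl m).toLinearMap := by
    refine (kBasis (m + 1)).ext fun Λ => (kBasis m).ext fun Ω => ?_
    rw [kBasis_apply, kBasis_apply]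
    change scalarProduct m (restr m (kFun Λ)) (kFun Ω) =
      scalarProduct (m + 1) (kFun Λ) (incl m (kFun Ω))
    rw [incl_kFun, scalarProduct_kFun_kFun]
    rcases Nat.eq_zero_or_pos (Λ.a (Fin.last m)) with h0 | h0
    · rw [restr_kFun_of_eq_zero h0, scalarProduct_kFun_kFun]
      conv_rhs => rw [← MPart.snocZero_init Λ h0]
      exact if_congr MPart.snocZero_injective.eq_iff.symm rfl rfl
    · rw [restr_kFun_of_pos h0, map_zero, LinearMap.zero_apply, if_neg]
      rintro rfl
      rw [MPart.snocZero_last] at h0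
      omega
  exact LinearMap.congr_fun₂ h f g

-- Adjointness of r and i moves the restriction onto s^*_Ω, where the inclusion theorem applies; as
-- the s^*_Ω span, these pairings determine r(s_Λ).
open Classical in
theorem scalarProduct_restr_schur {m : ℕ} (Λ : MPart (m + 1)) (Ω : MPart m) :
    scalarProduct m (restr m (schur Λ)) (dualSchur Ω) = if Λ = Ω.snocZero then 1 else 0 := by
  rw [scalarProduct_restr, incl_dualSchur]
  exact isSchurFamily_schur (m + 1) Λ Ω.snocZero

theorem restr_schur_of_pos {m : ℕ} {Λ : MPart (m + 1)} (h : 0 < Λ.a (Fin.last m)) :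
    restr m (schur Λ) = 0 := by
  classical
  refine eq_of_scalarProduct_dualSchur fun Ω => ?_
  rw [scalarProduct_restr_schur, map_zero, LinearMap.zero_apply, if_neg]
  rintro rfl
  rw [MPart.snocZero_last] at h
  omega

theorem restr_schur_of_eq_zero {m : ℕ} {Λ : MPart (m + 1)} (h : Λ.a (Fin.last m) = 0) :
    restr m (schur Λ) = schur Λ.init := by
  classical
  refine eq_of_scalarProduct_dualSchur fun Ω => ?_
  rw [scalarProduct_restr_schur, isSchurFamily_schur m Λ.init Ω]
  conv_lhs => rw [← MPart.snocZero_init Λ h]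
  exact if_congr MPart.snocZero_injective.eq_iff rfl rfl

end MSym

theorem mainTheorem9 :
    -- the objects in the statement are well defined
    (∀ m : ℕ,
      (∀ (a : Fin m → ℕ) (i : ℕ) (h : MSym.IsAscent a i),
        MSym.hallLittlewood a = MSym.heckeT m i h.1 (MSym.hallLittlewood (MSym.swapAt a i h.1))) ∧
      (∃! B, MSym.IsScalarProduct m B) ∧
      MSym.IsScalarProduct m (MSym.scalarProduct m) ∧
      (∀ (i : ℕ) (hi : i + 1 < m),
        (∃! S, MSym.IsHeckeAdjoint m i hi S) ∧
        MSym.IsHeckeAdjoint m i hi (MSym.heckeTStar m i hi)) ∧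
      (∀ (Λ : MSym.MPart m) (i : ℕ) (h : MSym.IsAscent Λ.a i),
        MSym.dualSchur Λ = MSym.tt⁻¹ • MSym.heckeTStar m i h.1
          (MSym.dualSchur ⟨MSym.swapAt Λ.a i h.1, Λ.lam⟩)) ∧
      (∃! s, MSym.IsSchurFamily m s) ∧
      MSym.IsSchurFamily m MSym.schur) ∧
    -- the inclusion of the dual `m`-symmetric Schur functions
    (∀ (m : ℕ) (Λ : MSym.MPart m),
      MSym.incl m (MSym.dualSchur Λ) = MSym.dualSchur Λ.snocZero) ∧
    -- the restriction of the `m`-symmetric Schur functions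
    (∀ (m : ℕ) (Λ : MSym.MPart (m + 1)),
      (0 < Λ.a (Fin.last m) → MSym.restr m (MSym.schur Λ) = 0) ∧
      (Λ.a (Fin.last m) = 0 → MSym.restr m (MSym.schur Λ) = MSym.schur Λ.init)) := by
  refine ⟨fun m => ⟨MSym.hallLittlewood_of_ascent, ?_, MSym.isScalarProduct_scalarProduct m,
    fun i hi => ⟨?_, MSym.isHeckeAdjoint_heckeTStar m i hi⟩, MSym.dualSchur_of_ascent, ?_,
    MSym.isSchurFamily_schur m⟩, fun m Λ => MSym.incl_dualSchur Λ,
    fun m Λ => ⟨MSym.restr_schur_of_pos, MSym.restr_schur_of_eq_zero⟩⟩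
  · exact ⟨_, MSym.isScalarProduct_scalarProduct m,
      fun _ h => h.eq (MSym.isScalarProduct_scalarProduct m)⟩
  · exact ⟨_, MSym.isHeckeAdjoint_heckeTStar m i hi,
      fun _ h => h.eq (MSym.isHeckeAdjoint_heckeTStar m i hi)⟩
  · exact ⟨_, MSym.isSchurFamily_schur m, fun _ h => h.eq (MSym.isSchurFamily_schur m)⟩
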